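/- Let $p$ be a prime, let $(A,\delta)$ be a crystalline prism (a $p$-torsion free, $p$-adically complete ring with a $\delta$-structure) and put $\phi_A(x)=x^p+p\delta(x)$. Let $Y$ be a smooth $p$-adic formal $A$-scheme, let $\mathfrak X$ be a separated scheme of finite type over $A/p$, and let $i:\mathfrak X\to Y$ be a closed immersion over $A$ such that, Zariski locally on $Y$, $\mathfrak X$ is defined in $Y\otimes_A A/p$ by a complete intersection sequence (a finite sequence that is regular in the local ring at each prime containing it). Let $\phi_Y$ be a lift, compatible with $\phi_A$, of the absolute Frobenius of $Y\otimes_A A/p$ to $Y\otimes_A A/p^2$. For a ring $R$ with an endomorphism $\phi$ and an ideal $I$, let $\delta(x)=(\phi(x)-x^p)/p$ on $R[1/p]$, and let $\mathrm{Prism}_{R,\phi}(I)$ (the prismatic envelope) be the $p$-adic completion of the subring $R[\delta^j(x/p): x\in I,\ j\ge 0]$ of $R[1/p]$. For a ring $S$ and $g\in S$ write $\widehat S_g$ for the $p$-adic completion of $S[1/g]$. Then for each affinoid open $U=\mathrm{Spf}(R)\subset Y$ the restriction of $\phi_Y$ to $R/p^2$ lifts to an endomorphism of the ring $R$, and there are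 a sheaf of rings $\mathrm{Prism}_Y(\mathfrak X)$ on the underlying space of $\mathfrak X$ and a map of sheaves of rings $\theta:\mathcal O_Y\to i_*\mathrm{Prism}_Y(\mathfrak X)$ such that: (1) For each affinoid open $U=\mathrm{Spf}(R)\subset Y$ and each ring endomorphism $\phi$ of $R$ lifting the restriction of $\phi_Y$ to $R/p^2$, there is an isomorphism of $R$-algebras $\Gamma(\mathfrak X\cap U,\mathrm{Prism}_Y(\mathfrak X))\cong\mathrm{Prism}_{R,\phi}(I)$, where $I\subset R$ is the ideal defining $\mathfrak X\cap U$. The pair $(\mathrm{Prism}_Y(\mathfrak X),\theta)$ is determined by this property up to unique isomorphism. (2) There is a unique map of sheaves of rings $\sigma:\mathcal O_{\mathfrak X}\to\mathrm{Prism}_Y(\mathfrak X)/p$ compatible with $\theta$, and it makes $\mathrm{Prism}_Y(\mathfrak X)/p$ a quasi-coherent $\mathcal O_{\mathfrak X}$-algebra. For each affine open $V\subset\mathfrak X$ the ring $S=\Gamma(V,\mathrm{Prism}_Y(\mathfrak X))$ is $p$-adically complete, and for each $f\in\Gamma(V,\mathcal O_{\mathfrak X})$ and each $g\in S$ whose image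 in $\Gamma(V,\mathrm{Prism}_Y(\mathfrak X)/p)$ is $\sigma(f)$, there is an isomorphism of $S$-algebras $\widehat S_g\cong\Gamma(V_f,\mathrm{Prism}_Y(\mathfrak X))$, where $V_f\subset V$ is the principal open subset defined by $f$. (3) For each affine open $V\subset\mathfrak X$ the natural map $\Gamma(V,\mathrm{Prism}_Y(\mathfrak X))/p\to\Gamma(V,\mathrm{Prism}_Y(\mathfrak X)/p)$ is an isomorphism. -/

import Mathlib

open CategoryTheory TopologicalSpace AlgebraicGeometry Opposite

universe u

noncomputable section

namespace PrismaticSheaf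

section Algebra

/-- A `δ`-structure on a commutative ring, for the prime `p`. -/
structure DeltaStructure (p : ℕ) (A : Type u) [CommRing A] where
  δ : A → A
  map_zero : δ 0 = 0
  map_one : δ 1 = 0
  map_mul : ∀ x y, δ (x * y) = x ^ p * δ y + y ^ p * δ x + p * (δ x * δ y)
  map_add : ∀ x y, δ (x + y) =
    δ x + δ y - ∑ i ∈ Finset.Ioo 0 p, ((p.choose i / p : ℕ) : A) * (x ^ i * y ^ (p - i))

/-- The Frobenius lift `φ(x) = x ^ p + p δ(x)` of a `δ`-structure. -/
def DeltaStructure.frob {p : ℕ} {A : Type u} [CommRing A] (d : DeltaStructure p A) (x : A) : A :=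
  x ^ p + p * d.δ x

/-- A ring with a `δ`-structure is a crystalline prism, i.e. `(A, (p))` is a prism, when it is
`p`-torsion free and `p`-adically complete (in particular separated). -/
structure IsCrystallinePrism (p : ℕ) (A : Type u) [CommRing A] (_d : DeltaStructure p A) :
    Prop where
  torsionFree : ∀ x : A, (p : A) * x = 0 → x = 0
  complete : IsAdicComplete (Ideal.span {(p : A)}) A

/-- A complete intersection sequence: it is regular in the local ring of each prime
containing it. -/
def IsCompleteIntersectionSequence {S : Type u} [CommRing S] (l : List S) : Prop :=
  ∀ (q : Ideal S) [q.IsPrime], (∀ x ∈ l, x ∈ q) →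
    RingTheory.Sequence.IsRegular (Localization.AtPrime q)
      (l.map (algebraMap S (Localization.AtPrime q)))

variable (p : ℕ) {R : Type u} [CommRing R] (φ : R →+* R)

/-- The extension to `R[1/p]` of a ring endomorphism `φ` of `R`. -/
def frobInv : Localization.Away (p : R) →+* Localization.Away (p : R) :=
  IsLocalization.Away.lift (p : R)
    (g := (algebraMap R (Localization.Away (p : R))).comp φ)
    (by
      have h := IsLocalization.Away.algebraMap_isUnit (S := Localization.Away (p : R)) (p : R)
      simpa using h)

/-- The operation `δ(x) = (φ(x) - x ^ p) / p` on `R[1/p]`. -/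
def deltaInv (x : Localization.Away (p : R)) : Localization.Away (p : R) :=
  (frobInv p φ x - x ^ p) * IsLocalization.Away.invSelf (p : R)

/-- The subring `R[δ^i(x/p) : x ∈ I, i ≥ 0]` of `R[1/p]`. -/
def envelope₀ (I : Ideal R) : Subalgebra R (Localization.Away (p : R)) :=
  Algebra.adjoin R {y | ∃ x ∈ I, ∃ i : ℕ, y = (deltaInv p φ)^[i]
    (algebraMap R (Localization.Away (p : R)) x * IsLocalization.Away.invSelf (p : R))}

/-- The prismatic envelope of `(R, φ, I)`: the `p`-adic completion of
`R[δ^i(x/p) : x ∈ I, i ≥ 0]`. -/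
abbrev Envelope (I : Ideal R) : Type u :=
  AdicCompletion (Ideal.span {(p : envelope₀ p φ I)}) (envelope₀ p φ I)

/-- The completed localization `S[1/g]^∧_p`. -/
abbrev CompletedLocalization (S : Type u) [CommRing S] (g : S) : Type u :=
  AdicCompletion (Ideal.span {(p : Localization.Away g)}) (Localization.Away g)

end Algebra

section Sheaf

variable (p : ℕ) {T : TopCat.{u}}

/-- The presheaf quotient `U ↦ F(U) / p ^ n`. -/
def modPowPresheaf (n : ℕ) (F : TopCat.Presheaf CommRingCat.{u} T) :
    TopCat.Presheaf CommRingCat.{u} T where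
  obj U := CommRingCat.of (F.obj U ⧸ Ideal.span {(p : F.obj U) ^ n})
  map {U V} g := CommRingCat.ofHom
    (Ideal.quotientMap (Ideal.span {(p : F.obj V) ^ n}) (F.map g).hom (by
      rw [Ideal.span_le, Set.singleton_subset_iff]
      simp))
  map_id U := by
    ext x
    simp
  map_comp f g := by
    ext x
    simp

/-- The quotient sheaf of rings `F / p ^ n`. -/
def modPow (n : ℕ) (F : TopCat.Presheaf CommRingCat.{u} T) : TopCat.Sheaf CommRingCat.{u} T :=
  (presheafToSheaf (Opens.grothendieckTopology T) CommRingCat.{u}).obj (modPowPresheaf p n F)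

/-- The canonical map from the presheaf quotient to the quotient sheaf. -/
def quotientToModPow (n : ℕ) (F : TopCat.Presheaf CommRingCat.{u} T) :
    modPowPresheaf p n F ⟶ (modPow p n F).presheaf :=
  toSheafify (Opens.grothendieckTopology T) (modPowPresheaf p n F)

/-- The reduction map `F → F / p ^ n`. -/
def toModPow (n : ℕ) (F : TopCat.Presheaf CommRingCat.{u} T) :
    F ⟶ (modPow p n F).presheaf :=
  { app := fun U => CommRingCat.ofHom (Ideal.Quotient.mk (Ideal.span {(p : F.obj U) ^ n}))
    naturality := fun U V g => by
      ext x
      rfl : F ⟶ modPowPresheaf p n F } ≫ quotientToModPow p n F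

/-- The reduction map `F / p ^ 2 → F / p`. -/
def reduction (F : TopCat.Presheaf CommRingCat.{u} T) : modPow p 2 F ⟶ modPow p 1 F :=
  (presheafToSheaf (Opens.grothendieckTopology T) CommRingCat.{u}).map
    { app := fun U => CommRingCat.ofHom (Ideal.Quotient.factor (by
        rw [Ideal.span_le, Set.singleton_subset_iff]
        exact Ideal.mem_span_singleton.mpr (pow_dvd_pow _ one_le_two)))
      naturality := fun U V g => by
        ext x
        obtain ⟨x, rfl⟩ := Ideal.Quotient.mk_surjective (R := F.obj U) x
        rfl }

end Sheaf

section FormalScheme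

variable (p : ℕ)

/-- An open subset `U` of a ringed space `Y` is affinoid, i.e. isomorphic as a ringed space to
`Spf R` with `R = Γ(U, 𝒪_Y)` a `p`-adically complete ring: `U` is homeomorphic to the space
`V(p) ⊆ Spec R` underlying `Spf R`, and for `f : R` the `R`-algebra of sections over the open
subset `W` of `U` corresponding to `D(f) ∩ V(p)` is `R[1/f]^∧_p`.
(Homomorphisms of `R`-algebras from `R[1/f]^∧_p` to `p`-adically separated rings are unique, so
these isomorphisms are automatically compatible with restriction.) -/
def IsAffinoid (Y : RingedSpace.{u, u}) (U : Opens Y) : Prop :=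
  IsAdicComplete (Ideal.span {(p : Y.presheaf.obj (op U))}) (Y.presheaf.obj (op U)) ∧
  ∃ h : U ≃ₜ PrimeSpectrum.zeroLocus {(p : Y.presheaf.obj (op U))},
    ∀ (f : Y.presheaf.obj (op U)) (W : Opens Y) (hW : W ≤ U),
      (∀ y : U, (y : Y) ∈ W ↔ f ∉ (h y).1.asIdeal) →
      ∃ e : CompletedLocalization p (Y.presheaf.obj (op U)) f ≃+* Y.presheaf.obj (op W),
        ∀ r : Y.presheaf.obj (op U),
          e (algebraMap _ (CompletedLocalization p (Y.presheaf.obj (op U)) f) r) =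
            Y.presheaf.map (homOfLE hW).op r

/-- A `p`-adic formal scheme: a ringed space locally isomorphic to `Spf R` for `p`-adically
complete rings `R`. -/
structure FormalScheme where
  toRingedSpace : RingedSpace.{u, u}
  exists_isAffinoid : ∀ y : toRingedSpace, ∃ U : Opens toRingedSpace,
    y ∈ U ∧ IsAffinoid p toRingedSpace U

variable {p}

/-- The ring of sections of the structure sheaf. -/
abbrev FormalScheme.sections (Y : FormalScheme.{u} p) (U : Opens Y.toRingedSpace) : CommRingCat :=
  Y.toRingedSpace.presheaf.obj (op U)

/-- The restriction to `U` of the structure morphism `Y → Spf A` given by `A → Γ(Y, 𝒪_Y)`. -/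
def FormalScheme.structureMap (Y : FormalScheme.{u} p) {A : Type u} [CommRing A]
    (a : A →+* Y.sections ⊤) (U : Opens Y.toRingedSpace) : A →+* Y.sections U :=
  (Y.toRingedSpace.presheaf.map (homOfLE le_top).op).hom.comp a

/-- The `p`-adic formal scheme `Y` over `A` is smooth: locally it is `Spf R` with all the
`A / p ^ n → R / p ^ n` smooth. -/
def FormalScheme.IsSmoothOver (Y : FormalScheme.{u} p) {A : Type u} [CommRing A]
    (a : A →+* Y.sections ⊤) : Prop :=
  ∀ y : Y.toRingedSpace, ∃ U : Opens Y.toRingedSpace, y ∈ U ∧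
    IsAffinoid p Y.toRingedSpace U ∧
    ∀ n : ℕ, (Ideal.quotientMap
      ((Ideal.span {(p : A) ^ n}).map (Y.structureMap a U)) (Y.structureMap a U)
      Ideal.le_comap_map).Smooth

/-- The structure sheaf of `Y ⊗ ℤ / p ^ n`. As `p` is nilpotent there, its space is that
of `Y`. -/
abbrev FormalScheme.modPow (Y : FormalScheme.{u} p) (n : ℕ) :
    TopCat.Sheaf CommRingCat.{u} Y.toRingedSpace.carrier :=
  PrismaticSheaf.modPow p n Y.toRingedSpace.presheaf

/-- A lift to `Y ⊗ ℤ / p ^ 2` of the absolute Frobenius of `Y ⊗ ℤ / p`. Such a lift is the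
identity on the underlying space, so it is an endomorphism of the structure sheaf. -/
def FormalScheme.IsFrobeniusLift (Y : FormalScheme.{u} p) (φ : Y.modPow 2 ⟶ Y.modPow 2) : Prop :=
  ∀ (U : Opens Y.toRingedSpace) (s : (Y.modPow 2).presheaf.obj (op U)),
    (reduction p Y.toRingedSpace.presheaf).hom.app (op U) (φ.hom.app (op U) s) =
      ((reduction p Y.toRingedSpace.presheaf).hom.app (op U) s) ^ p

/-- `φ` is compatible with the Frobenius lift of `A`. -/
def FormalScheme.IsCompatible (Y : FormalScheme.{u} p) {A : Type u} [CommRing A]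
    (d : DeltaStructure p A) (a : A →+* Y.sections ⊤) (φ : Y.modPow 2 ⟶ Y.modPow 2) : Prop :=
  ∀ x : A, φ.hom.app (op ⊤) ((toModPow p 2 Y.toRingedSpace.presheaf).app (op ⊤) (a x)) =
    (toModPow p 2 Y.toRingedSpace.presheaf).app (op ⊤) (a (d.frob x))

/-- The endomorphism `φR` of `Γ(U, 𝒪_Y)` lifts the restriction of `φ` to `U`. -/
def FormalScheme.IsLocalLift (Y : FormalScheme.{u} p) (φ : Y.modPow 2 ⟶ Y.modPow 2)
    (U : Opens Y.toRingedSpace) (φR : Y.sections U →+* Y.sections U) : Prop :=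
  ∀ s : Y.sections U,
    (toModPow p 2 Y.toRingedSpace.presheaf).app (op U) (φR s) =
      φ.hom.app (op U) ((toModPow p 2 Y.toRingedSpace.presheaf).app (op U) s)

/-- A closed immersion of a scheme into a formal scheme. -/
structure ClosedImmersion (X : Scheme.{u}) (Y : FormalScheme.{u} p) where
  hom : X.toPresheafedSpace ⟶ Y.toRingedSpace.toPresheafedSpace
  isClosedEmbedding : Topology.IsClosedEmbedding hom.base
  stalk_surjective : ∀ x : X, Function.Surjective (hom.stalkMap x)

namespace ClosedImmersion

variable {X : Scheme.{u}} {Y : FormalScheme.{u} p} (i : ClosedImmersion X Y)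

/-- The open subset `X ∩ U` of `X`. -/
abbrev inter (U : Opens Y.toRingedSpace) : X.Opens := (Opens.map i.hom.base).obj U

/-- The map `Γ(U, 𝒪_Y) → Γ(X ∩ U, 𝒪_X)`. -/
def app (U : Opens Y.toRingedSpace) : Y.sections U →+* Γ(X, i.inter U) :=
  (i.hom.c.app (op U)).hom

/-- The ideal of `Γ(U, 𝒪_Y)` which defines `X ∩ U`. -/
def ideal (U : Opens Y.toRingedSpace) : Ideal (Y.sections U) := RingHom.ker (i.app U)

/-- `X → Y` is a morphism over `A`, for the structure map `s` of `X` over `A / p`. -/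
def IsOver {A : Type u} [CommRing A] (a : A →+* Y.sections ⊤)
    (s : X ⟶ Spec (CommRingCat.of (A ⧸ Ideal.span {(p : A)}))) : Prop :=
  ∀ x : A, i.app ⊤ (a x) =
    s.appTop ((Scheme.ΓSpecIso (CommRingCat.of (A ⧸ Ideal.span {(p : A)}))).inv
      (Ideal.Quotient.mk (Ideal.span {(p : A)}) x))

/-- Locally on `Y`, the subscheme `X` of `Y ⊗ ℤ / p` is defined by a complete intersection
sequence. -/
def IsCompleteIntersection : Prop :=
  ∀ y : Y.toRingedSpace, ∃ U : Opens Y.toRingedSpace, y ∈ U ∧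
    IsAffinoid p Y.toRingedSpace U ∧
    ∃ l : List (Y.sections U ⧸ Ideal.span {(p : Y.sections U)}),
      (i.ideal U).map (Ideal.Quotient.mk (Ideal.span {(p : Y.sections U)})) = Ideal.ofList l ∧
      IsCompleteIntersectionSequence l

/-- Let `P` be a sheaf of rings on `X` and `θ : 𝒪_Y → i_* P`. For each affinoid open `U = Spf R`
of `Y`, with `X ∩ U` defined by the ideal `I` of `R`, and each lift `φR` of `φ` to `R`, the
`R`-algebra `Γ(X ∩ U, P)` is the prismatic envelope of `(R, φR, I)`. -/
def ComputesEnvelopes (φ : Y.modPow 2 ⟶ Y.modPow 2)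
    (P : TopCat.Sheaf CommRingCat.{u} X.carrier)
    (θ : Y.toRingedSpace.presheaf ⟶
      (TopCat.Presheaf.pushforward CommRingCat.{u} i.hom.base).obj P.presheaf) : Prop :=
  ∀ U : Opens Y.toRingedSpace, IsAffinoid p Y.toRingedSpace U →
    ∀ φR : Y.sections U →+* Y.sections U, Y.IsLocalLift φ U φR →
      ∃ e : Envelope p φR (i.ideal U) ≃+* P.presheaf.obj (op (i.inter U)),
        ∀ r : Y.sections U,
          e (algebraMap _ (Envelope p φR (i.ideal U)) r) = θ.app (op U) r

/-- The map `σ : 𝒪_X → P / p` is compatible with `θ : 𝒪_Y → i_* P`. -/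
def IsReduction (P : TopCat.Sheaf CommRingCat.{u} X.carrier)
    (θ : Y.toRingedSpace.presheaf ⟶
      (TopCat.Presheaf.pushforward CommRingCat.{u} i.hom.base).obj P.presheaf)
    (σ : X.sheaf ⟶ PrismaticSheaf.modPow p 1 P.presheaf) : Prop :=
  ∀ (U : Opens Y.toRingedSpace) (r : Y.sections U),
    σ.hom.app (op (i.inter U)) (i.app U r) =
      (toModPow p 1 P.presheaf).app (op (i.inter U)) (θ.app (op U) r)

end ClosedImmersion

/-- A sheaf of rings `Q` on `X` with a map `σ : 𝒪_X → Q`, seen as an `𝒪_X`-module. -/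
def asModule {X : Scheme.{u}} {Q : TopCat.Sheaf CommRingCat.{u} X.carrier} (σ : X.sheaf ⟶ Q) :
    SheafOfModules.{u} X.ringCatSheaf :=
  (SheafOfModules.restrictScalars
    ((sheafCompose (Opens.grothendieckTopology X) (forget₂ CommRingCat RingCat.{u})).map σ)).obj
    (SheafOfModules.unit _)

end FormalScheme

end PrismaticSheaf

end

open PrismaticSheaf

/-! The heart of the matter is that the subring generated by the `δ^j(x/p)` depends on the Frobenius
lift only modulo `p^2` and commutes with localization. Everything else is descent modulo powers of
`p`, followed by a limit.

Functoriality. Let `h : R → R'` satisfy `φ' h ≡ h φ` modulo `p^2` and carry `I` into `I'`. Taking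
`p`-th powers improves a congruence modulo `p^(k+1)` to one modulo `p^(k+2)`. Since `φ(x) = x^p + p
c`, it follows that `φ'(h(φ^k x)) ≡ h(φ^(k+1) x)` modulo `p^(k+2)` (`iterate_frob_diff`). Dividing
by `p`, the element `w = x/p` has commutation error in `p^(k+1)` for every `k`, and this whole
family of bounds passes from `w` to `δ(w)` (`frob_diff_delta`). Hence `h` maps envelope to envelope
(`invMap_mem_envelope₀`). For `h = id` this gives independence of the lift. For restriction maps,
with which local lifts commute modulo `p^2`, it gives transition maps. These compose correctly
because a homomorphism from an envelope to a `p`-torsion free, `p`-complete ring is determined on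
`R` (`IsEnvelope.hom_ext`).

Localization. `PLoc p h f` says that `h` inverts `f` and is the localization at `f` modulo `p`; for
torsion free, complete rings this identifies the target with the completed localization. When `R'`
is the completed localization of `R` and `I' = I R'`, the same estimates show that the envelope of
`R'` is generated by the image of that of `R` (`mem_adjoin_invMap`). Approximating coefficients by
fractions then yields `IsEnvelope.ploc`.

Gluing. Each `X ∩ U` is affine and `R` maps onto its ring (`isAffineOpen_inter`). Elements of `I`
become divisible by `p` in the envelope, so a cover of `X ∩ U` by principal opens gives a partition
of unity modulo `p` there, and sections glue by `exists_glue`. The result is a sheaf on a basis,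
extended to all opens by compatible families (`GluingSystem`).

General affine opens. An affine `V ⊂ X` need not be of the form `X ∩ U`. The localization property
on the `X ∩ U` makes `P/p` quasi-coherent, hence its first Čech cohomology on `V` vanishes
(`exists_coboundary`), and sections of `P/p` over `V` lift by successive approximation
(`exists_reduce_eq`). The localization property of `P/p` over `V` then lifts to `P`.

Smoothness enters through flatness, which makes `𝒪_Y` `p`-torsion free (`torsionFree_of_flat`), and
through formal smoothness, which lifts `φ` over each affinoid (`exists_lift_of_formallySmooth`). -/

namespace PrismaticSheaf

/-! ### Torsion free `p`-complete rings and `p`-adic completion. -/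

section Complete

variable {p : ℕ} {B C : Type*} [CommRing B] [CommRing C]

/-- The ring `B` is `p`-torsion free. -/
def TorsionFree (p : ℕ) (B : Type*) [CommRing B] : Prop :=
  ∀ x : B, (p : B) * x = 0 → x = 0

theorem TorsionFree.pow_mul_cancel (h : TorsionFree p B) (n : ℕ) {x y : B}
    (e : (p : B) ^ n * x = p ^ n * y) : x = y := by
  induction n with
  | zero => simpa using e
  | succ n ih =>
    refine ih (sub_eq_zero.1 (h _ ?_))
    rw [← sub_eq_zero] at e
    rw [← e]
    ring

theorem TorsionFree.mul_cancel (h : TorsionFree p B) {x y : B}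
    (e : (p : B) * x = p * y) : x = y :=
  h.pow_mul_cancel 1 (by simpa using e)

theorem TorsionFree.dvd_of_pow_mul_dvd (h : TorsionFree p B) (n m : ℕ) {x : B}
    (e : (p : B) ^ (n + m) ∣ p ^ n * x) : (p : B) ^ m ∣ x := by
  obtain ⟨c, hc⟩ := e
  exact ⟨c, h.pow_mul_cancel n (by rw [hc, pow_add, mul_assoc])⟩

theorem TorsionFree.of_injective (h : TorsionFree p C) (f : B →+* C) (hf : Function.Injective f) :
    TorsionFree p B := fun x hx => hf (by
  rw [map_zero]
  apply h
  rw [← map_natCast f, ← map_mul, hx, map_zero])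

theorem TorsionFree.localization (h : TorsionFree p B) (M : Submonoid B) [Algebra B C]
    [IsLocalization M C] : TorsionFree p C := by
  intro x hx
  obtain ⟨a, s, rfl⟩ := IsLocalization.exists_mk'_eq M x
  rw [← map_natCast (algebraMap B C), ← IsLocalization.mk'_one (M := M) C (p : B),
    ← IsLocalization.mk'_mul, IsLocalization.mk'_eq_zero_iff] at hx
  obtain ⟨m, hm⟩ := hx
  rw [IsLocalization.mk'_eq_zero_iff]
  refine ⟨m, h _ ?_⟩
  rw [← hm]
  ring

theorem map_dvd_pow (f : B →+* C) {n : ℕ} {x : B} (h : (p : B) ^ n ∣ x) : (p : C) ^ n ∣ f x := by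
  simpa using map_dvd f h

theorem map_dvd_natCast (f : B →+* C) {x : B} (h : (p : B) ∣ x) : (p : C) ∣ f x := by
  simpa using map_dvd f h

theorem sModEq_span_pow_iff {q : B} {n : ℕ} {x y : B} :
    x ≡ y [SMOD (Ideal.span {q} ^ n • ⊤ : Submodule B B)] ↔ q ^ n ∣ x - y := by
  rw [SModEq.sub_mem, Ideal.span_singleton_pow, smul_eq_mul, Ideal.mul_top,
    Ideal.mem_span_singleton]

theorem pow_dvd_sub_of_le {q : B} {u : ℕ → B} (h : ∀ n, q ^ n ∣ u (n + 1) - u n) {m n : ℕ}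
    (hmn : m ≤ n) : q ^ m ∣ u n - u m := by
  induction n, hmn using Nat.le_induction with
  | base => simp
  | succ n hmn ih =>
    have := dvd_add ((pow_dvd_pow q hmn).trans (h n)) ih
    simpa using this

theorem eq_zero_of_forall_pow_dvd {q : B} [IsHausdorff (Ideal.span {q}) B] {x : B}
    (h : ∀ n, q ^ n ∣ x) : x = 0 :=
  IsHausdorff.haus ‹_› x fun n => sModEq_span_pow_iff.2 (by simpa using h n)

theorem eq_of_forall_pow_dvd_sub {q : B} [IsHausdorff (Ideal.span {q}) B] {x y : B}
    (h : ∀ n, q ^ n ∣ x - y) : x = y :=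
  sub_eq_zero.1 (eq_zero_of_forall_pow_dvd h)

theorem exists_limit {q : B} [IsPrecomplete (Ideal.span {q}) B] {u : ℕ → B}
    (h : ∀ n, q ^ n ∣ u (n + 1) - u n) : ∃ l, ∀ n, q ^ n ∣ l - u n := by
  obtain ⟨l, hl⟩ := IsPrecomplete.prec ‹_› (f := u) fun {m n} hmn =>
    (sModEq_span_pow_iff.2 (pow_dvd_sub_of_le h hmn)).symm
  exact ⟨l, fun n => sModEq_span_pow_iff.1 (hl n).symm⟩

theorem isAdicComplete_span_singleton {q : B} (h₁ : ∀ x : B, (∀ n, q ^ n ∣ x) → x = 0)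
    (h₂ : ∀ u : ℕ → B, (∀ n, q ^ n ∣ u (n + 1) - u n) → ∃ l, ∀ n, q ^ n ∣ l - u n) :
    IsAdicComplete (Ideal.span {q}) B where
  haus' x hx := h₁ x fun n => by simpa using sModEq_span_pow_iff.1 (hx n)
  prec' f hf := by
    obtain ⟨l, hl⟩ := h₂ f fun n => sModEq_span_pow_iff.1 (hf n.le_succ).symm
    exact ⟨l, fun n => (sModEq_span_pow_iff.2 (hl n)).symm⟩

/-- The ring `B` is `p`-torsion free and `p`-adically complete. -/
structure TFComplete (p : ℕ) (B : Type*) [CommRing B] : Prop where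
  tf : TorsionFree p B
  complete : IsAdicComplete (Ideal.span {(p : B)}) B

theorem TFComplete.eq_of_forall (h : TFComplete p B) {x y : B}
    (hxy : ∀ n, (p : B) ^ n ∣ x - y) : x = y :=
  have := h.complete
  eq_of_forall_pow_dvd_sub hxy

theorem TFComplete.exists_limit (h : TFComplete p B) {u : ℕ → B}
    (hu : ∀ n, (p : B) ^ n ∣ u (n + 1) - u n) : ∃ l, ∀ n, (p : B) ^ n ∣ l - u n :=
  have := h.complete
  PrismaticSheaf.exists_limit hu

/-- `p` lies in the Jacobson radical of a `p`-adically complete ring, so invertibility can be tested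
modulo `p`. -/
theorem TFComplete.isUnit (h : TFComplete p B) {x y : B} (hxy : (p : B) ∣ x * y - 1) :
    IsUnit x := by
  have := h.complete
  have hj : (p : B) ∈ Ideal.jacobson (⊥ : Ideal B) :=
    IsAdicComplete.le_jacobson_bot (Ideal.span {(p : B)}) (Ideal.mem_span_singleton_self _)
  obtain ⟨c, hc⟩ := hxy
  have hu : IsUnit (x * y) := by
    rw [sub_eq_iff_eq_add] at hc
    rw [hc]
    exact Ideal.mem_jacobson_bot.1 hj c
  exact isUnit_of_mul_isUnit_left hu

/-- `ι` induces an isomorphism modulo `p`. -/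
structure BijModP (p : ℕ) (ι : B →+* C) : Prop where
  surj : ∀ c, ∃ b, (p : C) ∣ c - ι b
  inj : ∀ b, (p : C) ∣ ι b → (p : B) ∣ b

theorem BijModP.surj_pow {ι : B →+* C} (h : BijModP p ι) (n : ℕ) (c : C) :
    ∃ b, (p : C) ^ n ∣ c - ι b := by
  induction n with
  | zero => exact ⟨0, by simp⟩
  | succ n ih =>
    obtain ⟨b, d, hd⟩ := ih
    obtain ⟨b', d', hd'⟩ := h.surj d
    refine ⟨b + p ^ n * b', d', ?_⟩
    rw [sub_eq_iff_eq_add] at hd hd'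
    rw [hd, hd']
    simp
    ring

/-- One factor `p` is extracted from `b`, cancelled in `C`, and the argument is repeated with the
cofactor. -/
theorem BijModP.inj_pow {ι : B →+* C} (h : BijModP p ι) (hC : TorsionFree p C) (n : ℕ) (b : B)
    (hb : (p : C) ^ n ∣ ι b) : (p : B) ^ n ∣ b := by
  induction n generalizing b with
  | zero => simp
  | succ n ih =>
    obtain ⟨b', rfl⟩ := h.inj b ((dvd_pow_self _ n.succ_ne_zero).trans hb)
    rw [pow_succ']
    refine mul_dvd_mul_left _ (ih b' ?_)
    refine hC.dvd_of_pow_mul_dvd 1 n ?_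
    rw [add_comm 1 n]
    simpa using hb

/-- The `p`-adic completion. -/
abbrev PCompletion (p : ℕ) (B : Type*) [CommRing B] : Type _ :=
  AdicCompletion (Ideal.span {(p : B)}) B

/-- The ideal `(p)` is finitely generated, so the kernel of the projection to level `n` is `p^n`
times the completion. -/
theorem dvd_of_evalₐ_eq_zero (n : ℕ) (x : PCompletion p B)
    (hx : AdicCompletion.evalₐ (Ideal.span {(p : B)}) n x = 0) : (p : PCompletion p B) ^ n ∣ x := by
  have h := AdicCompletion.pow_smul_top_eq_ker_eval (I := Ideal.span {(p : B)}) (M := B) (n := n)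
    (Submodule.fg_span_singleton _)
  have hx' : x ∈ (AdicCompletion.eval (Ideal.span {(p : B)}) B n).ker := by
    have := AdicCompletion.factor_evalₐ_eq_eval (I := Ideal.span {(p : B)}) (n := n) x (by simp)
    rw [LinearMap.mem_ker]
    rw [← this, hx, map_zero]
  rw [← h, Ideal.span_singleton_pow, Submodule.ideal_span_singleton_smul] at hx'
  obtain ⟨y, -, hy⟩ := hx'
  refine ⟨y, ?_⟩
  rw [← hy]
  simp [Algebra.smul_def]

theorem evalₐ_eq_zero_iff (n : ℕ) (x : PCompletion p B) :
    AdicCompletion.evalₐ (Ideal.span {(p : B)}) n x = 0 ↔ (p : PCompletion p B) ^ n ∣ x := by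
  refine ⟨dvd_of_evalₐ_eq_zero n x, ?_⟩
  rintro ⟨y, rfl⟩
  have : ((p : B ⧸ (Ideal.span {(p : B)}) ^ n)) ^ n = 0 := by
    rw [← map_natCast (Ideal.Quotient.mk _), ← map_pow, Ideal.Quotient.eq_zero_iff_mem]
    exact Ideal.pow_mem_pow (Ideal.mem_span_singleton_self _) n
  rw [map_mul, map_pow, map_natCast, this, zero_mul]

theorem adicCompletion_approx (n : ℕ) (x : PCompletion p B) :
    ∃ b : B, (p : PCompletion p B) ^ n ∣ x - algebraMap B _ b := by
  obtain ⟨b, hb⟩ := Ideal.Quotient.mk_surjective (AdicCompletion.evalₐ (Ideal.span {(p : B)}) n x)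
  refine ⟨b, (evalₐ_eq_zero_iff n _).1 ?_⟩
  rw [map_sub, ← hb, sub_eq_zero]
  simp

theorem adicCompletion_ext {f g : PCompletion p B →+* C}
    (hC : IsHausdorff (Ideal.span {(p : C)}) C)
    (h : ∀ b, f (algebraMap B _ b) = g (algebraMap B _ b)) : f = g := by
  ext x
  refine eq_of_forall_pow_dvd_sub (q := (p : C)) fun n => ?_
  obtain ⟨b, hb⟩ := adicCompletion_approx n x
  have h1 := map_dvd_pow f hb
  have h2 := map_dvd_pow g hb
  rw [map_sub] at h1 h2
  have := dvd_sub h1 h2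
  rw [h b] at this
  simpa using this

theorem pow_dvd_algebraMap_iff (n : ℕ) (b : B) :
    (p : PCompletion p B) ^ n ∣ algebraMap B _ b ↔ (p : B) ^ n ∣ b := by
  rw [← evalₐ_eq_zero_iff]
  simp [Ideal.Quotient.eq_zero_iff_mem, Ideal.span_singleton_pow, Ideal.mem_span_singleton]

theorem bijModP_algebraMap :
    BijModP p (algebraMap B (PCompletion p B)) where
  surj c := by simpa using adicCompletion_approx 1 c
  inj b hb := by simpa using (pow_dvd_algebraMap_iff 1 b).1 (by simpa using hb)

/-- If `p x = 0` and `x ≡ b` modulo `p^(n+1)` with `b` in `B`, then `p^(n+1)` divides `p b`, so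
`p^n` divides `b` and therefore `x`. For completeness, a Cauchy sequence is replaced by an
approximating sequence from `B`. -/
theorem tfComplete_adicCompletion (h : TorsionFree p B) :
    TFComplete p (PCompletion p B) where
  tf x hx := by
    refine AdicCompletion.ext_evalₐ fun n => ?_
    rw [map_zero, evalₐ_eq_zero_iff]
    obtain ⟨b, c, hc⟩ := adicCompletion_approx (n + 1) x
    rw [sub_eq_iff_eq_add] at hc
    have h1 : (p : PCompletion p B) ^ (n + 1) ∣ algebraMap B _ (p * b) := by
      refine ⟨- p * c, ?_⟩
      rw [hc, mul_add, add_comm, ← eq_neg_iff_add_eq_zero] at hx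
      rw [map_mul, map_natCast, hx]
      ring
    rw [pow_dvd_algebraMap_iff, add_comm n 1] at h1
    have h2 := h.dvd_of_pow_mul_dvd 1 n (by simpa using h1)
    rw [hc]
    exact dvd_add (Dvd.dvd.mul_right (pow_dvd_pow _ n.le_succ) _)
      ((pow_dvd_algebraMap_iff n b).2 h2)
  complete := by
    refine isAdicComplete_span_singleton (fun x hx => AdicCompletion.ext_evalₐ fun n => ?_)
      fun u hu => ?_
    · rw [map_zero, evalₐ_eq_zero_iff]
      exact hx n
    · choose v hv using fun n => adicCompletion_approx n (u n)
      have hv' (n : ℕ) : (p : B) ^ n ∣ v (n + 1) - v n := by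
        rw [← pow_dvd_algebraMap_iff, map_sub]
        have h1 := dvd_sub (hv n) ((pow_dvd_pow _ n.le_succ).trans (hv (n + 1)))
        have h2 := dvd_add h1 (hu n)
        convert h2 using 1
        ring
      obtain ⟨l, hl⟩ : ∃ l : PCompletion p B, ∀ n,
          AdicCompletion.evalₐ _ n l = Ideal.Quotient.mk _ (v n) := by
        have hv'' : AdicCompletion.IsAdicCauchy (Ideal.span {(p : B)}) B v := fun {m n} hmn =>
          (sModEq_span_pow_iff.2 (pow_dvd_sub_of_le hv' hmn)).symm
        exact ⟨AdicCompletion.mk _ _ ⟨v, hv''⟩, fun n => AdicCompletion.evalₐ_mk _ n _⟩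
      refine ⟨l, fun n => ?_⟩
      have : (p : PCompletion p B) ^ n ∣ l - algebraMap B _ (v n) := by
        rw [← evalₐ_eq_zero_iff, map_sub, hl, sub_eq_zero]
        simp
      have h2 := dvd_sub this (hv n)
      convert h2 using 1
      ring

theorem exists_lift_adicCompletion (f : B →+* C)
    [hC : IsAdicComplete (Ideal.span {(p : C)}) C] :
    ∃ g : PCompletion p B →+* C, ∀ b, g (algebraMap B _ b) = f b := by
  have hle (n : ℕ) : Ideal.span {(p : B)} ^ n ≤ (Ideal.span {(p : C)} ^ n).comap f := by
    rw [Ideal.span_singleton_pow, Ideal.span_singleton_pow, Ideal.span_le,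
      Set.singleton_subset_iff]
    simp
  let F (n : ℕ) : PCompletion p B →+* C ⧸ Ideal.span {(p : C)} ^ n :=
    (Ideal.quotientMap _ f (hle n)).comp (AdicCompletion.evalₐ (Ideal.span {(p : B)}) n).toRingHom
  have hF (n : ℕ) (b : B) : F n (algebraMap B _ b) = Ideal.Quotient.mk _ (f b) := by
    simp [F]
  have hF' (n : ℕ) (x) (hx : (p : PCompletion p B) ^ n ∣ x) :
      F n x = 0 := by
    rw [← evalₐ_eq_zero_iff] at hx
    simp [F, hx]
  have hcomp {m n : ℕ} (hmn : m ≤ n) :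
      (Ideal.Quotient.factorPow (Ideal.span {(p : C)}) hmn).comp (F n) = F m := by
    ext x
    obtain ⟨b, hb⟩ := adicCompletion_approx n x
    have h1 := hF' n _ hb
    have h2 := hF' m _ ((pow_dvd_pow _ hmn).trans hb)
    rw [map_sub, sub_eq_zero, hF] at h1 h2
    rw [RingHom.comp_apply, h1, h2]
    simp
  refine ⟨IsAdicComplete.liftRingHom (Ideal.span {(p : C)}) F hcomp, fun b => ?_⟩
  refine eq_of_forall_pow_dvd_sub (q := (p : C)) fun n => ?_
  rw [← Ideal.mem_span_singleton, ← Ideal.span_singleton_pow, ← Ideal.Quotient.eq,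
    IsAdicComplete.mk_liftRingHom, hF]

/-- Torsion-freeness of `C` upgrades bijectivity modulo `p` to bijectivity modulo every `p^n`;
completing then gives an isomorphism. -/
theorem BijModP.exists_equiv {ι : B →+* C} (h : BijModP p ι) (hB : TorsionFree p B)
    (hC : TFComplete p C) :
    ∃ e : PCompletion p B ≃+* C, ∀ b, e (algebraMap B _ b) = ι b := by
  have := hC.complete
  obtain ⟨g, hg⟩ := exists_lift_adicCompletion (p := p) ι
  refine ⟨RingEquiv.ofBijective g ⟨?_, ?_⟩, hg⟩
  · rw [injective_iff_map_eq_zero]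
    intro x hx
    refine AdicCompletion.ext_evalₐ fun n => ?_
    rw [map_zero, evalₐ_eq_zero_iff]
    obtain ⟨b, hb⟩ := adicCompletion_approx n x
    have h1 := map_dvd_pow g hb
    rw [map_sub, hx, zero_sub, dvd_neg, hg] at h1
    have h2 := (pow_dvd_algebraMap_iff n b).2 (h.inj_pow hC.tf n b h1)
    simpa using dvd_add hb h2
  · intro c
    choose v hv using fun n => h.surj_pow n c
    have hv' (n : ℕ) : (p : B) ^ n ∣ v (n + 1) - v n := by
      refine h.inj_pow hC.tf n _ ?_
      have h2 := dvd_sub (hv n) ((pow_dvd_pow _ n.le_succ).trans (hv (n + 1)))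
      rw [map_sub]
      convert h2 using 1
      ring
    obtain ⟨l, hl⟩ := (tfComplete_adicCompletion hB).exists_limit
      (u := fun n => algebraMap B _ (v n))
      fun n => by
        rw [← map_sub, pow_dvd_algebraMap_iff]
        exact hv' n
    refine ⟨l, hC.eq_of_forall fun n => ?_⟩
    have h1 := map_dvd_pow g (hl n)
    rw [map_sub, hg] at h1
    have h2 := dvd_sub h1 (hv n)
    convert h2 using 1
    ring

end Complete

/-! ### Localization modulo `p`. -/

section PLoc

variable {p : ℕ} {A B C : Type*} [CommRing A] [CommRing B] [CommRing C]

/-- Modulo `p`, the ring homomorphism `h : A → B` is the localization of `A` at `f`. -/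
structure PLoc (p : ℕ) (h : A →+* B) (f : A) : Prop where
  unit : IsUnit (h f)
  surj : ∀ b, ∃ (k : ℕ) (a : A), (p : B) ∣ h f ^ k * b - h a
  inj : ∀ a, (p : B) ∣ h a → ∃ k : ℕ, (p : A) ∣ f ^ k * a

theorem PLoc.surj_pow {h : A →+* B} {f : A} (hf : PLoc p h f) (M : ℕ) (b : B) :
    ∃ (k : ℕ) (a : A), (p : B) ^ M ∣ h f ^ k * b - h a := by
  induction M with
  | zero => exact ⟨0, 0, by simp⟩
  | succ M ih =>
    obtain ⟨k, a, b', hb'⟩ := ih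
    obtain ⟨l, a', b'', hb''⟩ := hf.surj b'
    refine ⟨k + l, f ^ l * a + p ^ M * a', b'', ?_⟩
    rw [sub_eq_iff_eq_add] at hb' hb''
    rw [pow_add, mul_right_comm, hb', add_mul, mul_assoc, mul_comm b', hb'']
    simp
    ring

/-- Each factor `p` costs a further power of `f`. After one factor is extracted from `f^k a`,
torsion-freeness of `B` puts the cofactor in the same situation. -/
theorem PLoc.inj_pow {h : A →+* B} {f : A} (hf : PLoc p h f) (hB : TorsionFree p B) (M : ℕ) (a : A)
    (ha : (p : B) ^ M ∣ h a) : ∃ k : ℕ, (p : A) ^ M ∣ f ^ k * a := by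
  induction M generalizing a with
  | zero => exact ⟨0, by simp⟩
  | succ M ih =>
    obtain ⟨k, c, hc⟩ := hf.inj a ((dvd_pow_self _ M.succ_ne_zero).trans ha)
    obtain ⟨l, d, hd⟩ := ih c (by
      refine hB.dvd_of_pow_mul_dvd 1 M ?_
      rw [pow_one, ← map_natCast h, ← map_mul, ← hc, add_comm 1 M, map_natCast, map_mul]
      exact ha.mul_left _)
    refine ⟨k + l, d, ?_⟩
    rw [pow_add, mul_right_comm, hc, mul_assoc, mul_comm c, hd]
    ring

/-- Transitivity of localization. Up to powers of the unit `g f`, the element `f'` is the image of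
`r` modulo `p`, so inverting `f r` over `A` amounts to inverting `f'` over `B`. This is used for
principal opens of principal opens. -/
theorem PLoc.of_comp {g : A →+* B} {g' : B →+* C} {f r : A} {f' : B} {k : ℕ} (h₁ : PLoc p g f)
    (h₂ : PLoc p (g'.comp g) (f * r)) (hr : (p : B) ∣ g f ^ k * f' - g r) (hu : IsUnit (g' f')) :
    PLoc p g' f' where
  unit := hu
  surj c := by
    obtain ⟨n, a, ha⟩ := h₂.surj c
    obtain ⟨v, hv⟩ := h₁.unit.exists_left_inv
    -- Modulo `p`, the image of `f r` is `f^(k+1) f'`, so this power of the inverse `v` cancels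
    -- exactly the powers of `f` in `(f r)^n`.
    refine ⟨n, v ^ ((k + 1) * n) * g a, ?_⟩
    have h3 : (p : C) ∣ (g' (g f * (g f ^ k * f'))) ^ n - (g' (g (f * r))) ^ n := by
      refine dvd_trans ?_ (sub_dvd_pow_sub_pow _ _ n)
      rw [← map_sub]
      refine map_dvd_natCast g' ?_
      rw [map_mul, ← mul_sub]
      exact hr.mul_left _
    have h4 := dvd_add (h3.mul_right c) ha
    have h5 := h4.mul_left (g' v ^ ((k + 1) * n))
    have hv' : g' v * g' (g f) = 1 := by rw [← map_mul, hv, map_one]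
    convert h5 using 1
    simp only [map_mul, map_pow, RingHom.comp_apply]
    have : g' v ^ ((k + 1) * n) * (g' (g f) * (g' (g f) ^ k * g' f')) ^ n = g' f' ^ n := by
      rw [← mul_assoc, ← pow_succ', pow_mul, ← mul_pow, ← mul_assoc, ← mul_pow, hv', one_pow,
        one_mul]
    linear_combination (-c) * this
  inj b hb := by
    obtain ⟨m, a, ha⟩ := h₁.surj b
    obtain ⟨v, hv⟩ := h₁.unit.exists_left_inv
    have h3 : (p : C) ∣ (g'.comp g) a := by
      have := map_dvd_natCast g' ha
      rw [map_sub, map_mul] at this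
      exact (dvd_sub_right (hb.mul_left _)).1 this
    obtain ⟨n, hn⟩ := h₂.inj a h3
    refine ⟨n, ?_⟩
    have h4 : (p : B) ∣ (g f * (g f ^ k * f')) ^ n - (g (f * r)) ^ n := by
      refine dvd_trans ?_ (sub_dvd_pow_sub_pow _ _ n)
      rw [map_mul, ← mul_sub]
      exact hr.mul_left _
    have h5 := map_dvd_natCast g hn
    rw [map_mul, map_pow] at h5
    have h6 := dvd_add (dvd_add (ha.mul_left (g (f * r) ^ n)) h5) (h4.mul_right (g f ^ m * b))
    have h7 := h6.mul_left (v ^ m * v ^ ((k + 1) * n))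
    convert h7 using 1
    have e1 : v ^ ((k + 1) * n) * (g f * (g f ^ k * f')) ^ n = f' ^ n := by
      rw [← mul_assoc, ← pow_succ', pow_mul, ← mul_pow, ← mul_assoc, ← mul_pow, hv, one_pow,
        one_mul]
    have e2 : v ^ m * g f ^ m = 1 := by rw [← mul_pow, hv, one_pow]
    linear_combination (-(f' ^ n * b)) * e2 - (v ^ m * g f ^ m * b) * e1

/-- Completing changes nothing modulo `p`, so the property is inherited from the honest localization
`A[1/f]`. -/
theorem PLoc.of_equiv {h : A →+* B} {f : A} (e : CompletedLocalization p A f ≃+* B)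
    (he : ∀ a, e (algebraMap A _ a) = h a) : PLoc p h f := by
  let ι := algebraMap (Localization.Away f) (CompletedLocalization p A f)
  have hι : BijModP p ι := bijModP_algebraMap
  have he' (a : A) : h a = e (ι (algebraMap A _ a)) := (he a).symm
  constructor
  · rw [he']
    exact ((IsLocalization.Away.algebraMap_isUnit f).map ι).map e
  · intro b
    obtain ⟨l, hl⟩ := hι.surj (e.symm b)
    obtain ⟨k, a, hk⟩ := IsLocalization.Away.surj f l
    refine ⟨k, a, ?_⟩
    have := (map_dvd_natCast e.toRingHom hl).mul_left (h f ^ k)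
    convert this using 1
    rw [he' a, ← hk, he' f]
    simp
    ring
  · intro a ha
    have h1 : (p : CompletedLocalization p A f) ∣ ι (algebraMap A _ a) := by
      have := map_dvd_natCast e.symm.toRingHom ha
      rw [he'] at this
      simpa using this
    obtain ⟨l, hl⟩ := hι.inj _ h1
    obtain ⟨k, c, hk⟩ := IsLocalization.Away.surj f l
    have : algebraMap A (Localization.Away f) (f ^ k * a) = algebraMap A _ (p * c) := by
      rw [map_mul, hl, map_mul, ← hk]
      simp
      ring
    obtain ⟨m, hm⟩ := (IsLocalization.Away.exists_of_eq f this :)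
    exact ⟨m + k, f ^ m * c, by rw [pow_add, mul_assoc, hm]; ring⟩

theorem tfComplete_completedLocalization (hA : TorsionFree p A) (f : A) :
    TFComplete p (CompletedLocalization p A f) :=
  tfComplete_adicCompletion (hA.localization (.powers f))

theorem TFComplete.of_equiv (hB : TFComplete p B) (e : B ≃+* C) : TFComplete p C where
  tf := hB.tf.of_injective e.symm.toRingHom e.symm.injective
  complete := by
    refine isAdicComplete_span_singleton (fun x hx => ?_) fun u hu => ?_
    · refine e.symm.injective ?_
      rw [map_zero]
      exact hB.eq_of_forall fun n => by
        simpa using map_dvd_pow e.symm.toRingHom (hx n)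
    · obtain ⟨l, hl⟩ := hB.exists_limit (u := fun n => e.symm (u n)) fun n => by
        simpa using map_dvd_pow e.symm.toRingHom (hu n)
      exact ⟨e l, fun n => by simpa using map_dvd_pow e.toRingHom (hl n)⟩

/-- The converse of `PLoc.of_equiv`: the induced map `A[1/f] → B` is bijective modulo `p`, and
`BijModP.exists_equiv` applies. -/
theorem PLoc.exists_equiv {h : A →+* B} {f : A} (hf : PLoc p h f) (hA : TorsionFree p A)
    (hB : TFComplete p B) :
    ∃ e : CompletedLocalization p A f ≃+* B, ∀ a, e (algebraMap A _ a) = h a := by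
  let ι : Localization.Away f →+* B := IsLocalization.Away.lift f hf.unit
  have hι (a : A) : ι (algebraMap A _ a) = h a := IsLocalization.Away.lift_eq f hf.unit a
  have hι' : BijModP p ι := by
    constructor
    · intro b
      obtain ⟨k, a, ha⟩ := hf.surj b
      obtain ⟨v, hv⟩ := hf.unit.exists_left_inv
      obtain ⟨w, hw⟩ := (IsLocalization.Away.algebraMap_isUnit (S := Localization.Away f)
        f).exists_left_inv
      have hvw : v = ι w := by
        refine hf.unit.mul_right_cancel ?_
        rw [hv, ← hι, ← map_mul, hw, map_one]
      refine ⟨w ^ k * algebraMap A _ a, ?_⟩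
      have := ha.mul_left (v ^ k)
      convert this using 1
      rw [map_mul, map_pow, hι, ← hvw, mul_sub, ← mul_assoc, ← mul_pow, hv, one_pow, one_mul]
    · intro l hl
      obtain ⟨k, a, hk⟩ := IsLocalization.Away.surj f l
      obtain ⟨m, c, hm⟩ := hf.inj a (by
        rw [← hι, ← hk, map_mul]
        exact hl.mul_right _)
      have h1 : IsUnit (algebraMap A (Localization.Away f) f ^ (m + k)) :=
        (IsLocalization.Away.algebraMap_isUnit f).pow _
      rw [← h1.dvd_mul_right]
      refine ⟨algebraMap A _ c, ?_⟩
      have := congrArg (algebraMap A (Localization.Away f)) hm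
      rw [map_mul, ← hk] at this
      simp at this
      rw [← this]
      ring
  obtain ⟨e, he⟩ := hι'.exists_equiv (hA.localization (.powers f)) hB
  exact ⟨e, fun a => (he _).trans (hι a)⟩

end PLoc

/-! ### Gluing along a partition of unity modulo `p`. -/

section Glue

variable {p : ℕ} {A : Type*} [CommRing A] {ι : Type*}

theorem exists_uniform [Finite ι] {Q : ι → ℕ → Prop} (hQ : ∀ a k, Q a k → Q a (k + 1))
    (h : ∀ a, ∃ k, Q a k) : ∃ N, ∀ a, Q a N := by
  have hQ' (a : ι) {m n : ℕ} (hmn : m ≤ n) (hm : Q a m) : Q a n := by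
    induction n, hmn using Nat.le_induction with
    | base => exact hm
    | succ n _ ih => exact hQ a n ih
  choose k hk using h
  obtain ⟨N, hN⟩ := (Set.finite_range k).bddAbove
  exact ⟨N, fun a => hQ' a (hN ⟨a, rfl⟩) (hk a)⟩

/-- Modulo `p^M` the element `1 - ∑ c_a f_a` is nilpotent, so the `f_a` generate the unit ideal
there, and so do their `N`-th powers. -/
theorem exists_partition_pow [Fintype ι] {f c : ι → A} (h : (p : A) ∣ 1 - ∑ a, c a * f a)
    (M N : ℕ) : ∃ c : ι → A, (p : A) ^ M ∣ 1 - ∑ a, c a * f a ^ N := by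
  let π := Ideal.Quotient.mk (Ideal.span {(p : A) ^ M})
  have hu : IsUnit (∑ a, π (c a) * π (f a)) := by
    have : IsNilpotent (π (1 - ∑ a, c a * f a)) := by
      refine ⟨M, ?_⟩
      rw [← map_pow, Ideal.Quotient.eq_zero_iff_mem, Ideal.mem_span_singleton]
      exact pow_dvd_pow_of_dvd h M
    have := this.isUnit_one_sub
    simpa using this
  have hs : Ideal.span (Set.range fun a => π (f a)) = ⊤ := by
    refine Ideal.eq_top_of_isUnit_mem _ (sum_mem fun a _ => Ideal.mul_mem_left _ _ ?_) hu
    exact Ideal.subset_span ⟨a, rfl⟩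
  have hs' := Ideal.span_pow_eq_top _ hs N
  rw [← Set.range_comp, Ideal.eq_top_iff_one, Ideal.mem_span_range_iff_exists_fun] at hs'
  obtain ⟨d, hd⟩ := hs'
  choose d' hd' using fun a => Ideal.Quotient.mk_surjective (d a)
  refine ⟨d', ?_⟩
  rw [← Ideal.mem_span_singleton, ← Ideal.Quotient.eq_zero_iff_mem, map_sub, sub_eq_zero, map_one,
    ← hd, map_sum]
  refine Finset.sum_congr rfl fun a _ => ?_
  rw [map_mul, hd', map_pow]
  rfl

variable {B : ι → Type*} [∀ a, CommRing (B a)] {h : ∀ a, A →+* B a} {f : ι → A}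

theorem pow_dvd_of_local [Fintype ι] (hB : ∀ a, TorsionFree p (B a)) (hh : ∀ a, PLoc p (h a) (f a))
    {c : ι → A} (hc : (p : A) ∣ 1 - ∑ a, c a * f a) {M : ℕ} {x : A}
    (hx : ∀ a, (p : B a) ^ M ∣ h a x) : (p : A) ^ M ∣ x := by
  obtain ⟨N, hN⟩ := exists_uniform (Q := fun a k => (p : A) ^ M ∣ f a ^ k * x)
    (fun a k hk => by rw [pow_succ', mul_assoc]; exact hk.mul_left _)
    fun a => (hh a).inj_pow (hB a) M x (hx a)
  obtain ⟨d, hd⟩ := exists_partition_pow hc M N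
  have h1 : (p : A) ^ M ∣ ∑ a, d a * (f a ^ N * x) :=
    Finset.dvd_sum fun a _ => (hN a).mul_left _
  have h2 := dvd_add (hd.mul_right x) h1
  convert h2 using 1
  simp only [sub_mul, one_mul, Finset.sum_mul, mul_assoc]
  ring

variable {C : ι → ι → Type*} [∀ a b, CommRing (C a b)] {l : ∀ a b, B a →+* C a b}
  {r : ∀ a b, B b →+* C a b}

/-- The classical proof of the sheaf axiom for `Spec`, carried out modulo `p^M`: `N` clears the
denominators of the `t_a`, and `K` those in the agreement on overlaps. -/
theorem exists_glue_mod_pow [Fintype ι]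
    (hC : ∀ a b, TorsionFree p (C a b)) (hh : ∀ a, PLoc p (h a) (f a))
    (hlr : ∀ a b, (l a b).comp (h a) = (r a b).comp (h b))
    (hl : ∀ a b, PLoc p ((l a b).comp (h a)) (f a * f b))
    {c : ι → A} (hc : (p : A) ∣ 1 - ∑ a, c a * f a) {M : ℕ} (t : ∀ a, B a)
    (ht : ∀ a b, (p : C a b) ^ M ∣ l a b (t a) - r a b (t b)) :
    ∃ x : A, ∀ a, (p : B a) ^ M ∣ t a - h a x := by
  obtain ⟨N, hN⟩ := exists_uniform
    (Q := fun a k => ∃ β : A, (p : B a) ^ M ∣ h a (f a) ^ k * t a - h a β)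
    (fun a k ⟨β, hβ⟩ => ⟨f a * β, by
      rw [pow_succ', mul_assoc, map_mul, ← mul_sub]; exact hβ.mul_left _⟩)
    fun a => (hh a).surj_pow M (t a)
  choose β hβ using hN
  obtain ⟨K, hK⟩ := exists_uniform (ι := ι × ι)
    (Q := fun ab k => (p : A) ^ M ∣ (f ab.1 * f ab.2) ^ k *
      (f ab.2 ^ N * β ab.1 - f ab.1 ^ N * β ab.2))
    (fun a k hk => by rw [pow_succ', mul_assoc]; exact hk.mul_left _)
    fun ⟨a, b⟩ => by
      refine (hl a b).inj_pow (hC a b) M _ ?_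
      have h1 := (map_dvd_pow (l a b) (hβ a)).mul_left (l a b (h a (f b)) ^ N)
      have h2 := (map_dvd_pow (r a b) (hβ b)).mul_left (r a b (h b (f a)) ^ N)
      have h3 := (ht a b).mul_left (l a b (h a (f a)) ^ N * l a b (h a (f b)) ^ N)
      have e (x : A) : r a b (h b x) = l a b (h a x) := (congrArg (· x) (hlr a b)).symm
      simp only [map_sub, map_mul, map_pow, e, RingHom.comp_apply] at h1 h2 h3 ⊢
      have h4 := dvd_add (dvd_sub h2 h1) h3
      convert h4 using 1
      ring
  obtain ⟨d, hd⟩ := exists_partition_pow hc M (N + K)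
  -- With `∑ d_b f_b^(N+K) ≡ 1`, the relations on overlaps give `f_a^(N+K) x ≡ f_a^K β_a ≡ f_a^(N+K)
  -- t_a` over `B a`, where `f_a` is a unit.
  refine ⟨∑ b, d b * (f b ^ K * β b), fun a => ?_⟩
  rw [← ((hh a).unit.pow (N + K)).dvd_mul_left]
  have h1 : (p : A) ^ M ∣ ∑ b, d b * ((f a * f b) ^ K * (f b ^ N * β a - f a ^ N * β b)) :=
    Finset.dvd_sum fun b _ => (hK (a, b)).mul_left _
  have h2 := map_dvd_pow (h a) (dvd_add h1 (hd.mul_right (f a ^ K * β a)))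
  have h3 := dvd_add ((hβ a).mul_left (h a (f a) ^ K)) h2
  convert h3 using 1
  have e : f a ^ (N + K) * (∑ b, d b * (f b ^ K * β b)) =
      f a ^ K * β a - (∑ b, d b * ((f a * f b) ^ K * (f b ^ N * β a - f a ^ N * β b)) +
        (1 - ∑ b, d b * f b ^ (N + K)) * (f a ^ K * β a)) := by
    have (b : ι) : f a ^ (N + K) * (d b * (f b ^ K * β b)) = d b * f b ^ (N + K) * (f a ^ K * β a) -
        d b * ((f a * f b) ^ K * (f b ^ N * β a - f a ^ N * β b)) := by ring
    rw [Finset.mul_sum, Finset.sum_congr rfl fun b _ => this b, Finset.sum_sub_distrib,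
      ← Finset.sum_mul]
    ring
  have e' := congrArg (h a) e
  rw [map_mul, map_pow, map_sub, map_mul, map_pow] at e'
  rw [mul_sub, e']
  ring

/-- Solutions modulo `p^n` and `p^(n+1)` agree modulo `p^n` by `pow_dvd_of_local`, so they converge
in `A`. -/
theorem exists_glue [Fintype ι] (hA : TFComplete p A) (hB : ∀ a, TFComplete p (B a))
    (hC : ∀ a b, TorsionFree p (C a b)) (hh : ∀ a, PLoc p (h a) (f a))
    (hlr : ∀ a b, (l a b).comp (h a) = (r a b).comp (h b))
    (hl : ∀ a b, PLoc p ((l a b).comp (h a)) (f a * f b))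
    {c : ι → A} (hc : (p : A) ∣ 1 - ∑ a, c a * f a) (t : ∀ a, B a)
    (ht : ∀ a b, l a b (t a) = r a b (t b)) :
    ∃ x : A, ∀ a, h a x = t a := by
  choose x hx using fun M => exists_glue_mod_pow hC hh hlr hl hc (M := M) t
    (fun a b => by rw [ht, sub_self]; exact dvd_zero _)
  obtain ⟨y, hy⟩ := hA.exists_limit (u := x) fun n => by
    refine pow_dvd_of_local (fun a => (hB a).tf) hh hc fun a => ?_
    have := dvd_sub (hx n a) ((pow_dvd_pow _ n.le_succ).trans (hx (n + 1) a))
    rw [map_sub]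
    convert this using 1
    ring
  refine ⟨y, fun a => (hB a).eq_of_forall fun n => ?_⟩
  have := dvd_sub (map_dvd_pow (h a) (hy n)) (hx n a)
  rw [map_sub] at this
  convert this using 1
  ring

end Glue

/-! ### Commutation errors of Frobenius lifts. -/

section Delta

/-- In `a^p - b^p = (a - b) ∑ a^i b^(p-1-i)` the second factor is a sum of `p` terms congruent
modulo `p`, hence divisible by `p`. -/
theorem pow_dvd_pow_sub_pow {R : Type*} [CommRing R] {p k : ℕ} {a b : R}
    (h : (p : R) ^ (k + 1) ∣ a - b) : (p : R) ^ (k + 2) ∣ a ^ p - b ^ p := by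
  rw [← geom_sum₂_mul, mul_comm, pow_succ]
  exact mul_dvd_mul h (dvd_geom_sum₂_self ((dvd_pow_self _ k.succ_ne_zero).trans h))

/-- Write `φ(x) = x^p + p c`, so that `φ^(k+1) x = (φ^k x)^p + p φ^k c`. In the step from `k` to
`k+1` both summands gain a factor `p`: the first because `p`-th powers improve congruences, the
second because of its coefficient. -/
theorem iterate_frob_diff {p : ℕ} {R R' : Type*} [CommRing R] [CommRing R'] {φ : R →+* R}
    {φ' : R' →+* R'} (h : R →+* R') (hφ : ∀ x, (p : R) ∣ φ x - x ^ p)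
    (hh : ∀ x, (p : R') ^ 2 ∣ φ' (h x) - h (φ x)) (k : ℕ) (x : R) :
    (p : R') ^ (k + 2) ∣ φ' (h (φ^[k] x)) - h (φ^[k + 1] x) := by
  induction k generalizing x with
  | zero => exact hh x
  | succ k ih =>
    obtain ⟨c, hc⟩ := hφ x
    rw [sub_eq_iff_eq_add] at hc
    have h1 := pow_dvd_pow_sub_pow (ih x)
    have h2 := mul_dvd_mul_left (p : R') (ih c)
    rw [← pow_succ'] at h2
    have h3 := dvd_add h1 h2
    convert h3 using 1
    have e (n : ℕ) : φ^[n] (p : R) = p := by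
      induction n with
      | zero => rfl
      | succ n ih => rw [Function.iterate_succ_apply, map_natCast, ih]
    have key (n : ℕ) : φ^[n + 1] x = p * φ^[n] c + φ^[n] x ^ p := by
      rw [Function.iterate_succ_apply, hc, iterate_map_add, iterate_map_mul, iterate_map_pow, e]
    have e1 := congrArg (fun y => φ' (h y)) (key k)
    have e2 := congrArg h (key (k + 1))
    simp only [map_add, map_mul, map_pow, map_natCast] at e1 e2
    linear_combination e1 - e2

variable {p : ℕ} {K K' : Type*} [CommRing K] [CommRing K']

theorem iterate_map_inv {Φ : K →+* K} {q : K} (hq : (p : K) * q = 1) (k : ℕ) : Φ^[k] q = q := by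
  have h1 (n : ℕ) : Φ q = q := by
    have h2 : (p : K) * Φ q = 1 := by rw [← map_natCast Φ, ← map_mul, hq, map_one]
    linear_combination q * h2 - Φ q * hq
  induction k with
  | zero => rfl
  | succ n ih => rw [Function.iterate_succ_apply, h1 n, ih]

theorem map_inv_eq (h : K →+* K') {q : K} (hq : (p : K) * q = 1) {q' : K'}
    (hq' : (p : K') * q' = 1) : h q = q' := by
  have h2 : (p : K') * h q = 1 := by rw [← map_natCast h, ← map_mul, hq, map_one]
  linear_combination q' * h2 - h q * hq'

/-- In `δ(w) = (Φ w - w^p)/p`, the term `Φ w` contributes the error of `w` at `k+1`, in `p^(k+2) T`,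
and `w^p` contributes a difference of `p`-th powers of elements congruent modulo `p^(k+1)`, again in
`p^(k+2) T`. Division by `p` restores the exponent `k+1`. The loss is why the bounds are needed for
all `k` at once. -/
theorem frob_diff_delta {Φ : K →+* K} {Φ' : K' →+* K'} (h : K →+* K') {q : K} {q' : K'}
    (hq : (p : K) * q = 1) (hq' : (p : K') * q' = 1) (T : Subring K') {w : K}
    (hw : ∀ k, h (Φ^[k] w) ∈ T)
    (hd : ∀ k, ∃ t ∈ T, Φ' (h (Φ^[k] w)) - h (Φ^[k + 1] w) = p ^ (k + 1) * t) (k : ℕ) :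
    ∃ t ∈ T, Φ' (h (Φ^[k] ((Φ w - w ^ p) * q))) - h (Φ^[k + 1] ((Φ w - w ^ p) * q)) =
      p ^ (k + 1) * t := by
  obtain ⟨t, ht, et⟩ := hd k
  obtain ⟨t₂, ht₂, et₂⟩ := hd (k + 1)
  have h1 : (p : T) ^ (k + 2) ∣ (⟨_, hw (k + 1)⟩ + p ^ (k + 1) * ⟨t, ht⟩ : T) ^ p -
      (⟨_, hw (k + 1)⟩ : T) ^ p := pow_dvd_pow_sub_pow (by simp)
  obtain ⟨s, hs⟩ := h1
  have hs' := congrArg Subtype.val hs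
  simp only [AddSubgroupClass.coe_sub, Subring.coe_pow, Subring.coe_add, Subring.coe_mul,
    Subring.coe_natCast] at hs'
  refine ⟨t₂ - s, sub_mem ht₂ s.2, ?_⟩
  rw [sub_eq_iff_eq_add'] at et et₂
  simp only [iterate_map_mul, iterate_map_sub, iterate_map_pow, iterate_map_inv hq,
    ← Function.iterate_succ_apply, map_mul, map_sub, map_pow, map_inv_eq h hq hq',
    map_inv_eq Φ' hq' hq', et, et₂]
  linear_combination (-q') * hs' + (p ^ (k + 1) * (t₂ - s)) * hq'

end Delta

/-! ### Functoriality of the uncompleted envelope. -/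

section Envelope

variable {p : ℕ} {R R' : Type u} [CommRing R] [CommRing R'] {φ : R →+* R} {φ' : R' →+* R'}

theorem natCast_mul_invSelf : (p : Localization.Away (p : R)) *
    IsLocalization.Away.invSelf (p : R) = 1 := by
  have := IsLocalization.Away.mul_invSelf (S := Localization.Away (p : R)) (p : R)
  rwa [map_natCast] at this

theorem frobInv_algebraMap (r : R) :
    frobInv p φ (algebraMap R _ r) = algebraMap R _ (φ r) :=
  IsLocalization.Away.lift_eq _ _ _

theorem algebraMap_away_injective (hR : TorsionFree p R) :
    Function.Injective (algebraMap R (Localization.Away (p : R))) := by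
  refine IsLocalization.injective (M := .powers (p : R)) _ ?_
  rintro _ ⟨n, rfl⟩
  rw [mem_nonZeroDivisors_iff_right]
  exact fun x hx => hR.pow_mul_cancel n (by rw [mul_zero, mul_comm]; exact hx)

theorem exists_pow_mul_eq_algebraMap (z : Localization.Away (p : R)) :
    ∃ (n : ℕ) (r : R), (p : Localization.Away (p : R)) ^ n * z = algebraMap R _ r := by
  obtain ⟨n, r, h⟩ := IsLocalization.Away.surj (p : R) z
  exact ⟨n, r, by rw [← h, map_natCast, mul_comm]⟩

theorem natCast_pow_mul_cancel {n : ℕ} {x y : Localization.Away (p : R)}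
    (h : (p : Localization.Away (p : R)) ^ n * x = p ^ n * y) : x = y := by
  have h1 := congrArg (IsLocalization.Away.invSelf (p : R) ^ n * ·) h
  simpa [← mul_assoc, ← mul_pow, mul_comm _ (p : Localization.Away (p : R)),
    natCast_mul_invSelf] using h1

theorem deltaInv_algebraMap {r c : R} (hc : φ r = r ^ p + p * c) :
    deltaInv p φ (algebraMap R _ r) = algebraMap R _ c := by
  rw [deltaInv, frobInv_algebraMap, hc]
  simp only [map_add, map_pow, map_mul, map_natCast]
  linear_combination (algebraMap R _ c) * natCast_mul_invSelf (p := p) (R := R)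

theorem frobInv_eq (z : Localization.Away (p : R)) :
    frobInv p φ z = z ^ p + p * deltaInv p φ z := by
  rw [deltaInv]
  linear_combination (z ^ p - frobInv p φ z) * natCast_mul_invSelf (p := p) (R := R)

/-- The sum and product rules for `δ` reduce stability to the generators and to `R`, where `φ x ≡
x^p` modulo `p` makes `δ` integral. -/
theorem deltaInv_mem_adjoin [hp : Fact p.Prime] (hφ : ∀ x, (p : R) ∣ φ x - x ^ p)
    {G : Set (Localization.Away (p : R))}
    (hG : ∀ g ∈ G, deltaInv p φ g ∈ Algebra.adjoin R G) {z : Localization.Away (p : R)}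
    (hz : z ∈ Algebra.adjoin R G) : deltaInv p φ z ∈ Algebra.adjoin R G := by
  induction hz using Algebra.adjoin_induction with
  | mem g hg => exact hG g hg
  | algebraMap r =>
    obtain ⟨c, hc⟩ := hφ r
    rw [deltaInv_algebraMap (sub_eq_iff_eq_add'.1 hc)]
    exact Subalgebra.algebraMap_mem _ c
  | add x y hx hy hx' hy' =>
    -- The identity `(x + y)^p = x^p + y^p + p x y s` is taken inside the subalgebra, so that the
    -- correction term `x y s` lies in it.
    obtain ⟨s, hs⟩ := exists_add_pow_prime_eq hp.out (⟨x, hx⟩ : Algebra.adjoin R G) ⟨y, hy⟩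
    have hs' := congrArg Subtype.val hs
    have : deltaInv p φ (x + y) = deltaInv p φ x + deltaInv p φ y - x * (y * s) := by
      simp only [Subalgebra.coe_pow, Subalgebra.coe_add, Subalgebra.coe_mul] at hs'
      rw [deltaInv, deltaInv, deltaInv, map_add, hs']
      have e : ((p : Algebra.adjoin R G) : Localization.Away (p : R)) = p := rfl
      rw [e]
      linear_combination (-(x * (y * s))) * natCast_mul_invSelf (p := p) (R := R)
    rw [this]
    exact sub_mem (add_mem hx' hy') (mul_mem hx (mul_mem hy s.2))
  | mul x y hx hy hx' hy' =>
    have : deltaInv p φ (x * y) = x ^ p * deltaInv p φ y + y ^ p * deltaInv p φ x +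
        p * (deltaInv p φ x * deltaInv p φ y) := by
      rw [deltaInv, map_mul, frobInv_eq, frobInv_eq]
      linear_combination (x ^ p * deltaInv p φ y + y ^ p * deltaInv p φ x +
        p * (deltaInv p φ x * deltaInv p φ y)) * natCast_mul_invSelf (p := p) (R := R)
    rw [this]
    exact add_mem (add_mem (mul_mem (pow_mem hx _) hy') (mul_mem (pow_mem hy _) hx'))
      (mul_mem (Subalgebra.natCast_mem _ p) (mul_mem hx' hy'))

theorem deltaInv_mem_envelope₀ [hp : Fact p.Prime] (hφ : ∀ x, (p : R) ∣ φ x - x ^ p) {I : Ideal R}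
    {z : Localization.Away (p : R)} (hz : z ∈ envelope₀ p φ I) :
    deltaInv p φ z ∈ envelope₀ p φ I := by
  refine deltaInv_mem_adjoin hφ ?_ hz
  rintro _ ⟨x, hx, i, rfl⟩
  refine Algebra.subset_adjoin ⟨x, hx, i + 1, ?_⟩
  rw [Function.iterate_succ_apply']

theorem frobInv_mem_envelope₀ [hp : Fact p.Prime] (hφ : ∀ x, (p : R) ∣ φ x - x ^ p) {I : Ideal R}
    {z : Localization.Away (p : R)} (hz : z ∈ envelope₀ p φ I) :
    frobInv p φ z ∈ envelope₀ p φ I := by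
  rw [frobInv_eq]
  exact add_mem (pow_mem hz _) (mul_mem (Subalgebra.natCast_mem _ p) (deltaInv_mem_envelope₀ hφ hz))

theorem mul_invSelf_mem_envelope₀ {I : Ideal R} {x : R} (hx : x ∈ I) :
    algebraMap R _ x * IsLocalization.Away.invSelf (p : R) ∈ envelope₀ p φ I :=
  Algebra.subset_adjoin ⟨x, hx, 0, rfl⟩

variable (p) in
/-- The map `R[1/p] → R'[1/p]` induced by `h`. -/
noncomputable def invMap (h : R →+* R') :
    Localization.Away (p : R) →+* Localization.Away (p : R') :=
  IsLocalization.Away.lift (p : R) (g := (algebraMap R' (Localization.Away (p : R'))).comp h) (by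
    have h := IsLocalization.Away.algebraMap_isUnit (S := Localization.Away (p : R')) (p : R')
    simpa using h)

theorem invMap_algebraMap (h : R →+* R') (r : R) :
    invMap p h (algebraMap R _ r) = algebraMap R' _ (h r) :=
  IsLocalization.Away.lift_eq _ _ _

theorem invMap_invSelf (h : R →+* R') : invMap p h (IsLocalization.Away.invSelf (p : R)) =
    IsLocalization.Away.invSelf (p : R') :=
  map_inv_eq _ natCast_mul_invSelf natCast_mul_invSelf

theorem iterate_frobInv_algebraMap (k : ℕ) (r : R) :
    (frobInv p φ)^[k] (algebraMap R _ r) = algebraMap R _ (φ^[k] r) := by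
  induction k generalizing r with
  | zero => rfl
  | succ k ih =>
    rw [Function.iterate_succ_apply, frobInv_algebraMap, ih, Function.iterate_succ_apply]

theorem iterate_frobInv_mul_invSelf (k : ℕ) (r : R) :
    (frobInv p φ)^[k] (algebraMap R _ r * IsLocalization.Away.invSelf (p : R)) =
      algebraMap R _ (φ^[k] r) * IsLocalization.Away.invSelf (p : R) := by
  rw [iterate_map_mul, iterate_frobInv_algebraMap, iterate_map_inv natCast_mul_invSelf]

/-- The starting point `w = x/p`: dividing `iterate_frob_diff` by `p` turns the exponent `k+2` into
`k+1`, with a coefficient from `R'` and hence in any subalgebra. -/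
theorem frob_diff_mul_invSelf (hφ : ∀ x, (p : R) ∣ φ x - x ^ p) (h : R →+* R')
    (hh : ∀ x, (p : R') ^ 2 ∣ φ' (h x) - h (φ x)) (T : Subalgebra R' (Localization.Away (p : R')))
    (x : R) (k : ℕ) :
    ∃ t ∈ T.toSubring, frobInv p φ' (invMap p h ((frobInv p φ)^[k]
      (algebraMap R _ x * IsLocalization.Away.invSelf (p : R)))) - invMap p h ((frobInv p φ)^[k + 1]
      (algebraMap R _ x * IsLocalization.Away.invSelf (p : R))) = p ^ (k + 1) * t := by
  obtain ⟨d, hd⟩ := iterate_frob_diff h hφ hh k x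
  refine ⟨algebraMap R' _ d, Subalgebra.algebraMap_mem _ d, ?_⟩
  have hd' := congrArg (algebraMap R' (Localization.Away (p : R'))) hd
  simp only [map_sub, map_mul, map_pow, map_natCast] at hd'
  rw [iterate_frobInv_mul_invSelf, iterate_frobInv_mul_invSelf, map_mul, map_mul, map_mul,
    invMap_algebraMap, invMap_algebraMap, frobInv_algebraMap, invMap_invSelf,
    map_inv_eq (frobInv p φ') natCast_mul_invSelf natCast_mul_invSelf]
  linear_combination (IsLocalization.Away.invSelf (p : R')) * hd' +
    (p ^ (k + 1) * algebraMap R' _ d) * natCast_mul_invSelf (p := p) (R := R')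

/-- Although `invMap p h` does not commute with `δ`, one has `h(δ w) = δ'(h w) - t` with an error
`t` in the envelope of `R'`. The errors at later `δ^j` are controlled by those at all Frobenius
iterates of the earlier ones. -/
theorem invMap_mem_envelope₀ [hp : Fact p.Prime] (hφ : ∀ x, (p : R) ∣ φ x - x ^ p)
    (hφ' : ∀ x, (p : R') ∣ φ' x - x ^ p) (h : R →+* R')
    (hh : ∀ x, (p : R') ^ 2 ∣ φ' (h x) - h (φ x)) {I : Ideal R} {I' : Ideal R'}
    (hI : ∀ x ∈ I, h x ∈ I') {z : Localization.Away (p : R)} (hz : z ∈ envelope₀ p φ I) :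
    invMap p h z ∈ envelope₀ p φ' I' := by
  induction hz using Algebra.adjoin_induction with
  | algebraMap r =>
    rw [invMap_algebraMap]
    exact Subalgebra.algebraMap_mem _ _
  | add x y _ _ hx hy =>
    rw [map_add]
    exact add_mem hx hy
  | mul x y _ _ hx hy =>
    rw [map_mul]
    exact mul_mem hx hy
  | mem g hg =>
    obtain ⟨x, hx, j, rfl⟩ := hg
    let T := (envelope₀ p φ' I').toSubring
    -- The induction on `j` carries both the membership of all Frobenius iterates and the error
    -- bounds, as `frob_diff_delta` consumes the two together.
    suffices H : ∀ w : Localization.Away (p : R), w = (deltaInv p φ)^[j]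
        (algebraMap R _ x * IsLocalization.Away.invSelf (p : R)) →
        (∀ k, invMap p h ((frobInv p φ)^[k] w) ∈ T) ∧
        ∀ k, ∃ t ∈ T, frobInv p φ' (invMap p h ((frobInv p φ)^[k] w)) -
          invMap p h ((frobInv p φ)^[k + 1] w) = p ^ (k + 1) * t from (H _ rfl).1 0
    induction j with
    | zero =>
      rintro _ rfl
      have hd := frob_diff_mul_invSelf hφ h hh (envelope₀ p φ' I') x
      refine ⟨fun k => ?_, hd⟩
      induction k with
      | zero =>
        simp only [Function.iterate_zero, id_eq, map_mul, invMap_algebraMap, invMap_invSelf]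
        exact mul_invSelf_mem_envelope₀ (hI x hx)
      | succ k ih =>
        obtain ⟨t, ht, e⟩ := hd k
        rw [sub_eq_iff_eq_add, ← sub_eq_iff_eq_add'] at e
        simp only [Function.iterate_zero, id_eq]
        rw [← e]
        exact sub_mem (frobInv_mem_envelope₀ hφ' ih) (mul_mem (pow_mem (natCast_mem T p) _) ht)
    | succ j ih =>
      rintro _ rfl
      rw [Function.iterate_succ_apply']
      obtain ⟨h1, h2⟩ := ih _ rfl
      set w := (deltaInv p φ)^[j] (algebraMap R _ x * IsLocalization.Away.invSelf (p : R))
      refine ⟨fun k => ?_, frob_diff_delta _ natCast_mul_invSelf natCast_mul_invSelf T h1 h2⟩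
      obtain ⟨t, ht, e⟩ := h2 k
      have : invMap p h ((frobInv p φ)^[k] (deltaInv p φ w)) =
          deltaInv p φ' (invMap p h ((frobInv p φ)^[k] w)) - p ^ k * t := by
        rw [deltaInv, deltaInv, iterate_map_mul, iterate_map_sub, iterate_map_pow,
          iterate_map_inv natCast_mul_invSelf, ← Function.iterate_succ_apply, map_mul, map_sub,
          map_pow, invMap_invSelf]
        linear_combination (-(IsLocalization.Away.invSelf (p : R'))) * e +
          (- p ^ k * t) * natCast_mul_invSelf (p := p) (R := R')
      rw [this]
      exact sub_mem (deltaInv_mem_envelope₀ hφ' (h1 k)) (mul_mem (pow_mem (natCast_mem T p) _) ht)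

/-- The prismatic envelope only depends on the Frobenius lift modulo `p ^ 2`. -/
theorem envelope₀_le_of_congr [hp : Fact p.Prime] {φ₂ : R →+* R} (hφ : ∀ x, (p : R) ∣ φ x - x ^ p)
    (hφ₂ : ∀ x, (p : R) ∣ φ₂ x - x ^ p) (hh : ∀ x, (p : R) ^ 2 ∣ φ₂ x - φ x) (I : Ideal R) :
    envelope₀ p φ I ≤ envelope₀ p φ₂ I := fun z hz => by
  -- Functoriality along the identity of `R`, whose induced map on `R[1/p]` is the identity.
  have := invMap_mem_envelope₀ hφ hφ₂ (RingHom.id R) hh (I := I) (I' := I) (fun x hx => hx) hz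
  have e : invMap p (RingHom.id R) = RingHom.id _ := by
    refine IsLocalization.ringHom_ext (.powers (p : R)) ?_
    ext r
    simp [invMap_algebraMap]
  rwa [e] at this

end Envelope

/-! ### Localization, completion and mapping properties of envelopes. -/

section Envelope

variable {p : ℕ} {R R' : Type u} [CommRing R] [CommRing R'] {φ' : R' →+* R'} {φ : R →+* R}

/-- The restriction of `R[1/p] → R'[1/p]` to subalgebras. -/
noncomputable def subalgebraMap {E : Subalgebra R (Localization.Away (p : R))}
    {E' : Subalgebra R' (Localization.Away (p : R'))} (h : R →+* R')
    (H : ∀ z ∈ E, invMap p h z ∈ E') : E →+* E' :=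
  ((invMap p h).comp E.val.toRingHom).codRestrict E' fun z => H z z.2

theorem coe_subalgebraMap {E : Subalgebra R (Localization.Away (p : R))}
    {E' : Subalgebra R' (Localization.Away (p : R'))} (h : R →+* R')
    (H : ∀ z ∈ E, invMap p h z ∈ E') (z : E) :
    (subalgebraMap h H z : Localization.Away (p : R')) = invMap p h z := rfl

theorem subalgebraMap_algebraMap {E : Subalgebra R (Localization.Away (p : R))}
    {E' : Subalgebra R' (Localization.Away (p : R'))} (h : R →+* R')
    (H : ∀ z ∈ E, invMap p h z ∈ E') (r : R) :
    subalgebraMap h H (algebraMap R E r) = algebraMap R' E' (h r) :=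
  Subtype.ext (invMap_algebraMap h r)

theorem Subalgebra.exists_pow_mul_eq {E : Subalgebra R (Localization.Away (p : R))} (z : E) :
    ∃ (n : ℕ) (r : R), (p : E) ^ n * z = algebraMap R E r := by
  obtain ⟨N, r, hr⟩ := exists_pow_mul_eq_algebraMap (z : Localization.Away (p : R))
  exact ⟨N, r, Subtype.ext (by simpa using hr)⟩

theorem torsionFree_subalgebra (E : Subalgebra R (Localization.Away (p : R))) :
    TorsionFree p E := by
  intro x hx
  have h := congrArg Subtype.val hx
  refine Subtype.ext (natCast_pow_mul_cancel (n := 1) ?_)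
  simpa using h

/-- When `I' = I R'`, the prismatic envelope of `R'` is generated by that of `R`. -/
theorem mem_adjoin_invMap [hp : Fact p.Prime] (hφ : ∀ x, (p : R) ∣ φ x - x ^ p)
    (hφ' : ∀ x, (p : R') ∣ φ' x - x ^ p) (h : R →+* R')
    (hh : ∀ x, (p : R') ^ 2 ∣ φ' (h x) - h (φ x)) {I : Ideal R} {I' : Ideal R'}
    (hI : I' ≤ I.map h) {z : Localization.Away (p : R')} (hz : z ∈ envelope₀ p φ' I') :
    z ∈ Algebra.adjoin R' (invMap p h '' (envelope₀ p φ I : Set (Localization.Away (p : R)))) := by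
  let G : Set (Localization.Away (p : R)) := {y | ∃ x ∈ I, ∃ i : ℕ, y = (deltaInv p φ)^[i]
    (algebraMap R (Localization.Away (p : R)) x * IsLocalization.Away.invSelf (p : R))}
  let T := Algebra.adjoin R' (invMap p h '' G)
  have hT : ∀ y ∈ envelope₀ p φ I, invMap p h y ∈ T := by
    intro y hy
    induction hy using Algebra.adjoin_induction with
    | algebraMap r =>
      rw [invMap_algebraMap]
      exact Subalgebra.algebraMap_mem _ _
    | add x y _ _ hx hy =>
      rw [map_add]
      exact add_mem hx hy
    | mul x y _ _ hx hy =>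
      rw [map_mul]
      exact mul_mem hx hy
    | mem g hg => exact Algebra.subset_adjoin ⟨g, hg, rfl⟩
  have hG : ∀ g ∈ G, g ∈ envelope₀ p φ I := fun g hg => Algebra.subset_adjoin hg
  suffices hzT : z ∈ T from Algebra.adjoin_mono (Set.image_mono hG) hzT
  have hiter {w} (hw : w ∈ envelope₀ p φ I) (k : ℕ) : (frobInv p φ)^[k] w ∈ envelope₀ p φ I := by
    induction k generalizing w with
    | zero => exact hw
    | succ k ih =>
      rw [Function.iterate_succ_apply]
      exact ih (frobInv_mem_envelope₀ hφ hw)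
  have hd : ∀ g ∈ G, ∀ k, ∃ t ∈ T.toSubring, frobInv p φ' (invMap p h ((frobInv p φ)^[k] g)) -
      invMap p h ((frobInv p φ)^[k + 1] g) = p ^ (k + 1) * t := by
    rintro _ ⟨x, hx, j, rfl⟩
    induction j with
    | zero => exact frob_diff_mul_invSelf hφ h hh T x
    | succ j ih =>
      rw [Function.iterate_succ_apply']
      exact frob_diff_delta _ natCast_mul_invSelf natCast_mul_invSelf _
        (fun k => hT _ (hiter (hG _ ⟨x, hx, j, rfl⟩) k)) ih
  -- On generators `δ'(h g) = h(δ g) + t` with `t` in `T`; only the error at `k = 0` is used here.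
  -- Stability under `δ'` then reduces the claim to the elements `x/p` with `x ∈ I'`.
  have hδ : ∀ y ∈ T, deltaInv p φ' y ∈ T := fun y hy => by
    refine deltaInv_mem_adjoin hφ' ?_ hy
    rintro _ ⟨g, hg, rfl⟩
    obtain ⟨t, ht, e⟩ := hd g hg 0
    have : deltaInv p φ' (invMap p h g) = invMap p h (deltaInv p φ g) + t := by
      simp only [Function.iterate_zero, id_eq, zero_add, Function.iterate_one, pow_one] at e
      rw [deltaInv, deltaInv, map_mul, map_sub, map_pow, invMap_invSelf]
      linear_combination IsLocalization.Away.invSelf (p : R') * e +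
        t * natCast_mul_invSelf (p := p) (R := R')
    rw [this]
    exact add_mem (hT _ (deltaInv_mem_envelope₀ hφ (hG g hg))) ht
  refine Algebra.adjoin_le ?_ hz
  rintro _ ⟨x, hx, j, rfl⟩
  induction j with
  | zero =>
    have hx' := hI hx
    simp only [Function.iterate_zero, id_eq, SetLike.mem_coe]
    clear hx
    induction hx' using Submodule.span_induction with
    | mem y hy =>
      obtain ⟨x, hx, rfl⟩ := hy
      have := hT _ (mul_invSelf_mem_envelope₀ (p := p) (φ := φ) hx)
      rwa [map_mul, invMap_algebraMap, invMap_invSelf] at this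
    | zero => simp
    | add x y _ _ hx hy =>
      rw [map_add, add_mul]
      exact add_mem hx hy
    | smul r x _ hx =>
      rw [smul_eq_mul, map_mul, mul_assoc]
      exact mul_mem (Subalgebra.algebraMap_mem _ _) hx
  | succ j ih =>
    rw [Function.iterate_succ_apply']
    exact hδ _ ih

/-- Coefficients in `R'` are fractions modulo any `p^M`, and the remaining generators come from the
envelope of `R`. The exponent `N` bounding the denominator of `e` is fixed before the precision `M`,
so the precision can later be chosen to beat the denominator. -/
theorem exists_approx_envelope₀ [hp : Fact p.Prime] (hφ : ∀ x, (p : R) ∣ φ x - x ^ p)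
    (hφ' : ∀ x, (p : R') ∣ φ' x - x ^ p) {h : R →+* R'} {f : R} (hf : PLoc p h f)
    (hh : ∀ x, (p : R') ^ 2 ∣ φ' (h x) - h (φ x)) {I : Ideal R} {I' : Ideal R'}
    (hI : I' ≤ I.map h) {z : Localization.Away (p : R')} (hz : z ∈ envelope₀ p φ' I') :
    ∃ N : ℕ, ∀ M : ℕ, ∃ k : ℕ, ∃ e ∈ envelope₀ p φ I,
      (∃ r : R, (p : Localization.Away (p : R)) ^ N * e = algebraMap R _ r) ∧
      ∃ r' : R', algebraMap R' (Localization.Away (p : R')) (h f) ^ k * z - invMap p h e =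
        p ^ M * algebraMap R' _ r' := by
  have hz' := mem_adjoin_invMap hφ hφ' h hh hI hz
  clear hz
  induction hz' using Algebra.adjoin_induction with
  | mem g hg =>
    obtain ⟨w, hw, rfl⟩ := hg
    obtain ⟨N, r, hr⟩ := exists_pow_mul_eq_algebraMap w
    exact ⟨N, fun M => ⟨0, w, hw, ⟨r, hr⟩, 0, by simp⟩⟩
  | algebraMap r =>
    refine ⟨0, fun M => ?_⟩
    obtain ⟨k, a, c, hc⟩ := hf.surj_pow M r
    refine ⟨k, algebraMap R _ a, Subalgebra.algebraMap_mem _ a, ⟨a, by simp⟩, c, ?_⟩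
    rw [invMap_algebraMap, ← map_pow, ← map_mul, ← map_sub, hc]
    simp
  | add z₁ z₂ _ _ h₁ h₂ =>
    obtain ⟨N₁, h₁⟩ := h₁
    obtain ⟨N₂, h₂⟩ := h₂
    refine ⟨N₁ + N₂, fun M => ?_⟩
    obtain ⟨k, e₁, he₁, ⟨r₁, hr₁⟩, r₁', hr₁'⟩ := h₁ M
    obtain ⟨l, e₂, he₂, ⟨r₂, hr₂⟩, r₂', hr₂'⟩ := h₂ M
    refine ⟨k + l, algebraMap R _ (f ^ l) * e₁ + algebraMap R _ (f ^ k) * e₂,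
      add_mem (mul_mem (Subalgebra.algebraMap_mem _ _) he₁)
        (mul_mem (Subalgebra.algebraMap_mem _ _) he₂),
      ⟨p ^ N₂ * f ^ l * r₁ + p ^ N₁ * f ^ k * r₂, ?_⟩, h f ^ l * r₁' + h f ^ k * r₂', ?_⟩
    · simp only [map_add, map_mul, map_pow, map_natCast, ← hr₁, ← hr₂]
      ring
    · simp only [map_add, map_mul, map_pow, invMap_algebraMap]
      linear_combination (algebraMap R' _ (h f)) ^ l * hr₁' + (algebraMap R' _ (h f)) ^ k * hr₂'
  | mul z₁ z₂ _ _ h₁ h₂ =>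
    obtain ⟨N₁, h₁⟩ := h₁
    obtain ⟨N₂, h₂⟩ := h₂
    obtain ⟨L, s, hs⟩ := exists_pow_mul_eq_algebraMap z₂
    refine ⟨N₁ + N₂, fun M => ?_⟩
    -- In the product, the first error is multiplied by `z₂`, with denominator `p^L`, and the second
    -- by the image of `e₁`, with denominator `p^N₁`; the extra precision absorbs both.
    obtain ⟨k, e₁, he₁, ⟨r₁, hr₁⟩, r₁', hr₁'⟩ := h₁ (M + L)
    obtain ⟨l, e₂, he₂, ⟨r₂, hr₂⟩, r₂', hr₂'⟩ := h₂ (M + N₁)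
    refine ⟨k + l, e₁ * e₂, mul_mem he₁ he₂, ⟨r₁ * r₂, ?_⟩,
      h f ^ l * (r₁' * s) + h r₁ * r₂', ?_⟩
    · rw [map_mul, ← hr₁, ← hr₂]
      ring
    · have hr₁'' := congrArg (invMap p h) hr₁
      simp only [map_mul, map_pow, map_natCast, invMap_algebraMap] at hr₁''
      simp only [map_add, map_mul, map_pow, ← hs, ← hr₁'']
      linear_combination (algebraMap R' _ (h f)) ^ l * z₂ * hr₁' + invMap p h e₁ * hr₂'

/-- Surjectivity modulo `p` is the approximation at precision `1`. For injectivity, if `e` maps to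
`p z`, then `z` is approximated by `e₂/f^k`, denominators are cleared, and injectivity of `h` modulo
powers of `p` is applied in `R`. -/
theorem ploc_subalgebraMap (hR' : TorsionFree p R') {h : R →+* R'} {f : R} (hf : PLoc p h f)
    {E : Subalgebra R (Localization.Away (p : R))} {E' : Subalgebra R' (Localization.Away (p : R'))}
    (H : ∀ z ∈ E, invMap p h z ∈ E')
    (happrox : ∀ z ∈ E', ∃ N : ℕ, ∀ M : ℕ, ∃ k : ℕ, ∃ e ∈ E,
      (∃ r : R, (p : Localization.Away (p : R)) ^ N * e = algebraMap R _ r) ∧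
      ∃ r' : R', algebraMap R' (Localization.Away (p : R')) (h f) ^ k * z - invMap p h e =
        p ^ M * algebraMap R' _ r') :
    PLoc p (subalgebraMap h H) (algebraMap R _ f) := by
  have hc (r : R) : ((algebraMap R E r : E) : Localization.Away (p : R)) = algebraMap R _ r := rfl
  have hc' (r : R') : ((algebraMap R' E' r : E') :
    Localization.Away (p : R')) = algebraMap R' _ r := rfl
  have hfe := subalgebraMap_algebraMap h H
  have hn : ((p : E) : Localization.Away (p : R)) = p := rfl
  have hn' : ((p : E') : Localization.Away (p : R')) = p := rfl
  refine ⟨?_, fun b => ?_, fun e he => ?_⟩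
  · rw [hfe]
    exact hf.unit.map _
  · obtain ⟨N, hN⟩ := happrox b b.2
    obtain ⟨k, e, he, -, r', hr'⟩ := hN 1
    refine ⟨k, ⟨e, he⟩, algebraMap R' _ r', Subtype.ext ?_⟩
    rw [hfe]
    simpa [coe_subalgebraMap] using hr'
  · obtain ⟨z, hz⟩ := he
    obtain ⟨N₁, hN⟩ := happrox z z.2
    obtain ⟨N₂, s, hs⟩ := exists_pow_mul_eq_algebraMap (e : Localization.Away (p : R))
    -- The factor `p^(N₁+N₂)` clears the denominators of `e₂` and `e` and is cancelled at the end.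
    -- At this precision the remainder is still `p^(N₁+N₂+1)` times an element of `R`, hence `p`
    -- times an element of the envelope.
    obtain ⟨k, e₂, he₂, ⟨r₂, hr₂⟩, r', hr'⟩ := hN (N₁ + N₂)
    have hz' := congrArg Subtype.val hz
    rw [coe_subalgebraMap] at hz'
    simp only [Subalgebra.coe_mul, hn'] at hz'
    have h1 : (p : R') ^ ((N₁ + N₂) + (N₁ + N₂) + 1) ∣
        h (p ^ N₁ * f ^ k * s - p ^ (N₂ + 1) * r₂) := by
      refine ⟨r', algebraMap_away_injective hR' ?_⟩
      have hs' := congrArg (invMap p h) hs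
      have hr₂' := congrArg (invMap p h) hr₂
      simp only [map_mul, map_pow, map_natCast, invMap_algebraMap] at hs' hr₂'
      simp only [map_sub, map_mul, map_pow, map_natCast, ← hs', ← hr₂']
      linear_combination p ^ (N₁ + N₂ + 1) * hr' +
        p ^ (N₁ + N₂) * algebraMap R' _ (h f) ^ k * hz'
    obtain ⟨l, c, hl⟩ := hf.inj_pow hR' _ _ h1
    refine ⟨l + k, ⟨algebraMap R _ f ^ l * e₂ + p ^ (N₁ + N₂) * algebraMap R _ c, ?_⟩,
      Subtype.ext ?_⟩
    · exact add_mem (mul_mem (pow_mem (Subalgebra.algebraMap_mem _ _) _) he₂)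
        (mul_mem (pow_mem (Subalgebra.natCast_mem _ p) _) (Subalgebra.algebraMap_mem _ _))
    · have hl' := congrArg (algebraMap R (Localization.Away (p : R))) hl
      simp only [map_sub, map_mul, map_pow, map_natCast, ← hs, ← hr₂] at hl'
      refine natCast_pow_mul_cancel (n := N₁ + N₂) ?_
      simp only [Subalgebra.coe_mul, Subalgebra.coe_pow, hc, hn]
      linear_combination hl'

/-- Apart from the unit condition, which `ι'` preserves, `PLoc` only involves the rings modulo `p`.
-/
theorem PLoc.completion {A B A' B' : Type*} [CommRing A] [CommRing B] [CommRing A'] [CommRing B']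
    {g : A →+* B} {f : A} (h : PLoc p g f) {ι : A →+* A'} {ι' : B →+* B'} (hι : BijModP p ι)
    (hι' : BijModP p ι') {g' : A' →+* B'} (hg : ∀ a, g' (ι a) = ι' (g a)) : PLoc p g' (ι f) where
  unit := by
    rw [hg]
    exact h.unit.map ι'
  surj b := by
    obtain ⟨c, hc⟩ := hι'.surj b
    obtain ⟨k, a, ha⟩ := h.surj c
    refine ⟨k, ι a, ?_⟩
    have := dvd_add (hc.mul_left (ι' (g f) ^ k)) (map_dvd_natCast ι' ha)
    rw [hg, hg]
    convert this using 1
    simp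
    ring
  inj a ha := by
    obtain ⟨c, hc⟩ := hι.surj a
    have h1 : (p : B') ∣ ι' (g c) := by
      have := map_dvd_natCast g' hc
      rw [map_sub, hg] at this
      exact (dvd_sub_right ha).1 this
    obtain ⟨k, hk⟩ := h.inj c (hι'.inj _ h1)
    refine ⟨k, ?_⟩
    have := dvd_add (hc.mul_left (ι f ^ k)) (map_dvd_natCast ι hk)
    convert this using 1
    simp
    ring

variable {S S' : Type u} [CommRing S'] [CommRing S]

/-- The `R`-algebra `S` is the prismatic envelope of `(R, φ, I)`. -/
def IsEnvelope (p : ℕ) (φ : R →+* R) (I : Ideal R) (θ : R →+* S) : Prop :=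
  ∃ e : Envelope p φ I ≃+* S, ∀ r, e (algebraMap R _ r) = θ r

theorem isEnvelope_algebraMap (I : Ideal R) : IsEnvelope p φ I (algebraMap R (Envelope p φ I)) :=
  ⟨RingEquiv.refl _, fun _ => rfl⟩

theorem IsEnvelope.tfComplete {I : Ideal R} {θ : R →+* S} (h : IsEnvelope p φ I θ) :
    TFComplete p S :=
  (tfComplete_adicCompletion (torsionFree_subalgebra _)).of_equiv h.choose

theorem IsEnvelope.congr [hp : Fact p.Prime] {φ₂ : R →+* R} (hφ : ∀ x, (p : R) ∣ φ x - x ^ p)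
    (hφ₂ : ∀ x, (p : R) ∣ φ₂ x - x ^ p) (hh : ∀ x, (p : R) ^ 2 ∣ φ₂ x - φ x) {I : Ideal R}
    {θ : R →+* S} (h : IsEnvelope p φ I θ) : IsEnvelope p φ₂ I θ := by
  have e : envelope₀ p φ I = envelope₀ p φ₂ I := by
    refine le_antisymm (envelope₀_le_of_congr hφ hφ₂ hh I) (envelope₀_le_of_congr hφ₂ hφ ?_ I)
    intro x
    rw [dvd_sub_comm]
    exact hh x
  -- The subalgebra occurs in the type of the completion, so the equality is substituted with both
  -- sides generalized to variables.
  have key (E E' : Subalgebra R (Localization.Away (p : R))) (h : E = E') :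
      (∃ e : AdicCompletion (Ideal.span {(p : E)}) E ≃+* S, ∀ r, e (algebraMap R _ r) = θ r) →
      ∃ e : AdicCompletion (Ideal.span {(p : E')}) E' ≃+* S, ∀ r, e (algebraMap R _ r) = θ r := by
    subst h
    exact id
  exact key _ _ e h

/-- Every element of the uncompleted envelope has a `p`-power multiple coming from `R`, and powers
of `p` cancel in `S'`; density extends the equality to the completion. -/
theorem IsEnvelope.hom_ext {I : Ideal R} {θ : R →+* S} (h : IsEnvelope p φ I θ)
    (hS : TFComplete p S') {f g : S →+* S'} (hfg : ∀ r, f (θ r) = g (θ r)) : f = g := by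
  obtain ⟨e, he⟩ := h
  have := hS.complete
  have key : f.comp e.toRingHom = g.comp e.toRingHom := by
    refine adicCompletion_ext inferInstance fun z => ?_
    obtain ⟨N, r, hr⟩ := exists_pow_mul_eq_algebraMap (z : Localization.Away (p : R))
    have hr' : (p : envelope₀ p φ I) ^ N * z = algebraMap R _ r := Subtype.ext (by simpa using hr)
    refine hS.tf.pow_mul_cancel N ?_
    have e1 (F : S →+* S') : (p : S') ^ N * (F.comp e.toRingHom) (algebraMap _ _ z) = F (θ r) := by
      rw [← he, ← map_natCast (F.comp e.toRingHom), ← map_pow, ← map_natCast (algebraMap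
        (envelope₀ p φ I) (Envelope p φ I)), ← map_pow, ← map_mul, ← map_mul, hr']
      rfl
    rw [e1, e1, hfg]
  ext x
  obtain ⟨y, rfl⟩ := e.surjective x
  exact congrArg (· y) key

/-- In the envelope `x = p (x/p)`. Hence a partition of unity modulo `I` becomes one modulo `p`, and
`R → S/p` factors through `R/I`. -/
theorem IsEnvelope.dvd_of_mem {I : Ideal R} {θ : R →+* S} (h : IsEnvelope p φ I θ) {x : R}
    (hx : x ∈ I) : (p : S) ∣ θ x := by
  obtain ⟨e, he⟩ := h
  let z : envelope₀ p φ I := ⟨_, mul_invSelf_mem_envelope₀ hx⟩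
  have hz : algebraMap R (envelope₀ p φ I) x = p * z := Subtype.ext (by
    have := natCast_mul_invSelf (p := p) (R := R)
    change algebraMap R (Localization.Away (p : R)) x = (p : Localization.Away (p : R)) *
      (algebraMap R _ x * IsLocalization.Away.invSelf (p : R))
    linear_combination (-algebraMap R _ x) * this)
  rw [← he]
  refine map_dvd_natCast e.toRingHom ⟨algebraMap _ _ z, ?_⟩
  have := congrArg (algebraMap (envelope₀ p φ I) (Envelope p φ I)) hz
  rw [map_mul, map_natCast] at this
  exact this

theorem exists_map_completion {E : Subalgebra R (Localization.Away (p : R))}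
    {E' : Subalgebra R' (Localization.Away (p : R'))} (h : R →+* R')
    (H : ∀ z ∈ E, invMap p h z ∈ E') :
    ∃ g : PCompletion p E →+* PCompletion p E', ∀ r,
      g (algebraMap R (PCompletion p E) r) = algebraMap R' (PCompletion p E') (h r) := by
  have hc := (tfComplete_adicCompletion (torsionFree_subalgebra E')).complete
  obtain ⟨g, hg⟩ := exists_lift_adicCompletion (p := p) (C := PCompletion p E')
    ((algebraMap E' (PCompletion p E')).comp (subalgebraMap h H))
  refine ⟨g, fun r => (hg (algebraMap R E r)).trans ?_⟩
  rw [RingHom.comp_apply, subalgebraMap_algebraMap]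
  rfl

/-- The map `g` is prescribed on `R` only. It agrees with `subalgebraMap` on all of `E` because
elements of `E` have `p`-power multiples in `R` and the target is torsion free. -/
theorem ploc_completion {E : Subalgebra R (Localization.Away (p : R))}
    {E' : Subalgebra R' (Localization.Away (p : R'))} {h : R →+* R'}
    (H : ∀ z ∈ E, invMap p h z ∈ E') {f : R} (hf : PLoc p (subalgebraMap h H) (algebraMap R _ f))
    {g : PCompletion p E →+* PCompletion p E'}
    (hg : ∀ r, g (algebraMap R _ r) = algebraMap R' _ (h r)) :
    PLoc p g (algebraMap R _ f) := by
  have hc := tfComplete_adicCompletion (torsionFree_subalgebra E')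
  refine hf.completion (ι := algebraMap E (PCompletion p E))
    (ι' := algebraMap E' (PCompletion p E'))
    bijModP_algebraMap bijModP_algebraMap fun z => ?_
  obtain ⟨N, r, hr⟩ := Subalgebra.exists_pow_mul_eq z
  refine hc.tf.pow_mul_cancel N ?_
  have e1 (F : E →+* PCompletion p E') :
      (p : PCompletion p E') ^ N * F z = F (algebraMap R _ r) := by
    rw [← hr, map_mul, map_pow, map_natCast]
  refine (e1 (g.comp (algebraMap _ _))).trans (Eq.trans ?_
    (e1 ((algebraMap _ _).comp (subalgebraMap h H))).symm)
  rw [RingHom.comp_apply, RingHom.comp_apply, subalgebraMap_algebraMap]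
  exact hg r

theorem IsEnvelope.exists_map [hp : Fact p.Prime] (hφ : ∀ x, (p : R) ∣ φ x - x ^ p)
    (hφ' : ∀ x, (p : R') ∣ φ' x - x ^ p) (h : R →+* R')
    (hh : ∀ x, (p : R') ^ 2 ∣ φ' (h x) - h (φ x)) {I : Ideal R} {I' : Ideal R'}
    (hI : ∀ x ∈ I, h x ∈ I') {θ : R →+* S} {θ' : R' →+* S'} (hS : IsEnvelope p φ I θ)
    (hS' : IsEnvelope p φ' I' θ') : ∃ g : S →+* S', ∀ r, g (θ r) = θ' (h r) := by
  obtain ⟨e, he⟩ := hS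
  obtain ⟨e', he'⟩ := hS'
  obtain ⟨g, hg⟩ := exists_map_completion h
    fun z hz => invMap_mem_envelope₀ hφ hφ' h hh hI hz
  refine ⟨(e'.toRingHom.comp g).comp e.symm.toRingHom, fun r => ?_⟩
  rw [← he, ← he', ← hg]
  simp

theorem bijModP_ringEquiv {A B : Type*} [CommRing A] [CommRing B] (e : A ≃+* B) :
    BijModP p e.toRingHom :=
  ⟨fun c => ⟨e.symm c, by simp⟩, fun b hb => by simpa using map_dvd_natCast e.symm.toRingHom hb⟩

theorem PLoc.of_ringEquiv {A B A' B' : Type*} [CommRing A] [CommRing B] [CommRing A'] [CommRing B']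
    {g : A →+* B} {f : A} (h : PLoc p g f) (e : A ≃+* A') (e' : B ≃+* B') {g' : A' →+* B'}
    (hg : ∀ a, g' (e a) = e' (g a)) : PLoc p g' (e f) := by
  exact h.completion (bijModP_ringEquiv e) (bijModP_ringEquiv e') hg

theorem IsEnvelope.ploc [hp : Fact p.Prime] (hR' : TorsionFree p R')
    (hφ : ∀ x, (p : R) ∣ φ x - x ^ p)
    (hφ' : ∀ x, (p : R') ∣ φ' x - x ^ p) {h : R →+* R'} {f : R} (hf : PLoc p h f)
    (hh : ∀ x, (p : R') ^ 2 ∣ φ' (h x) - h (φ x)) {I : Ideal R} {I' : Ideal R'}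
    (hI : I.map h = I') {θ : R →+* S} {θ' : R' →+* S'} (hS : IsEnvelope p φ I θ)
    (hS' : IsEnvelope p φ' I' θ') {g : S →+* S'} (hg : ∀ r, g (θ r) = θ' (h r)) :
    PLoc p g (θ f) := by
  obtain ⟨e, he⟩ := hS
  obtain ⟨e', he'⟩ := hS'
  have H : ∀ z ∈ envelope₀ p φ I, invMap p h z ∈ envelope₀ p φ' I' :=
    fun z hz => invMap_mem_envelope₀ hφ hφ' h hh
      (fun x hx => hI ▸ Ideal.mem_map_of_mem h hx) hz
  have h1 := ploc_subalgebraMap hR' hf H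
    fun z hz => exists_approx_envelope₀ hφ hφ' hf hh hI.ge hz
  have h2 := ploc_completion H h1 (g := (e'.symm.toRingHom.comp g).comp e.toRingHom) fun r => by
    refine e'.injective ?_
    rw [he', ← hg, ← he]
    simp
  rw [← he]
  exact h2.of_ringEquiv e e' fun a => by simp

end Envelope

/-! ### Sheaves of `p`-torsion free rings and their reductions. -/

section Sheaf

variable {T : TopCat.{u}} (F : TopCat.Presheaf CommRingCat.{u} T)

/-- The restriction homomorphism of a presheaf of rings on a space. -/
def rs {U V : Opens T} (h : V ≤ U) : F.obj (op U) →+* F.obj (op V) := (F.map (homOfLE h).op).hom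

@[simp]
theorem rs_rs {U V W : Opens T} (h : V ≤ U) (h' : W ≤ V) (s : F.obj (op U)) :
    rs F h' (rs F h s) = rs F (h'.trans h) s := by
  rw [rs, rs, rs, ← homOfLE_comp h' h, op_comp, F.map_comp]
  rfl

@[simp]
theorem rs_self {U : Opens T} (h : U ≤ U) (s : F.obj (op U)) : rs F h s = s := by
  have : homOfLE h = 𝟙 U := rfl
  rw [rs, this, op_id, F.map_id]
  rfl

theorem rs_naturality {G : TopCat.Presheaf CommRingCat.{u} T} (α : F ⟶ G) {U V : Opens T}
    (h : V ≤ U) (s : F.obj (op U)) : α.app (op V) (rs F h s) = rs G h (α.app (op U) s) :=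
  NatTrans.naturality_apply α (homOfLE h).op s

variable {F}

theorem eq_of_locally_eq (hF : F.IsSheaf) {U : Opens T} {s t : F.obj (op U)}
    (h : ∀ x ∈ U, ∃ (V : Opens T) (hV : V ≤ U), x ∈ V ∧ rs F hV s = rs F hV t) : s = t :=
  TopCat.Presheaf.IsSheaf.section_ext hF fun x hx => by
    obtain ⟨V, hV, hxV, e⟩ := h x hx
    exact ⟨V, hV, hxV, e⟩

theorem exists_section (hF : F.IsSheaf) {ι : Type*} (U : ι → Opens T) (V : Opens T)
    (hU : ∀ i, U i ≤ V) (hV : ∀ x ∈ V, ∃ i, x ∈ U i) (s : ∀ i, F.obj (op (U i)))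
    (hs : ∀ i j, ∀ x, x ∈ U i → x ∈ U j → ∃ (W : Opens T) (h₁ : W ≤ U i) (h₂ : W ≤ U j), x ∈ W ∧
      rs F h₁ (s i) = rs F h₂ (s j)) : ∃ t : F.obj (op V), ∀ i, rs F (hU i) t = s i := by
  obtain ⟨t, ht, -⟩ := TopCat.Sheaf.existsUnique_gluing' ⟨F, hF⟩ U V (fun i => homOfLE (hU i))
    (fun x hx => by
      obtain ⟨i, hi⟩ := hV x hx
      exact Opens.mem_iSup.2 ⟨i, hi⟩) s fun i j => by
      refine eq_of_locally_eq hF fun x hx => ?_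
      obtain ⟨W, h₁, h₂, hxW, e⟩ := hs i j x hx.1 hx.2
      refine ⟨W, le_inf h₁ h₂, hxW, ?_⟩
      refine (rs_rs F _ _ _).trans (e.trans (rs_rs F _ _ _).symm)
  exact ⟨t, ht⟩

variable {p : ℕ}

theorem torsionFree_of_locally (hF : F.IsSheaf) {U : Opens T}
    (h : ∀ x ∈ U, ∃ V ≤ U, x ∈ V ∧ TorsionFree p (F.obj (op V))) : TorsionFree p (F.obj (op U)) :=
  fun s hs => eq_of_locally_eq hF fun x hx => by
    obtain ⟨V, hV, hxV, hV'⟩ := h x hx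
    refine ⟨V, hV, hxV, ?_⟩
    rw [map_zero]
    apply hV'
    rw [← map_natCast (rs F hV), ← map_mul, hs, map_zero]

/-- Local quotients by `p^n` are unique by torsion-freeness, hence they glue. -/
theorem pow_dvd_of_locally (hF : F.IsSheaf) (hp : ∀ U : Opens T, TorsionFree p (F.obj (op U)))
    {n : ℕ} {U : Opens T} {s : F.obj (op U)}
    (h : ∀ x ∈ U, ∃ (V : Opens T) (hV : V ≤ U), x ∈ V ∧ (p : F.obj (op V)) ^ n ∣ rs F hV s) :
    (p : F.obj (op U)) ^ n ∣ s := by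
  choose V hV hxV t ht using fun x : U => h x x.2
  obtain ⟨r, hr⟩ := exists_section hF V U hV (fun x hx => ⟨⟨x, hx⟩, hxV _⟩) t fun i j x hi hj => by
    refine ⟨V i ⊓ V j, inf_le_left, inf_le_right, ⟨hi, hj⟩, (hp _).pow_mul_cancel n ?_⟩
    have e (k : U) (hk : V i ⊓ V j ≤ V k) : (p : F.obj (op (V i ⊓ V j))) ^ n * rs F hk (t k) =
        rs F (hk.trans (hV k)) s := by
      rw [← rs_rs F (hV k) hk, ht]
      simp
    rw [e, e]
  refine ⟨r, eq_of_locally_eq hF fun x hx => ⟨V ⟨x, hx⟩, hV _, hxV _, ?_⟩⟩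
  rw [ht, map_mul, hr]
  simp

/-- Limits are taken on a cover by complete opens. They are unique on small complete opens inside
the overlaps, so they glue over an arbitrary `U`, and divisibility by `p^n` is local. -/
theorem tfComplete_of_locally (hF : F.IsSheaf) {U : Opens T}
    (h : ∀ V ≤ U, ∀ x ∈ V, ∃ W ≤ V, x ∈ W ∧ TFComplete p (F.obj (op W)))
    (hp : ∀ U : Opens T, TorsionFree p (F.obj (op U))) : TFComplete p (F.obj (op U)) where
  tf := hp U
  complete := by
    refine isAdicComplete_span_singleton (fun s hs => ?_) fun s hs => ?_
    · refine eq_of_locally_eq hF fun x hx => ?_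
      obtain ⟨V, hV, hxV, hV'⟩ := h U le_rfl x hx
      exact ⟨V, hV, hxV, hV'.eq_of_forall fun n => by simpa using map_dvd_pow (rs F hV) (hs n)⟩
    · choose V hV hxV hV' using fun x : U => h U le_rfl x x.2
      choose t ht using fun x : U => (hV' x).exists_limit (u := fun n => rs F (hV x) (s n))
        fun n => by simpa using map_dvd_pow (rs F (hV x)) (hs n)
      obtain ⟨r, hr⟩ := exists_section hF V U hV (fun x hx => ⟨⟨x, hx⟩, hxV _⟩) t
        fun i j x hi hj => by
          obtain ⟨W, hW, hxW, hW'⟩ := h (V i ⊓ V j) (inf_le_left.trans (hV i)) x ⟨hi, hj⟩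
          refine ⟨W, hW.trans inf_le_left, hW.trans inf_le_right, hxW, hW'.eq_of_forall fun n => ?_⟩
          have h1 := map_dvd_pow (rs F (hW.trans inf_le_left)) (ht i n)
          have h2 := map_dvd_pow (rs F (hW.trans inf_le_right)) (ht j n)
          rw [map_sub, rs_rs] at h1 h2
          have h3 := dvd_sub h1 h2
          rwa [sub_sub_sub_cancel_right] at h3
      refine ⟨r, fun n => pow_dvd_of_locally hF hp fun x hx => ⟨V ⟨x, hx⟩, hV _, hxV _, ?_⟩⟩
      rw [map_sub, hr]
      exact ht _ n

theorem isSheaf_modPow (n : ℕ) (F : TopCat.Presheaf CommRingCat.{u} T) :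
    (modPow p n F).presheaf.IsSheaf := (modPow p n F).2

instance (n : ℕ) : Presheaf.IsLocallyInjective (Opens.grothendieckTopology T)
    (quotientToModPow p n F) :=
  inferInstanceAs (Presheaf.IsLocallyInjective _
    (toSheafify (Opens.grothendieckTopology T) (modPowPresheaf p n F)))

instance (n : ℕ) : Presheaf.IsLocallySurjective (Opens.grothendieckTopology T)
    (quotientToModPow p n F) :=
  inferInstanceAs (Presheaf.IsLocallySurjective _
    (toSheafify (Opens.grothendieckTopology T) (modPowPresheaf p n F)))

/-- Two sections identified in the sheaf quotient differ by a section locally divisible by `p^n`,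
which is globally divisible by `pow_dvd_of_locally`. -/
theorem quotientToModPow_injective (hF : F.IsSheaf)
    (hp : ∀ U : Opens T, TorsionFree p (F.obj (op U))) (n : ℕ) (U : Opens T) :
    Function.Injective ((quotientToModPow p n F).app (op U)) := by
  intro x y hxy
  obtain ⟨x, rfl⟩ := Ideal.Quotient.mk_surjective (R := F.obj (op U)) x
  obtain ⟨y, rfl⟩ := Ideal.Quotient.mk_surjective (R := F.obj (op U)) y
  have h := Presheaf.equalizerSieve_mem (Opens.grothendieckTopology T) (quotientToModPow p n F)
    (X := op U) _ _ hxy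
  refine (Ideal.Quotient.eq (I := Ideal.span {(p : F.obj (op U)) ^ n})).2 ?_
  rw [Ideal.mem_span_singleton]
  refine pow_dvd_of_locally hF hp fun z hz => ?_
  obtain ⟨V, g, hg, hzV⟩ := h z hz
  refine ⟨V, g.le, hzV, ?_⟩
  have hg' : (Ideal.Quotient.mk (Ideal.span {(p : F.obj (op V)) ^ n})) (rs F g.le x) =
    Ideal.Quotient.mk _ (rs F g.le y) := hg
  rwa [Ideal.Quotient.eq, Ideal.mem_span_singleton, ← map_sub] at hg'

theorem toModPow_eq_zero_iff (hF : F.IsSheaf)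
    (hp : ∀ U : Opens T, TorsionFree p (F.obj (op U))) {n : ℕ} {U : Opens T} {s : F.obj (op U)} :
    (toModPow p n F).app (op U) s = 0 ↔ (p : F.obj (op U)) ^ n ∣ s := by
  refine (map_eq_zero_iff ((quotientToModPow p n F).app (op U)).hom
    (quotientToModPow_injective hF hp n U)).trans ?_
  exact (Ideal.Quotient.eq_zero_iff_mem (I := Ideal.span {(p : F.obj (op U)) ^ n})).trans
    Ideal.mem_span_singleton

theorem toModPow_eq_iff (hF : F.IsSheaf)
    (hp : ∀ U : Opens T, TorsionFree p (F.obj (op U))) {n : ℕ} {U : Opens T} {s t : F.obj (op U)} :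
    (toModPow p n F).app (op U) s = (toModPow p n F).app (op U) t ↔
      (p : F.obj (op U)) ^ n ∣ s - t := by
  rw [← toModPow_eq_zero_iff hF hp, map_sub, sub_eq_zero]

theorem exists_local_toModPow {n : ℕ} {U : Opens T}
    (t : (modPow p n F).presheaf.obj (op U)) (x : T) (hx : x ∈ U) :
    ∃ (V : Opens T) (hV : V ≤ U) (s : F.obj (op V)), x ∈ V ∧
      (toModPow p n F).app (op V) s = rs _ hV t := by
  obtain ⟨V, g, ⟨s, hs⟩, hxV⟩ := Presheaf.imageSieve_mem (Opens.grothendieckTopology T)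
    (quotientToModPow p n F) (U := op U) t x hx
  obtain ⟨s, rfl⟩ := Ideal.Quotient.mk_surjective (R := F.obj (op V)) s
  exact ⟨V, g.le, s, hxV, hs⟩

theorem quotientToModPow_bijective (hF : F.IsSheaf)
    (hp : ∀ U : Opens T, TorsionFree p (F.obj (op U))) (n : ℕ) (U : Opens T)
    (h : Function.Surjective ((toModPow p n F).app (op U))) :
    Function.Bijective ((quotientToModPow p n F).app (op U)) := by
  refine ⟨quotientToModPow_injective hF hp n U, fun t => ?_⟩
  obtain ⟨s, rfl⟩ := h t
  exact ⟨Ideal.Quotient.mk _ s, rfl⟩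

theorem reduction_toModPow {U : Opens T} (s : F.obj (op U)) :
    (reduction p F).hom.app (op U) ((toModPow p 2 F).app (op U) s) =
      (toModPow p 1 F).app (op U) s := by
  have h := toSheafify_naturality (Opens.grothendieckTopology T) (P := modPowPresheaf p 2 F)
    (Q := modPowPresheaf p 1 F)
    { app := fun U => CommRingCat.ofHom (Ideal.Quotient.factor (by
        rw [Ideal.span_le, Set.singleton_subset_iff]
        exact Ideal.mem_span_singleton.mpr (pow_dvd_pow _ one_le_two)))
      naturality := fun U V g => by
        ext x
        obtain ⟨x, rfl⟩ := Ideal.Quotient.mk_surjective (R := F.obj U) x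
        rfl }
  have h' := congrArg (fun α =>
    α.app (op U) (Ideal.Quotient.mk (Ideal.span {(p : F.obj (op U)) ^ 2}) s)) h
  exact h'.symm

end Sheaf

/-! ### The Frobenius lift of a `δ`-structure. -/

section Frobenius

variable {p : ℕ} {A : Type u} [CommRing A]

/-- The primality of `p` makes the division in `p.choose i / p` exact, so the sum in the axiom
`map_add` is `((x+y)^p - x^p - y^p)/p`. -/
theorem DeltaStructure.frob_add [hp : Fact p.Prime] (d : DeltaStructure p A) (x y : A) :
    d.frob (x + y) = d.frob x + d.frob y := by
  obtain ⟨q, rfl⟩ : ∃ q, p = q + 1 := ⟨p - 1, (Nat.succ_pred_eq_of_pos hp.out.pos).symm⟩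
  have h : (x + y) ^ (q + 1) = x ^ (q + 1) + y ^ (q + 1) + ((q + 1 : ℕ) : A) *
      ∑ i ∈ Finset.Ioo 0 (q + 1), (((q + 1).choose i / (q + 1) : ℕ) : A) *
        (x ^ i * y ^ (q + 1 - i)) := by
    rw [add_pow, Finset.sum_range_succ, Finset.sum_range_eq_add_Ico _ q.succ_pos, Finset.mul_sum]
    have : Finset.Ico 1 (q + 1) = Finset.Ioo 0 (q + 1) := by
      ext i
      simp [Nat.succ_le_iff]
    rw [this]
    have h2 : ∀ i ∈ Finset.Ioo 0 (q + 1), x ^ i * y ^ (q + 1 - i) * ((q + 1).choose i : A) =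
        ((q + 1 : ℕ) : A) * ((((q + 1).choose i / (q + 1) : ℕ) : A) *
          (x ^ i * y ^ (q + 1 - i))) := fun i hi => by
      rw [Finset.mem_Ioo] at hi
      obtain ⟨c, hc⟩ := hp.out.dvd_choose_self hi.1.ne' hi.2
      rw [hc, Nat.mul_div_cancel_left _ q.succ_pos]
      push_cast
      ring
    rw [Finset.sum_congr rfl h2]
    simp
    ring
  rw [frob, h, d.map_add, frob, frob]
  ring

/-- The Frobenius lift of a `δ`-structure as a ring homomorphism. -/
def DeltaStructure.frobHom [hp : Fact p.Prime] (d : DeltaStructure p A) : A →+* A where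
  toFun := d.frob
  map_one' := by simp [frob, d.map_one]
  map_zero' := by simp [frob, d.map_zero, hp.out.ne_zero]
  map_mul' x y := by
    rw [frob, frob, frob, d.map_mul]
    ring
  map_add' := d.frob_add

end Frobenius

/-! ### Flatness and torsion; lifting Frobenius by formal smoothness. -/

section Smooth

variable {p : ℕ} {A R : Type u} [CommRing A] [CommRing R]

/-- The morphism `A / p ^ n → R / p ^ n` induced by `α`. -/
abbrev quotPow (p : ℕ) (α : A →+* R) (n : ℕ) :
    A ⧸ Ideal.span {(p : A) ^ n} →+* R ⧸ (Ideal.span {(p : A) ^ n}).map α :=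
  Ideal.quotientMap ((Ideal.span {(p : A) ^ n}).map α) α Ideal.le_comap_map

theorem map_span_natCast_pow (α : A →+* R) (n : ℕ) :
    (Ideal.span {(p : A) ^ n}).map α = Ideal.span {(p : R) ^ n} := by
  rw [Ideal.map_span, Set.image_singleton, map_pow, map_natCast]

/-- By the equational criterion of flatness over `A/p^(n+1)`, a relation `p x = 0` writes `x` as a
combination of elements of the annihilator of `p`, which is generated by `p^n` since `A` is torsion
free. Thus `p^n` divides `x` for every `n`. -/
theorem torsionFree_of_flat {α : A →+* R} (hA : TorsionFree p A)
    (hR : IsHausdorff (Ideal.span {(p : R)}) R) (h : ∀ n, (quotPow p α n).Flat) :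
    TorsionFree p R := by
  intro x hx
  refine eq_zero_of_forall_pow_dvd (q := (p : R)) fun n => ?_
  let A' := A ⧸ Ideal.span {(p : A) ^ (n + 1)}
  let R' := R ⧸ (Ideal.span {(p : A) ^ (n + 1)}).map α
  let _ : Algebra A' R' := (quotPow p α (n + 1)).toAlgebra
  have : Module.Flat A' R' := h (n + 1)
  have hpR : (p : R') = Ideal.Quotient.mk ((Ideal.span {(p : A) ^ (n + 1)}).map α) (p : R) :=
    (map_natCast _ _).symm
  obtain ⟨k, b, y, h1, h2⟩ := Module.Flat.isTrivialRelation_of_sum_smul_eq_zero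
    (ι := Unit) (f := fun _ => (p : A'))
    (x := fun _ => (Ideal.Quotient.mk ((Ideal.span {(p : A) ^ (n + 1)}).map α) x : R')) (by
      rw [Finset.univ_unique, Finset.sum_singleton, Algebra.smul_def,
        map_natCast (algebraMap A' R'), hpR, ← map_mul, hx, map_zero])
  have h3 (j : Fin k) : ∃ c : A', b () j = (p : A') ^ n * c := by
    obtain ⟨c, hc⟩ := Ideal.Quotient.mk_surjective (b () j)
    have h4 := h2 j
    simp only [Finset.univ_unique, Finset.sum_singleton] at h4
    change (p : A') * b () j = 0 at h4
    rw [← hc, ← map_natCast (Ideal.Quotient.mk _), ← map_mul, Ideal.Quotient.eq_zero_iff_mem,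
      Ideal.mem_span_singleton, pow_succ'] at h4
    obtain ⟨e, he⟩ := h4
    refine ⟨Ideal.Quotient.mk _ e, ?_⟩
    rw [← hc, ← map_natCast (Ideal.Quotient.mk _), ← map_pow, ← map_mul]
    congr 1
    exact hA.mul_cancel (by rw [he, mul_assoc])
  choose c hc using h3
  have h5 := h1 ()
  simp only [hc, Algebra.smul_def, map_mul, map_pow, mul_assoc] at h5
  rw [map_natCast (algebraMap A' R')] at h5
  rw [← Finset.mul_sum] at h5
  obtain ⟨z, hz⟩ := Ideal.Quotient.mk_surjective (∑ j, algebraMap A' R' (c j) * y j)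
  rw [← hz, hpR, ← map_pow, ← map_mul, Ideal.Quotient.eq,
    map_span_natCast_pow, Ideal.mem_span_singleton] at h5
  have h6 := dvd_add ((pow_dvd_pow (p : R) n.le_succ).trans h5) (dvd_mul_right ((p : R) ^ n) z)
  simpa using h6

/-- The ring `R/p^(n+1)` is made an algebra over `A/p^(n+1)` through `ψ`, so that a `ψ`-semilinear
lift becomes a homomorphism of algebras. Since `n ≠ 0`, the kernel of the reduction lies in `(p)`
and is nilpotent. -/
theorem exists_lift_succ {α : A →+* R} {ψ : A →+* A} {n : ℕ} (hn : n ≠ 0)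
    (h : (quotPow p α (n + 1)).FormallySmooth) (φ : R →+* R ⧸ Ideal.span {(p : R)} ^ n)
    (hφ : ∀ x, φ (α x) = Ideal.Quotient.mk _ (α (ψ x))) :
    ∃ φ' : R →+* R ⧸ Ideal.span {(p : R)} ^ (n + 1),
      (∀ x, φ' (α x) = Ideal.Quotient.mk _ (α (ψ x))) ∧
      (Ideal.Quotient.factorPow _ n.le_succ).comp φ' = φ := by
  let A' := A ⧸ Ideal.span {(p : A) ^ (n + 1)}
  let R' := R ⧸ (Ideal.span {(p : A) ^ (n + 1)}).map α
  let B := R ⧸ Ideal.span {(p : R)} ^ (n + 1)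
  let C := R ⧸ Ideal.span {(p : R)} ^ n
  let q : B →+* C := Ideal.Quotient.factorPow _ n.le_succ
  have hpB : (p : B) ^ (n + 1) = 0 := by
    rw [← map_natCast (Ideal.Quotient.mk _), ← map_pow, Ideal.Quotient.eq_zero_iff_mem]
    exact Ideal.pow_mem_pow (Ideal.mem_span_singleton_self _) _
  have hpC : (p : C) ^ (n + 1) = 0 := by
    rw [← map_natCast q, ← map_pow, hpB, map_zero]
  let β : A' →+* B := Ideal.Quotient.lift _ ((Ideal.Quotient.mk _).comp (α.comp ψ)) fun a ha => by
    obtain ⟨c, rfl⟩ := Ideal.mem_span_singleton.1 ha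
    rw [map_mul, map_pow, map_natCast, hpB, zero_mul]
  let φ₁ : R' →+* C := Ideal.Quotient.lift _ φ fun a ha => by
    rw [map_span_natCast_pow] at ha
    obtain ⟨c, rfl⟩ := Ideal.mem_span_singleton.1 ha
    rw [map_mul, map_pow, map_natCast, hpC, zero_mul]
  let _ : Algebra A' R' := (quotPow p α (n + 1)).toAlgebra
  let _ : Algebra A' B := β.toAlgebra
  let _ : Algebra A' C := (q.comp β).toAlgebra
  have : Algebra.FormallySmooth A' R' := h
  let qa : B →ₐ[A'] C := { q with commutes' := fun _ => rfl }
  let fa : R' →ₐ[A'] C := { φ₁ with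
    commutes' := fun a => by
      obtain ⟨a, rfl⟩ := Ideal.Quotient.mk_surjective a
      exact hφ a }
  have hq : Function.Surjective qa :=
    Ideal.Quotient.factor_surjective (Ideal.pow_le_pow_right n.le_succ)
  have hnil : IsNilpotent (RingHom.ker (qa : B →+* C)) := by
    refine ⟨n + 1, ?_⟩
    have hle : RingHom.ker (qa : B →+* C) ≤ Ideal.span {(p : B)} := by
      intro b hb
      obtain ⟨b, rfl⟩ := Ideal.Quotient.mk_surjective b
      have hb' : Ideal.Quotient.mk (Ideal.span {(p : R)} ^ n) b = 0 := hb
      rw [Ideal.Quotient.eq_zero_iff_mem] at hb'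
      obtain ⟨c, rfl⟩ := Ideal.mem_span_singleton.1 (Ideal.pow_le_self hn hb')
      rw [map_mul, map_natCast]
      exact Ideal.mul_mem_right _ _ (Ideal.mem_span_singleton_self _)
    refine le_bot_iff.1 ((Ideal.pow_right_mono hle _).trans ?_)
    rw [Ideal.span_singleton_pow (p : B), hpB]
    simp
  let g := Algebra.FormallySmooth.liftOfSurjective fa qa hq hnil
  refine ⟨(g : R' →+* B).comp (Ideal.Quotient.mk _), fun x => ?_, ?_⟩
  · exact g.commutes (Ideal.Quotient.mk _ x)
  · ext x
    exact Algebra.FormallySmooth.liftOfSurjective_apply fa qa hq hnil (Ideal.Quotient.mk _ x)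

theorem exists_lift_of_formallySmooth {α : A →+* R} {ψ : A →+* A}
    [IsAdicComplete (Ideal.span {(p : R)}) R]
    (h : ∀ n, (quotPow p α n).FormallySmooth) {m : ℕ} (hm : m ≠ 0)
    (φ : R →+* R ⧸ Ideal.span {(p : R)} ^ m)
    (hφ : ∀ x, φ (α x) = Ideal.Quotient.mk _ (α (ψ x))) :
    ∃ Φ : R →+* R, ∀ x, Ideal.Quotient.mk _ (Φ x) = φ x := by
  let S (n : ℕ) := {f : R →+* R ⧸ Ideal.span {(p : R)} ^ (m + n) //
    ∀ x, f (α x) = Ideal.Quotient.mk _ (α (ψ x))}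
  have hS (n : ℕ) (f : S n) : ∃ f' : S (n + 1),
      (Ideal.Quotient.factorPow _ (m + n).le_succ).comp f'.1 = f.1 := by
    obtain ⟨f', h1, h2⟩ := exists_lift_succ (by omega) (h (m + n + 1)) f.1 f.2
    exact ⟨⟨f', h1⟩, h2⟩
  choose s hs using hS
  let f (n : ℕ) : S n := Nat.rec (motive := S) ⟨φ, hφ⟩ s n
  have hf (n : ℕ) : (Ideal.Quotient.factorPow _ (m + n).le_succ).comp (f (n + 1)).1 = (f n).1 :=
    hs n (f n)
  -- The lifts start at level `m`; reducing level `m + n` to level `n` produces the system indexed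
  -- by all `n` from which the limit is formed.
  let g (n : ℕ) : R →+* R ⧸ Ideal.span {(p : R)} ^ n :=
    (Ideal.Quotient.factorPow _ (Nat.le_add_left n m)).comp (f n).1
  have hg {k n : ℕ} (hkn : k ≤ n) : (Ideal.Quotient.factorPow _ hkn).comp (g n) = g k := by
    induction n, hkn using Nat.le_induction with
    | base =>
      ext x
      obtain ⟨y, hy⟩ := Ideal.Quotient.mk_surjective (g k x)
      rw [RingHom.comp_apply, ← hy]
      simp [Ideal.Quotient.factorPow]
    | succ n hkn ih =>
      rw [← ih]
      ext x
      simp only [g, RingHom.comp_apply]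
      rw [← hf n, RingHom.comp_apply]
      obtain ⟨y, hy⟩ := Ideal.Quotient.mk_surjective ((f (n + 1)).1 x)
      rw [← hy]
      rfl
  refine ⟨IsAdicComplete.liftRingHom _ g hg, fun x => ?_⟩
  rw [IsAdicComplete.mk_liftRingHom]
  have hk (k : ℕ) : (Ideal.Quotient.factorPow _ (Nat.le_add_right m k)).comp (f k).1 = φ := by
    induction k with
    | zero =>
      ext x
      obtain ⟨y, hy⟩ := Ideal.Quotient.mk_surjective (φ x)
      rw [RingHom.comp_apply, ← hy]
      change Ideal.Quotient.factorPow _ _ (φ x) = _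
      rw [← hy]
      rfl
    | succ k ih =>
      rw [← ih, ← hf k]
      ext x
      simp only [RingHom.comp_apply]
      obtain ⟨y, hy⟩ := Ideal.Quotient.mk_surjective ((f (k + 1)).1 x)
      rw [← hy]
      rfl
  exact congrArg (fun a => a x) (hk m)

end Smooth

/-! ### The spaces `V(p)` and localization modulo `p`. -/

section Localization

variable {p : ℕ} {A B : Type u} [CommRing A] [CommRing B] {h : A →+* B} {f : A}

theorem PLoc.isLocalization (hf : PLoc p h f) (hB : TorsionFree p B) (n : ℕ)
    [Algebra (A ⧸ Ideal.span {(p : A) ^ n}) (B ⧸ Ideal.span {(p : B) ^ n})]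
    (hh : ∀ a, algebraMap (A ⧸ Ideal.span {(p : A) ^ n}) (B ⧸ Ideal.span {(p : B) ^ n})
      (Ideal.Quotient.mk _ a) = Ideal.Quotient.mk _ (h a)) :
    IsLocalization.Away (Ideal.Quotient.mk (Ideal.span {(p : A) ^ n}) f)
      (B ⧸ Ideal.span {(p : B) ^ n}) := by
  refine (isLocalization_iff _ _).2 ⟨?_, ?_, ?_⟩
  · rintro ⟨_, k, rfl⟩
    simp only [map_pow, hh]
    exact (hf.unit.map _).pow k
  · intro b
    obtain ⟨b, rfl⟩ := Ideal.Quotient.mk_surjective b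
    obtain ⟨k, a, ha⟩ := hf.surj_pow n b
    refine ⟨⟨Ideal.Quotient.mk _ a, ⟨_, k, rfl⟩⟩, ?_⟩
    simp only [map_pow, hh]
    rw [← map_pow, ← map_mul, Ideal.Quotient.eq, Ideal.mem_span_singleton, mul_comm]
    exact ha
  · intro a b hab
    obtain ⟨a, rfl⟩ := Ideal.Quotient.mk_surjective a
    obtain ⟨b, rfl⟩ := Ideal.Quotient.mk_surjective b
    rw [hh, hh, Ideal.Quotient.eq, Ideal.mem_span_singleton, ← map_sub] at hab
    obtain ⟨k, hk⟩ := hf.inj_pow hB n _ hab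
    refine ⟨⟨_, k, rfl⟩, ?_⟩
    simp only
    rw [← map_pow, ← map_mul, ← map_mul, Ideal.Quotient.eq, Ideal.mem_span_singleton, ← mul_sub]
    exact hk

/-- The map `V(p) → V(p)` induced by a ring homomorphism. -/
def zeroLocusComap (p : ℕ) (h : A →+* B) (q : PrimeSpectrum.zeroLocus {(p : B)}) :
    PrimeSpectrum.zeroLocus {(p : A)} :=
  ⟨PrimeSpectrum.comap h q.1, by
    have := q.2
    rw [PrimeSpectrum.mem_zeroLocus, Set.singleton_subset_iff] at this ⊢
    simpa using this⟩

theorem natCast_mem (q : PrimeSpectrum.zeroLocus {(p : B)}) : (p : B) ∈ q.1.asIdeal := q.2 rfl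

theorem mem_iff_of_dvd_sub (q : PrimeSpectrum.zeroLocus {(p : B)}) {x y : B}
    (hxy : (p : B) ∣ x - y) : x ∈ q.1.asIdeal ↔ y ∈ q.1.asIdeal := by
  have h := q.1.asIdeal.mem_of_dvd hxy (natCast_mem q)
  refine ⟨fun hx => ?_, fun hy => ?_⟩
  · simpa using sub_mem hx h
  · simpa using add_mem h hy

theorem PLoc.notMem (hf : PLoc p h f) (q : PrimeSpectrum.zeroLocus {(p : B)}) :
    f ∉ (zeroLocusComap p h q).1.asIdeal :=
  fun hq => q.1.2.ne_top (Ideal.eq_top_of_isUnit_mem _ hq hf.unit)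

theorem PLoc.mem_iff (hf : PLoc p h f) (q : PrimeSpectrum.zeroLocus {(p : B)}) {k : ℕ} {a : A}
    {b : B} (hk : (p : B) ∣ h f ^ k * b - h a) :
    b ∈ q.1.asIdeal ↔ a ∈ (zeroLocusComap p h q).1.asIdeal := by
  refine Iff.trans ?_ (mem_iff_of_dvd_sub q hk)
  rw [q.1.2.mul_mem_iff_mem_or_mem]
  have := hf.notMem q
  refine (or_iff_right fun h' => this ?_).symm
  exact q.1.2.mem_of_pow_mem _ h'

/-- Modulo `p` and up to powers of the unit `h f`, every `b` comes from some `a`, so both the points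
and the principal opens of `V(p) ⊆ Spec B` are determined by those downstairs. -/
theorem PLoc.isEmbedding (hf : PLoc p h f) : Topology.IsEmbedding (zeroLocusComap p h) := by
  have hc : Continuous (zeroLocusComap p h) :=
    ((PrimeSpectrum.continuous_comap h).comp continuous_subtype_val).subtype_mk _
  refine ⟨⟨le_antisymm hc.le_induced ?_⟩, fun q q' e => ?_⟩
  · have hb := (PrimeSpectrum.isTopologicalBasis_basic_opens (R := B)).induced
      (Subtype.val : PrimeSpectrum.zeroLocus {(p : B)} → _)
    rw [show (instTopologicalSpaceSubtype : TopologicalSpace (PrimeSpectrum.zeroLocus {(p : B)})) =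
      TopologicalSpace.induced Subtype.val inferInstance from rfl, hb.eq_generateFrom]
    refine le_generateFrom ?_
    rintro _ ⟨_, ⟨b, rfl⟩, rfl⟩
    obtain ⟨k, a, ha⟩ := hf.surj b
    refine ⟨Subtype.val ⁻¹' (PrimeSpectrum.basicOpen a : Set (PrimeSpectrum A)),
      PrimeSpectrum.isOpen_basicOpen.preimage continuous_subtype_val, ?_⟩
    ext q
    exact not_congr (hf.mem_iff q ha).symm
  · refine Subtype.ext (PrimeSpectrum.ext (Ideal.ext fun b => ?_))
    obtain ⟨k, a, ha⟩ := hf.surj b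
    rw [hf.mem_iff q ha, hf.mem_iff q' ha, e]

theorem PLoc.range_zeroLocusComap (hf : PLoc p h f) (hB : TorsionFree p B) :
    Set.range (zeroLocusComap p h) = {q | f ∉ q.1.asIdeal} := by
  refine Set.Subset.antisymm ?_ fun q hq => ?_
  · rintro _ ⟨q, rfl⟩
    exact hf.notMem q
  let A' := A ⧸ Ideal.span {(p : A) ^ 1}
  let B' := B ⧸ Ideal.span {(p : B) ^ 1}
  let _ : Algebra A' B' := (Ideal.quotientMap (Ideal.span {(p : B) ^ 1}) h (by
    rw [Ideal.span_le, Set.singleton_subset_iff]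
    simp)).toAlgebra
  have := hf.isLocalization hB 1 fun _ => rfl
  obtain ⟨q', hq'⟩ : q.1 ∈ Set.range (PrimeSpectrum.comap
      (Ideal.Quotient.mk (Ideal.span {(p : A) ^ 1}))) := by
    rw [range_comap_of_surjective _ _ Ideal.Quotient.mk_surjective, Ideal.mk_ker]
    simp [PrimeSpectrum.zeroLocus_span]
  obtain ⟨q'', hq''⟩ : q' ∈ Set.range (PrimeSpectrum.comap (algebraMap A' B')) := by
    rw [PrimeSpectrum.localization_away_comap_range B'
      (Ideal.Quotient.mk (Ideal.span {(p : A) ^ 1}) f)]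
    change f ∉ q.1.asIdeal at hq
    rw [← hq'] at hq
    exact hq
  refine ⟨⟨PrimeSpectrum.comap (Ideal.Quotient.mk _) q'', ?_⟩, Subtype.ext ?_⟩
  · rw [PrimeSpectrum.mem_zeroLocus, Set.singleton_subset_iff]
    change Ideal.Quotient.mk _ (p : B) ∈ q''.asIdeal
    rw [Ideal.Quotient.eq_zero_iff_mem.2 (by rw [pow_one]; exact Ideal.mem_span_singleton_self _)]
    exact zero_mem _
  · rw [← hq', ← hq'']
    rfl

end Localization

/-! ### Affinoid opens and their principal opens. -/

section Affinoid

variable {p : ℕ} {Y : RingedSpace.{u, u}} {U : Opens Y}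

theorem exists_chart_le (h : U ≃ₜ PrimeSpectrum.zeroLocus {(p : Y.presheaf.obj (op U))})
    {V : Opens Y} {y : Y} (hy : y ∈ U) (hyV : y ∈ V) :
    ∃ (f : Y.presheaf.obj (op U)) (W : Opens Y), W ≤ U ∧ W ≤ V ∧ y ∈ W ∧
      ∀ z : U, (z : Y) ∈ W ↔ f ∉ (h z).1.asIdeal := by
  have hO : IsOpen (h '' (Subtype.val ⁻¹' (V : Set Y))) :=
    h.isOpenMap _ (V.2.preimage continuous_subtype_val)
  have hb := (PrimeSpectrum.isTopologicalBasis_basic_opens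
    (R := Y.presheaf.obj (op U))).isInducing (Topology.IsInducing.subtypeVal
      (t := PrimeSpectrum.zeroLocus {(p : Y.presheaf.obj (op U))}))
  obtain ⟨_, ⟨_, ⟨f, rfl⟩, rfl⟩, hyf, hf⟩ := hb.exists_subset_of_mem_open
    (show h ⟨y, hy⟩ ∈ h '' (Subtype.val ⁻¹' (V : Set Y)) from ⟨⟨y, hy⟩, hyV, rfl⟩) hO
  have hW : IsOpen (Subtype.val '' {z : U | f ∉ (h z).1.asIdeal}) :=
    U.2.isOpenMap_subtype_val _ ((PrimeSpectrum.isOpen_basicOpen (a := f)).preimage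
      (continuous_subtype_val.comp h.continuous))
  refine ⟨f, ⟨_, hW⟩, ?_, ?_, ⟨_, hyf, rfl⟩, fun z => ?_⟩
  · rintro _ ⟨z, -, rfl⟩
    exact z.2
  · rintro _ ⟨z, hz, rfl⟩
    obtain ⟨z', hz', e⟩ := hf hz
    rw [← h.injective e]
    exact hz'
  · exact Subtype.val_injective.mem_set_image

theorem torsionFree_of_chart (hU : IsAffinoid p Y U) (h : TorsionFree p (Y.presheaf.obj (op U)))
    {V : Opens Y} {y : Y} (hy : y ∈ U) (hyV : y ∈ V) :
    ∃ W ≤ V, y ∈ W ∧ TorsionFree p (Y.presheaf.obj (op W)) := by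
  obtain ⟨-, e, he⟩ := hU
  obtain ⟨f, W, hW, hWV, hyW, hf⟩ := exists_chart_le e hy hyV
  obtain ⟨e', -⟩ := he f W hW hf
  exact ⟨W, hWV, hyW, ((tfComplete_completedLocalization h f).of_equiv e').tf⟩

theorem FormalScheme.IsSmoothOver.torsionFree {Y : FormalScheme.{u} p} {A : Type u} [CommRing A]
    {a : A →+* Y.sections ⊤} (hY : Y.IsSmoothOver a) (hA : TorsionFree p A)
    (V : Opens Y.toRingedSpace) : TorsionFree p (Y.toRingedSpace.presheaf.obj (op V)) := by
  refine torsionFree_of_locally Y.toRingedSpace.IsSheaf fun y hy => ?_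
  obtain ⟨U, hyU, hU, hs⟩ := hY y
  have := hU.1
  exact torsionFree_of_chart hU (torsionFree_of_flat hA inferInstance fun n => (hs n).flat) hyU hy

variable (hp : ∀ V : Opens Y, TorsionFree p (Y.presheaf.obj (op V)))
include hp

theorem ploc_of_chart {h : U ≃ₜ PrimeSpectrum.zeroLocus {(p : Y.presheaf.obj (op U))}}
    (hh : ∀ (f : Y.presheaf.obj (op U)) (W : Opens Y) (hW : W ≤ U),
      (∀ y : U, (y : Y) ∈ W ↔ f ∉ (h y).1.asIdeal) →
      ∃ e : CompletedLocalization p (Y.presheaf.obj (op U)) f ≃+* Y.presheaf.obj (op W),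
        ∀ r : Y.presheaf.obj (op U),
          e (algebraMap _ (CompletedLocalization p (Y.presheaf.obj (op U)) f) r) =
            Y.presheaf.map (homOfLE hW).op r) {f : Y.presheaf.obj (op U)} {W : Opens Y}
    (hW : W ≤ U) (hf : ∀ y : U, (y : Y) ∈ W ↔ f ∉ (h y).1.asIdeal) :
    PLoc p (rs Y.presheaf hW) f ∧ TFComplete p (Y.presheaf.obj (op W)) := by
  obtain ⟨e, he⟩ := hh f W hW hf
  exact ⟨PLoc.of_equiv e he, (tfComplete_completedLocalization (hp U) f).of_equiv e⟩

/-- `Y` is only a ringed space, so invertibility of a germ has to be compared with non-vanishing in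
the chart. This frees all later arguments from the choice of a chart. -/
theorem mem_basicOpen_iff_of_chart
    {h : U ≃ₜ PrimeSpectrum.zeroLocus {(p : Y.presheaf.obj (op U))}}
    (hh : ∀ (f : Y.presheaf.obj (op U)) (W : Opens Y) (hW : W ≤ U),
      (∀ y : U, (y : Y) ∈ W ↔ f ∉ (h y).1.asIdeal) →
      ∃ e : CompletedLocalization p (Y.presheaf.obj (op U)) f ≃+* Y.presheaf.obj (op W),
        ∀ r : Y.presheaf.obj (op U),
          e (algebraMap _ (CompletedLocalization p (Y.presheaf.obj (op U)) f) r) =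
            Y.presheaf.map (homOfLE hW).op r) (f : Y.presheaf.obj (op U)) (y : U) :
    (y : Y) ∈ Y.basicOpen f ↔ f ∉ (h y).1.asIdeal := by
  refine ⟨fun hy hf => ?_, fun hf => ?_⟩
  · obtain ⟨g, W, hWU, hW, hyW, hg⟩ := exists_chart_le h y.2 hy
    obtain ⟨hl, -⟩ := ploc_of_chart hp hh hWU hg
    have hu : IsUnit (rs Y.presheaf hWU f) := by
      have := (Y.isUnit_res_basicOpen f).map (rs Y.presheaf hW)
      change IsUnit (rs Y.presheaf hW (rs Y.presheaf (Y.basicOpen_le f) f)) at this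
      rwa [rs_rs] at this
    obtain ⟨b, hb⟩ := hu.exists_right_inv
    obtain ⟨k, r, hr⟩ := hl.surj b
    -- Near `y` the section `f` has an inverse, which is `r/g^k` modulo `p`. Hence a power of `g`
    -- lies in the ideal `(f, p)`, and `f` cannot vanish where `g` does not.
    obtain ⟨l, hl⟩ := hl.inj (g ^ k - f * r) (by
      rw [map_sub, map_pow, map_mul]
      have := hr.mul_left (rs Y.presheaf hWU f)
      rwa [mul_sub, mul_left_comm, hb, mul_one] at this)
    refine (hg y).1 hyW ((h y).1.2.mem_of_pow_mem (l + k) ?_)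
    have h1 : g ^ (l + k) - f * (g ^ l * r) ∈ (h y).1.asIdeal :=
      Ideal.mem_of_dvd _ (hl.trans (dvd_of_eq (by ring))) (natCast_mem _)
    simpa using add_mem h1 (Ideal.mul_mem_right (g ^ l * r) _ hf)
  · have hO : IsOpen (Subtype.val '' {z : U | f ∉ (h z).1.asIdeal}) :=
      U.2.isOpenMap_subtype_val _ ((PrimeSpectrum.isOpen_basicOpen (a := f)).preimage
        (continuous_subtype_val.comp h.continuous))
    obtain ⟨hl, -⟩ := ploc_of_chart hp hh (W := ⟨_, hO⟩) (by rintro _ ⟨z, -, rfl⟩; exact z.2)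
      (f := f) fun z => Subtype.val_injective.mem_set_image
    rw [Y.mem_basicOpen f y.1 y.2]
    have hy : y.1 ∈ (⟨_, hO⟩ : Opens Y) := ⟨y, hf, rfl⟩
    have := hl.unit.map (Y.presheaf.germ _ y.1 hy).hom
    rwa [show (Y.presheaf.germ _ y.1 hy).hom (rs Y.presheaf _ f) = _ from
      Y.presheaf.germ_res_apply _ _ _ _] at this

theorem IsAffinoid.exists_chart (hU : IsAffinoid p Y U) :
    ∃ h : U ≃ₜ PrimeSpectrum.zeroLocus {(p : Y.presheaf.obj (op U))},
      ∀ (f : Y.presheaf.obj (op U)) (y : U), (y : Y) ∈ Y.basicOpen f ↔ f ∉ (h y).1.asIdeal := by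
  obtain ⟨-, h, hh⟩ := hU
  exact ⟨h, mem_basicOpen_iff_of_chart hp hh⟩

theorem IsAffinoid.ploc_and_tfComplete (hU : IsAffinoid p Y U) (f : Y.presheaf.obj (op U)) :
    PLoc p (rs Y.presheaf (Y.basicOpen_le f)) f ∧
      TFComplete p (Y.presheaf.obj (op (Y.basicOpen f))) := by
  obtain ⟨-, h, hh⟩ := hU
  exact ploc_of_chart hp hh _ (mem_basicOpen_iff_of_chart hp hh f)

theorem IsAffinoid.ploc (hU : IsAffinoid p Y U) (f : Y.presheaf.obj (op U)) :
    PLoc p (rs Y.presheaf (Y.basicOpen_le f)) f := (hU.ploc_and_tfComplete hp f).1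

theorem IsAffinoid.basicOpen_eq_of_dvd (hU : IsAffinoid p Y U) {f g : Y.presheaf.obj (op U)}
    (hfg : (p : Y.presheaf.obj (op U)) ∣ f - g) : Y.basicOpen f = Y.basicOpen g := by
  obtain ⟨h, hh⟩ := hU.exists_chart hp
  ext y
  by_cases hy : y ∈ U
  · exact (hh f ⟨y, hy⟩).trans ((not_congr (mem_iff_of_dvd_sub _ hfg)).trans (hh g ⟨y, hy⟩).symm)
  · exact iff_of_false (fun h => hy (Y.basicOpen_le f h)) fun h => hy (Y.basicOpen_le g h)

/-- By `PLoc`, the space `V(p)` of the completed localization is the locus `f ≠ 0` in that of `R`,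
which gives the chart. Its principal opens are those of products `f r` on `U`. -/
theorem IsAffinoid.basicOpen (hU : IsAffinoid p Y U) (f : Y.presheaf.obj (op U)) :
    IsAffinoid p Y (Y.basicOpen f) := by
  have hl := hU.ploc hp f
  have hc := (hU.ploc_and_tfComplete hp f).2
  obtain ⟨h, hh⟩ := hU.exists_chart hp
  let j : Y.basicOpen f → U := Set.inclusion (Y.basicOpen_le f)
  have hj : Topology.IsEmbedding j := Topology.IsEmbedding.inclusion (Y.basicOpen_le f)
  let e₁ := (h.isEmbedding.comp hj).toHomeomorph
  let e₂ := hl.isEmbedding.toHomeomorph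
  have hr : Set.range (h ∘ j) =
      Set.range (zeroLocusComap p (rs Y.presheaf (Y.basicOpen_le f))) := by
    rw [hl.range_zeroLocusComap (hp _)]
    ext q
    constructor
    · rintro ⟨y, rfl⟩
      exact (hh f (j y)).1 y.2
    · intro hq
      obtain ⟨y, rfl⟩ := h.surjective q
      exact ⟨⟨y, (hh f y).2 hq⟩, rfl⟩
  let e := (e₁.trans (Homeomorph.setCongr hr)).trans e₂.symm
  have he (y : Y.basicOpen f) :
      zeroLocusComap p (rs Y.presheaf (Y.basicOpen_le f)) (e y) = h (j y) := by
    have : e₂ (e y) = Homeomorph.setCongr hr (e₁ y) := e₂.apply_symm_apply _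
    exact congrArg Subtype.val this
  refine ⟨hc.complete, e, fun g W hW hg => ?_⟩
  obtain ⟨k, r, hr⟩ := hl.surj g
  have hWr : W = Y.basicOpen (f * r) := by
    ext y
    rw [RingedSpace.basicOpen_mul]
    constructor
    · intro hy
      refine ⟨hW hy, ?_⟩
      have := (hg ⟨y, hW hy⟩).1 hy
      rw [hl.mem_iff _ hr, he] at this
      exact (hh r (j ⟨y, hW hy⟩)).2 this
    · rintro ⟨hy, hy'⟩
      refine (hg ⟨y, hy⟩).2 ?_
      rw [hl.mem_iff _ hr, he]
      exact (hh r (j ⟨y, hy⟩)).1 hy'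
  subst hWr
  have hl₂ := hU.ploc hp (f * r)
  have hc₂ := (hU.ploc_and_tfComplete hp (f * r)).2
  have hcomp : (rs Y.presheaf hW).comp (rs Y.presheaf (Y.basicOpen_le f)) =
      rs Y.presheaf (Y.basicOpen_le (f * r)) := by
    ext x
    exact rs_rs _ _ _ _
  refine (hl.of_comp (g' := rs Y.presheaf hW) (by rw [hcomp]; exact hl₂) hr ?_).exists_equiv
    (hp _) hc₂
  have hu := hl₂.unit
  rw [map_mul] at hu
  obtain ⟨v, hv⟩ := (isUnit_of_mul_isUnit_right hu).exists_right_inv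
  have h1 := map_dvd_natCast (rs Y.presheaf hW) hr
  rw [map_sub, map_mul, map_pow, rs_rs, rs_rs] at h1
  -- Modulo `p` one has `f^k g = r`, and `v` inverts `r`, so `f^k v` inverts `g`.
  refine hc₂.isUnit (y := rs Y.presheaf (Y.basicOpen_le (f * r)) f ^ k * v) ?_
  have h2 := h1.mul_right v
  rw [sub_mul, hv] at h2
  convert h2 using 2
  ring

theorem IsAffinoid.exists_basicOpen_le (hU : IsAffinoid p Y U) {V : Opens Y} {y : Y} (hy : y ∈ U)
    (hyV : y ∈ V) : ∃ f : Y.presheaf.obj (op U), y ∈ Y.basicOpen f ∧ Y.basicOpen f ≤ V := by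
  obtain ⟨h, hh⟩ := hU.exists_chart hp
  obtain ⟨f, W, hW, hWV, hyW, hf⟩ := exists_chart_le h hy hyV
  have : W = Y.basicOpen f := by
    ext z
    refine ⟨fun hz => (hh f ⟨z, hW hz⟩).2 ((hf ⟨z, hW hz⟩).1 hz), fun hz => ?_⟩
    have hzU := Y.basicOpen_le f hz
    exact (hf ⟨z, hzU⟩).2 ((hh f ⟨z, hzU⟩).1 hz)
  subst this
  exact ⟨f, hyW, hWV⟩

theorem IsAffinoid.exists_basicOpen_eq (hU : IsAffinoid p Y U) {f : Y.presheaf.obj (op U)}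
    (g : Y.presheaf.obj (op (Y.basicOpen f))) :
    ∃ r : Y.presheaf.obj (op U), Y.basicOpen g = Y.basicOpen (f * r) := by
  obtain ⟨k, r, hr⟩ := (hU.ploc hp f).surj g
  refine ⟨r, ?_⟩
  have h1 := (hU.basicOpen hp f).basicOpen_eq_of_dvd hp hr
  have hu : Y.basicOpen (rs Y.presheaf (Y.basicOpen_le f) f ^ k) = Y.basicOpen f :=
    Y.basicOpen_of_isUnit ((hU.ploc hp f).unit.pow k)
  rw [RingedSpace.basicOpen_mul, hu] at h1
  rw [RingedSpace.basicOpen_mul, ← inf_eq_right.2 (Y.basicOpen_le g), h1]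
  exact Y.basicOpen_res (homOfLE (Y.basicOpen_le f)).op r

/-- As for schemes: a principal open of `U'` contained in a principal open of `U` is itself
principal in `U`. -/
theorem IsAffinoid.exists_common (hU : IsAffinoid p Y U) {U' : Opens Y} (hU' : IsAffinoid p Y U')
    {y : Y} (hy : y ∈ U) (hy' : y ∈ U') :
    ∃ (f : Y.presheaf.obj (op U)) (g : Y.presheaf.obj (op U')), y ∈ Y.basicOpen f ∧
      Y.basicOpen f = Y.basicOpen g := by
  obtain ⟨f, hyf, hf⟩ := hU.exists_basicOpen_le hp hy hy'
  obtain ⟨g, hyg, hg⟩ := hU'.exists_basicOpen_le hp hy' hyf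
  obtain ⟨r, hr⟩ := hU.exists_basicOpen_eq hp (rs Y.presheaf hf g)
  have : Y.basicOpen (rs Y.presheaf hf g) = Y.basicOpen f ⊓ Y.basicOpen g :=
    Y.basicOpen_res (homOfLE hf).op g
  rw [inf_eq_right.2 hg] at this
  refine ⟨f * r, g, ?_, ?_⟩
  · rw [← hr, this]
    exact hyg
  · rw [← hr, this]

omit hp in
theorem exists_sum_of_span_sup_eq_top {R : Type*} [CommRing R] {ι : Type*} {f : ι → R}
    {J : Ideal R} (h : Ideal.span (Set.range f) ⊔ J = ⊤) :
    ∃ (m : ℕ) (j : Fin m → ι) (c : Fin m → R), 1 - ∑ a, c a * f (j a) ∈ J := by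
  have h1 : (1 : R) ∈ Ideal.span (Set.range f) ⊔ J := h ▸ Submodule.mem_top
  obtain ⟨x, hx, y, hy, hxy⟩ := Submodule.mem_sup.1 h1
  obtain ⟨c, hc⟩ := Finsupp.mem_ideal_span_range_iff_exists_finsupp.1 hx
  refine ⟨c.support.card, fun a => (c.support.equivFin.symm a : ι),
    fun a => c (c.support.equivFin.symm a : ι), ?_⟩
  rw [Equiv.sum_comp c.support.equivFin.symm (fun i : c.support => c i * f i),
    Finset.sum_coe_sort c.support (fun i => c i * f i)]
  rw [Finsupp.sum] at hc
  rw [hc, ← hxy, add_sub_cancel_left]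
  exact hy

/-- A maximal ideal containing `p` and all the `f_j` would be a point of the chart outside every
`Y.basicOpen (f j)`. -/
theorem IsAffinoid.span_eq_top (hU : IsAffinoid p Y U) {ι : Type*}
    {f : ι → Y.presheaf.obj (op U)} (hf : ∀ y ∈ U, ∃ j, y ∈ Y.basicOpen (f j)) :
    Ideal.span (Set.range f) ⊔ Ideal.span {(p : Y.presheaf.obj (op U))} = ⊤ := by
  obtain ⟨h, hh⟩ := hU.exists_chart hp
  by_contra hne
  obtain ⟨m, hm, hle⟩ := Ideal.exists_le_maximal _ hne
  have hpm : (⟨m, hm.isPrime⟩ : PrimeSpectrum _) ∈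
      PrimeSpectrum.zeroLocus {(p : Y.presheaf.obj (op U))} := by
    rw [PrimeSpectrum.mem_zeroLocus, Set.singleton_subset_iff]
    exact hle (Ideal.mem_sup_right (Ideal.mem_span_singleton_self _))
  obtain ⟨y, hy⟩ := h.surjective ⟨_, hpm⟩
  obtain ⟨j, hj⟩ := hf y y.2
  refine (hh (f j) y).1 hj ?_
  rw [hy]
  exact hle (Ideal.mem_sup_left (Ideal.subset_span ⟨j, rfl⟩))

end Affinoid

/-! ### Smoothness modulo `p^n` is local. -/

section Reduction

variable {p : ℕ} {A B C : Type u} [CommRing A] [CommRing B] [CommRing C]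

/-- The morphism `A / p ^ n → B / p ^ n` induced by `h`. -/
def redPow (p : ℕ) (h : A →+* B) (n : ℕ) :
    A ⧸ Ideal.span {(p : A) ^ n} →+* B ⧸ Ideal.span {(p : B) ^ n} :=
  Ideal.quotientMap (Ideal.span {(p : B) ^ n}) h (by
    rw [Ideal.span_le, Set.singleton_subset_iff]
    simp)

theorem redPow_comp (g : B →+* C) (h : A →+* B) (n : ℕ) :
    redPow p (g.comp h) n = (redPow p g n).comp (redPow p h n) := by
  ext x
  rfl

theorem smooth_redPow_iff (h : A →+* B) (n : ℕ) :
    (redPow p h n).Smooth ↔ (quotPow p h n).Smooth := by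
  let e := Ideal.quotEquivOfEq (map_span_natCast_pow (p := p) h n)
  have h1 : (e : _ →+* _).comp (quotPow p h n) = redPow p h n := by
    ext x
    rfl
  have h2 : (e.symm : _ →+* _).comp (redPow p h n) = quotPow p h n := by
    ext x
    rfl
  refine ⟨fun H => ?_, fun H => ?_⟩
  · rw [← h2]
    exact H.comp (.of_bijective e.symm.bijective)
  · rw [← h1]
    exact H.comp (.of_bijective e.bijective)

theorem PLoc.smooth_redPow {h : A →+* B} {f : A} (hf : PLoc p h f) (hB : TorsionFree p B) (n : ℕ) :
    (redPow p h n).Smooth := by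
  algebraize [redPow p h n]
  have := hf.isLocalization hB n fun _ => rfl
  exact RingHom.Smooth.holdsForLocalizationAway _ (Ideal.Quotient.mk (Ideal.span {(p : A) ^ n}) f)

theorem smooth_redPow_of_local {α : A →+* B} {m : ℕ} {f c : Fin m → B} {D : Fin m → Type u}
    [∀ a, CommRing (D a)] {h : ∀ a, B →+* D a} (hh : ∀ a, PLoc p (h a) (f a))
    (hD : ∀ a, TorsionFree p (D a)) (hc : (p : B) ∣ 1 - ∑ a, c a * f a) (n : ℕ)
    (hs : ∀ a, (redPow p ((h a).comp α) n).Smooth) : (redPow p α n).Smooth := by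
  let π := Ideal.Quotient.mk (Ideal.span {(p : B) ^ n})
  refine RingHom.Smooth.ofLocalizationSpanTarget _ (Set.range fun a => π (f a)) ?_ ?_
  · obtain ⟨d, hd⟩ := exists_partition_pow hc n 1
    rw [Ideal.eq_top_iff_one]
    have : (1 : B ⧸ Ideal.span {(p : B) ^ n}) = ∑ a, π (d a) * π (f a) := by
      simp only [← map_mul, ← map_sum, ← map_one π, pow_one] at hd ⊢
      exact Ideal.Quotient.eq.2 (Ideal.mem_span_singleton.2 hd)
    rw [this]
    exact sum_mem fun a _ => Ideal.mul_mem_left _ _ (Ideal.subset_span ⟨a, rfl⟩)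
  · rintro ⟨_, a, rfl⟩
    let _ : Algebra (B ⧸ Ideal.span {(p : B) ^ n}) (D a ⧸ Ideal.span {(p : D a) ^ n}) :=
      (redPow p (h a) n).toAlgebra
    have := (hh a).isLocalization (hD a) n fun _ => rfl
    let e := IsLocalization.algEquiv (Submonoid.powers (π (f a)))
      (D a ⧸ Ideal.span {(p : D a) ^ n}) (Localization.Away (π (f a)))
    have h1 : (algebraMap _ (Localization.Away (π (f a)))).comp (redPow p α n) =
        (e : _ →+* _).comp (redPow p ((h a).comp α) n) := by
      rw [redPow_comp, ← RingHom.comp_assoc]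
      congr 1
      exact (e.toAlgHom.comp_algebraMap).symm
    change RingHom.Smooth ((algebraMap _ (Localization.Away (π (f a)))).comp (redPow p α n))
    rw [h1]
    exact (hs a).comp (.of_bijective e.bijective)

end Reduction

/-! ### Finite covers and sections modulo `p^n` over an affinoid. -/

section Affinoid

variable {p : ℕ} {Y : RingedSpace.{u, u}} {U : Opens Y}
  (hp : ∀ V : Opens Y, TorsionFree p (Y.presheaf.obj (op V)))
include hp

theorem IsAffinoid.exists_cover (hU : IsAffinoid p Y U) {ι : Type*}
    {f : ι → Y.presheaf.obj (op U)} (hf : ∀ y ∈ U, ∃ j, y ∈ Y.basicOpen (f j)) :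
    ∃ (m : ℕ) (j : Fin m → ι) (c : Fin m → Y.presheaf.obj (op U)),
      (p : Y.presheaf.obj (op U)) ∣ 1 - ∑ a, c a * f (j a) := by
  obtain ⟨m, j, c, hc⟩ := exists_sum_of_span_sup_eq_top (hU.span_eq_top hp hf)
  exact ⟨m, j, c, Ideal.mem_span_singleton.1 hc⟩

theorem IsAffinoid.exists_mem_basicOpen (hU : IsAffinoid p Y U) {m : ℕ}
    {f c : Fin m → Y.presheaf.obj (op U)} (hc : (p : Y.presheaf.obj (op U)) ∣ 1 - ∑ a, c a * f a)
    {y : Y} (hy : y ∈ U) : ∃ a, y ∈ Y.basicOpen (f a) := by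
  obtain ⟨h, hh⟩ := hU.exists_chart hp
  by_contra! H
  have h1 (a : Fin m) : f a ∈ (h ⟨y, hy⟩).1.asIdeal := by
    by_contra h'
    exact H a ((hh (f a) ⟨y, hy⟩).2 h')
  have h2 : ∑ a, c a * f a ∈ (h ⟨y, hy⟩).1.asIdeal :=
    sum_mem fun a _ => Ideal.mul_mem_left _ _ (h1 a)
  have h3 := add_mem (Ideal.mem_of_dvd _ hc (natCast_mem _)) h2
  rw [sub_add_cancel] at h3
  exact (h ⟨y, hy⟩).1.2.ne_top ((Ideal.eq_top_iff_one _).2 h3)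

/-- Local lifts agree modulo `p^n` on overlaps, and `exists_glue_mod_pow` glues such data without
any cohomology. -/
theorem IsAffinoid.toModPow_surjective (hU : IsAffinoid p Y U) (n : ℕ) :
    Function.Surjective ((toModPow p n Y.presheaf).app (op U)) := by
  intro t
  have h (y : U) : ∃ (f : Y.presheaf.obj (op U)) (s : Y.presheaf.obj (op (Y.basicOpen f))),
      y.1 ∈ Y.basicOpen f ∧ (toModPow p n Y.presheaf).app (op (Y.basicOpen f)) s =
        rs _ (Y.basicOpen_le f) t := by
    obtain ⟨V, hV, s, hyV, hs⟩ := exists_local_toModPow t y.1 y.2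
    obtain ⟨f, hyf, hf⟩ := hU.exists_basicOpen_le hp y.2 hyV
    refine ⟨f, rs _ hf s, hyf, ?_⟩
    rw [rs_naturality, hs]
    exact rs_rs _ _ _ _
  choose f s hyf hs using h
  obtain ⟨m, j, c, hc⟩ := hU.exists_cover hp (f := f) fun y hy => ⟨⟨y, hy⟩, hyf _⟩
  have hle (a b : Fin m) : Y.basicOpen (f (j a) * f (j b)) ≤ Y.basicOpen (f (j a)) := by
    rw [RingedSpace.basicOpen_mul]
    exact inf_le_left
  have hle' (a b : Fin m) : Y.basicOpen (f (j a) * f (j b)) ≤ Y.basicOpen (f (j b)) := by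
    rw [RingedSpace.basicOpen_mul]
    exact inf_le_right
  have hcomp {f₁ f₂ : Y.presheaf.obj (op U)} (h : Y.basicOpen f₂ ≤ Y.basicOpen f₁) :
      (rs Y.presheaf h).comp (rs Y.presheaf (Y.basicOpen_le f₁)) =
        rs Y.presheaf (Y.basicOpen_le f₂) := by
    ext x
    exact rs_rs _ _ _ _
  obtain ⟨x, hx⟩ := exists_glue_mod_pow (p := p) (M := n)
    (C := fun a b => Y.presheaf.obj (op (Y.basicOpen (f (j a) * f (j b)))))
    (h := fun a => rs Y.presheaf (Y.basicOpen_le (f (j a))))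
    (l := fun a b => rs Y.presheaf (hle a b)) (r := fun a b => rs Y.presheaf (hle' a b))
    (fun a b => hp _) (fun a => hU.ploc hp (f (j a)))
    (fun a b => by rw [hcomp, hcomp]) (fun a b => by rw [hcomp]; exact hU.ploc hp _)
    hc (fun a => s (j a)) fun a b => by
      rw [← toModPow_eq_iff Y.IsSheaf hp, rs_naturality, rs_naturality, hs, hs, rs_rs, rs_rs]
  refine ⟨x, eq_of_locally_eq (isSheaf_modPow n _) fun y hy => ?_⟩
  obtain ⟨a, ha⟩ := hU.exists_mem_basicOpen hp hc hy
  refine ⟨_, Y.basicOpen_le (f (j a)), ha, ?_⟩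
  rw [← hs, ← rs_naturality]
  exact ((toModPow_eq_iff Y.IsSheaf hp).2 (hx a)).symm

end Affinoid

/-! ### Local lifts of Frobenius on a smooth formal scheme. -/

section FormalScheme

variable {p : ℕ} {Y : FormalScheme.{u} p} {A : Type u} [CommRing A] {a : A →+* Y.sections ⊤}
  {U : Opens Y.toRingedSpace}

/-- The definition provides smooth affinoids near each point; `exists_common` and locality on the
source transfer this to every affinoid. -/
theorem FormalScheme.IsSmoothOver.smooth_quotPow (hY : Y.IsSmoothOver a) (hA : TorsionFree p A)
    (hU : IsAffinoid p Y.toRingedSpace U) (n : ℕ) : (quotPow p (Y.structureMap a U) n).Smooth := by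
  have hp := hY.torsionFree hA
  rw [← smooth_redPow_iff]
  have hcomp {V W : Opens Y.toRingedSpace} (h : V ≤ W) :
      (rs Y.toRingedSpace.presheaf h).comp (Y.structureMap a W) = Y.structureMap a V := by
    ext x
    exact rs_rs _ _ _ _
  have h (y : U) : ∃ f : Y.toRingedSpace.presheaf.obj (op U), y.1 ∈ Y.toRingedSpace.basicOpen f ∧
      (redPow p (Y.structureMap a (Y.toRingedSpace.basicOpen f)) n).Smooth := by
    obtain ⟨U', hyU', hU', hs⟩ := hY y.1
    obtain ⟨f, g, hyf, hfg⟩ := hU.exists_common hp hU' y.2 hyU'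
    refine ⟨f, hyf, ?_⟩
    rw [hfg, ← hcomp (Y.toRingedSpace.basicOpen_le g), redPow_comp]
    exact ((smooth_redPow_iff _ n).2 (hs n)).comp ((hU'.ploc hp g).smooth_redPow (hp _) n)
  choose f hyf hf using h
  obtain ⟨m, j, c, hc⟩ := hU.exists_cover hp (f := f) fun y hy => ⟨⟨y, hy⟩, hyf _⟩
  refine smooth_redPow_of_local (fun b => hU.ploc hp (f (j b))) (fun b => hp _) hc n fun b => ?_
  rw [hcomp]
  exact hf _

variable {φ : Y.modPow 2 ⟶ Y.modPow 2}

/-- Over an affinoid the sections of `𝒪_Y/p^2` are `R/p^2`, so `φ` becomes a homomorphism `R →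
R/p^2` over the Frobenius of `A`, which formal smoothness lifts. -/
theorem FormalScheme.IsSmoothOver.exists_isLocalLift [Fact p.Prime] (hY : Y.IsSmoothOver a)
    (hA : TorsionFree p A) {d : DeltaStructure p A} (hφ : Y.IsCompatible d a φ)
    (hU : IsAffinoid p Y.toRingedSpace U) :
    ∃ φR : Y.sections U →+* Y.sections U, Y.IsLocalLift φ U φR := by
  have hp := hY.torsionFree hA
  have := hU.1
  let R := Y.sections U
  let e₁ : R ⧸ Ideal.span {(p : R) ^ 2} ≃+* (Y.modPow 2).presheaf.obj (op U) :=
    RingEquiv.ofBijective ((quotientToModPow p 2 Y.toRingedSpace.presheaf).app (op U)).hom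
      (quotientToModPow_bijective Y.toRingedSpace.IsSheaf hp 2 U (hU.toModPow_surjective hp 2))
  let e₂ : R ⧸ Ideal.span {(p : R)} ^ 2 ≃+* R ⧸ Ideal.span {(p : R) ^ 2} :=
    Ideal.quotEquivOfEq (Ideal.span_singleton_pow _ _)
  let e := e₂.trans e₁
  have he (s : R) : e (Ideal.Quotient.mk _ s) =
    (toModPow p 2 Y.toRingedSpace.presheaf).app (op U) s := rfl
  let φ₂ : R →+* R ⧸ Ideal.span {(p : R)} ^ 2 := (e.symm : _ →+* _).comp
    ((φ.hom.app (op U)).hom.comp ((toModPow p 2 Y.toRingedSpace.presheaf).app (op U)).hom)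
  obtain ⟨Φ, hΦ⟩ := exists_lift_of_formallySmooth (p := p) (α := Y.structureMap a U)
    (ψ := d.frobHom) (fun n => (hY.smooth_quotPow hA hU n).formallySmooth) two_ne_zero φ₂
    fun x => by
      refine e.injective ((e.apply_symm_apply _).trans ?_)
      rw [he]
      have h1 := congrArg (rs (Y.modPow 2).presheaf (le_top : U ≤ ⊤)) (hφ x)
      rw [← rs_naturality, ← rs_naturality, ← rs_naturality] at h1
      exact h1
  refine ⟨Φ, fun s => ?_⟩
  rw [← he, hΦ]
  exact e.apply_symm_apply _

theorem FormalScheme.IsLocalLift.dvd (hp : ∀ V, TorsionFree p (Y.sections V))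
    (hφ : Y.IsFrobeniusLift φ) {φR : Y.sections U →+* Y.sections U} (h : Y.IsLocalLift φ U φR)
    (x : Y.sections U) : (p : Y.sections U) ∣ φR x - x ^ p := by
  have h1 := congrArg ((reduction p Y.toRingedSpace.presheaf).hom.app (op U)) (h x)
  rw [hφ, reduction_toModPow, reduction_toModPow, ← map_pow] at h1
  simpa using (toModPow_eq_iff Y.toRingedSpace.IsSheaf hp).1 h1

/-- Independently chosen lifts commute with restriction only modulo `p^2`. This is the congruence
assumed in `invMap_mem_envelope₀`. -/
theorem FormalScheme.IsLocalLift.dvd_map (hp : ∀ V, TorsionFree p (Y.sections V))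
    {V : Opens Y.toRingedSpace} (hVU : V ≤ U) {φR : Y.sections U →+* Y.sections U}
    {φV : Y.sections V →+* Y.sections V}
    (h : Y.IsLocalLift φ U φR) (h' : Y.IsLocalLift φ V φV) (x : Y.sections U) :
    (p : Y.sections V) ^ 2 ∣ φV (rs Y.toRingedSpace.presheaf hVU x) -
      rs Y.toRingedSpace.presheaf hVU (φR x) := by
  rw [← toModPow_eq_iff Y.toRingedSpace.IsSheaf hp, h']
  have h1 := rs_naturality _ (toModPow p 2 Y.toRingedSpace.presheaf) hVU
  exact (congrArg (φ.hom.app (op V)) (h1 x)).trans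
    ((rs_naturality (Y.modPow 2).presheaf φ.hom hVU _).trans
      ((congrArg (rs (Y.modPow 2).presheaf hVU) (h x).symm).trans (h1 (φR x)).symm))

end FormalScheme

/-! ### Closed subschemes of affinoids. -/

section ClosedImmersion

variable {p : ℕ} {Y : FormalScheme.{u} p} {X : Scheme.{u}} (i : ClosedImmersion X Y)

/-- The map from the sections of `𝒪_Y` to a stalk of `𝒪_X`. -/
noncomputable def ClosedImmersion.toStalk {U : Opens Y.toRingedSpace} (x : X) (hx : x ∈ i.inter U) :
    Y.sections U →+* X.presheaf.stalk x :=
  (i.hom.stalkMap x).hom.comp (Y.toRingedSpace.presheaf.germ U (i.hom.base x) hx).hom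

theorem ClosedImmersion.toStalk_eq_germ {U : Opens Y.toRingedSpace} (x : X) (hx : x ∈ i.inter U)
    (f : Y.sections U) : i.toStalk x hx f = X.presheaf.germ (i.inter U) x hx (i.app U f) :=
  PresheafedSpace.stalkMap_germ_apply i.hom U x hx f

theorem ClosedImmersion.toStalk_rs {U V : Opens Y.toRingedSpace} (h : V ≤ U) (x : X)
    (hx : x ∈ i.inter V) (f : Y.sections U) :
    i.toStalk x hx (rs Y.toRingedSpace.presheaf h f) =
      i.toStalk (U := U) x (h (show i.hom.base x ∈ V from hx)) f :=
  congrArg (i.hom.stalkMap x) (Y.toRingedSpace.presheaf.germ_res_apply (homOfLE h) _ hx f)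

theorem ClosedImmersion.app_rs {U V : Opens Y.toRingedSpace} (h : V ≤ U) (f : Y.sections U) :
    i.app V (rs Y.toRingedSpace.presheaf h f) =
      rs X.presheaf (show i.inter V ≤ i.inter U from fun _ hx => h hx) (i.app U f) :=
  NatTrans.naturality_apply i.hom.c (homOfLE h).op f

theorem ClosedImmersion.exists_toStalk (x : X) (t : X.presheaf.stalk x) :
    ∃ (W : Opens Y.toRingedSpace) (hx : x ∈ i.inter W) (g : Y.sections W),
      i.toStalk x hx g = t := by
  obtain ⟨t, rfl⟩ := i.stalk_surjective x t
  obtain ⟨W, hW, g, rfl⟩ := TopCat.Presheaf.exists_germ_eq _ t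
  exact ⟨W, hW, g, rfl⟩

theorem ClosedImmersion.IsOver.natCast_eq_zero {i : ClosedImmersion X Y} {A : Type u} [CommRing A]
    {a : A →+* Y.sections ⊤} {s : X ⟶ Spec (CommRingCat.of (A ⧸ Ideal.span {(p : A)}))}
    (hi : i.IsOver a s) (V : X.Opens) : (p : Γ(X, V)) = 0 := by
  have h := hi p
  rw [Ideal.Quotient.eq_zero_iff_mem.2 (Ideal.mem_span_singleton_self _), map_zero, map_zero,
    map_natCast, map_natCast] at h
  have h' := congrArg (rs X.presheaf (le_top : V ≤ ⊤)) h
  exact ((map_natCast (rs X.presheaf _) p).symm.trans h').trans (map_zero _)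

theorem ClosedImmersion.appTop_toSpec (U : Opens Y.toRingedSpace) :
    (Scheme.ΓSpecIso (Y.sections U)).inv ≫ ((i.inter U).toScheme.toSpecΓ ≫
      Spec.map (CommRingCat.ofHom (i.app U) ≫ (i.inter U).topIso.inv)).appTop =
      CommRingCat.ofHom (i.app U) ≫ (i.inter U).topIso.inv := by
  rw [Scheme.Hom.comp_appTop, Scheme.toSpecΓ_appTop]
  exact (Scheme.ΓSpecIso_inv_naturality_assoc _ _).symm.trans (by
    rw [Iso.inv_hom_id, Category.comp_id])

variable (hp : ∀ V, TorsionFree p (Y.sections V)) {U : Opens Y.toRingedSpace}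
include hp

/-- The point is that `f` invertible on `X` at `x` does not vanish at `x` on `Y`. No locality of
stalk maps is assumed, so the chart is used instead. -/
theorem ClosedImmersion.basicOpen_app (hU : IsAffinoid p Y.toRingedSpace U) (f : Y.sections U) :
    X.basicOpen (i.app U f) = i.inter (Y.toRingedSpace.basicOpen f) := by
  ext x
  refine ⟨fun hx => ?_, fun hx => ?_⟩
  · have hxU : x ∈ i.inter U := X.basicOpen_le _ hx
    have hx' : IsUnit (i.toStalk x hxU f) := by
      rw [i.toStalk_eq_germ]
      exact (X.mem_basicOpen _ _ hxU).1 hx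
    obtain ⟨v, hv⟩ := hx'.exists_right_inv
    obtain ⟨W, hxW, g, rfl⟩ := i.exists_toStalk x v
    obtain ⟨f', hxf', hf'⟩ := hU.exists_basicOpen_le hp hxU hxW
    have hD := hU.basicOpen hp f'
    obtain ⟨h, hh⟩ := hD.exists_chart hp
    by_contra hf
    have h1 : rs Y.toRingedSpace.presheaf (Y.toRingedSpace.basicOpen_le f') f ∈
        (h ⟨_, hxf'⟩).1.asIdeal := by
      by_contra h2
      refine hf ?_
      have h3 := (hh _ ⟨_, hxf'⟩).2 h2
      have h4 := Y.toRingedSpace.basicOpen_res (homOfLE (Y.toRingedSpace.basicOpen_le f')).op f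
      exact (h4.le h3).2
    -- Here `g` lifts an inverse of `f` in the stalk of `X`. If `f` vanished at the point, `1 - f g`
    -- would be invertible near it on `Y`, yet it maps to zero in the nonzero stalk of `X`.
    have h2 : 1 - rs Y.toRingedSpace.presheaf (Y.toRingedSpace.basicOpen_le f') f *
        rs Y.toRingedSpace.presheaf hf' g ∉ (h ⟨_, hxf'⟩).1.asIdeal := fun h3 =>
      (h ⟨_, hxf'⟩).1.2.ne_top ((Ideal.eq_top_iff_one _).2 (by
        simpa using add_mem h3 (Ideal.mul_mem_right (rs Y.toRingedSpace.presheaf hf' g) _ h1)))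
    have h3 := (Y.toRingedSpace.mem_basicOpen _ _ hxf').1 ((hh _ ⟨_, hxf'⟩).2 h2)
    have hxD : x ∈ i.inter (Y.toRingedSpace.basicOpen f') := hxf'
    have h4 : IsUnit (i.toStalk x hxD (1 - rs Y.toRingedSpace.presheaf
        (Y.toRingedSpace.basicOpen_le f') f * rs Y.toRingedSpace.presheaf hf' g)) :=
      h3.map (i.hom.stalkMap x).hom
    rw [map_sub, map_mul, i.toStalk_rs, i.toStalk_rs, hv, map_one, sub_self] at h4
    exact not_isUnit_zero h4
  · have hxU : x ∈ i.inter U := Y.toRingedSpace.basicOpen_le f hx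
    have h1 := ((Y.toRingedSpace.mem_basicOpen f _ hxU).1 hx).map (i.hom.stalkMap x).hom
    refine (X.mem_basicOpen _ _ hxU).2 ?_
    rw [← i.toStalk_eq_germ]
    exact h1

variable (hX : ∀ V : X.Opens, (p : Γ(X, V)) = 0)
include hX

omit hp in
theorem ClosedImmersion.app_eq_of_dvd {V : Opens Y.toRingedSpace} {f g : Y.sections V}
    (h : (p : Y.sections V) ∣ f - g) : i.app V f = i.app V g := by
  rw [← sub_eq_zero, ← map_sub]
  have := map_dvd_natCast (i.app V) h
  rwa [hX, zero_dvd_iff] at this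

/-- Sections over a principal open are fractions only modulo `p`, which suffices because `p = 0` on
`X`. -/
theorem ClosedImmersion.exists_fraction (hU : IsAffinoid p Y.toRingedSpace U) (x : X)
    (hx : x ∈ i.inter U)
    (t : X.presheaf.stalk x) : ∃ f r : Y.sections U, IsUnit (i.toStalk x hx f) ∧
      i.toStalk x hx f * t = i.toStalk x hx r := by
  obtain ⟨W, hxW, g, rfl⟩ := i.exists_toStalk x t
  obtain ⟨f, hxf, hf⟩ := hU.exists_basicOpen_le hp hx hxW
  obtain ⟨k, r, hr⟩ := (hU.ploc hp f).surj (rs Y.toRingedSpace.presheaf hf g)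
  refine ⟨f ^ k, r, ?_, ?_⟩
  · rw [map_pow]
    exact (((Y.toRingedSpace.mem_basicOpen f _ hx).1 hxf).map (i.hom.stalkMap x).hom).pow k
  · have hxD : x ∈ i.inter (Y.toRingedSpace.basicOpen f) := hxf
    have h1 := congrArg (X.presheaf.germ (i.inter (Y.toRingedSpace.basicOpen f)) x hxD)
      (i.app_eq_of_dvd hX hr)
    rw [← i.toStalk_eq_germ, ← i.toStalk_eq_germ, map_mul, map_pow, i.toStalk_rs, i.toStalk_rs,
      i.toStalk_rs] at h1
    rw [map_pow]
    exact h1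

/-- On points the morphism `X ∩ U → Spec R` is the chart, a closed embedding, and on stalks it is
surjective because germs are fractions of elements of `R`. -/
theorem ClosedImmersion.isClosedImmersion_toSpec (hU : IsAffinoid p Y.toRingedSpace U) :
    IsClosedImmersion ((i.inter U).toScheme.toSpecΓ ≫
      Spec.map (CommRingCat.ofHom (i.app U) ≫ (i.inter U).topIso.inv)) := by
  let ψ := CommRingCat.ofHom (i.app U) ≫ (i.inter U).topIso.inv
  let j := (i.inter U).toScheme.toSpecΓ ≫ Spec.map ψ
  obtain ⟨h, hh⟩ := hU.exists_chart hp
  have hj (x : i.inter U) : j x = (h ⟨i.hom.base x.1, x.2⟩).1 := by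
    refine PrimeSpectrum.ext (Ideal.ext fun f => not_iff_not.1 ?_)
    rw [← hh, ← show _ ↔ i.hom.base x.1 ∈ Y.toRingedSpace.basicOpen f from
      SetLike.ext_iff.1 (i.basicOpen_app hp hU f) x.1]
    have h1 : j ⁻¹ᵁ (PrimeSpectrum.basicOpen f) = (i.inter U).toScheme.basicOpen (ψ f) :=
      (i.inter U).toScheme.toSpecΓ_preimage_basicOpen (ψ f)
    have h2 := SetLike.ext_iff.1 h1 x
    refine h2.trans ?_
    rw [← (i.inter U).ι_image_basicOpen_topIso_inv (i.app U f)]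
    constructor
    · exact fun h3 => ⟨x, h3, rfl⟩
    · rintro ⟨x', h3, h4⟩
      rwa [← Subtype.ext (a1 := x') (a2 := x) h4]
  refine (isClosedImmersion_iff _).2 ⟨⟨fun x t => ?_⟩, ?_⟩
  · obtain ⟨f, r, hu, hfr⟩ := i.exists_fraction hp hX hU x.1 x.2 ((i.inter U).stalkIso x |>.hom t)
    have key (g : Y.sections U) : ((i.inter U).stalkIso x).hom (j.stalkMap x
        ((Spec (Y.sections U)).presheaf.germ ⊤ (j x) trivial
          ((Scheme.ΓSpecIso (Y.sections U)).inv g))) = i.toStalk x.1 x.2 g := by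
      refine (congrArg _ (Scheme.Hom.germ_stalkMap_apply j ⊤ x trivial _)).trans ?_
      have h1 : j.appTop ((Scheme.ΓSpecIso (Y.sections U)).inv g) = ψ g := by
        exact ConcreteCategory.congr_hom (i.appTop_toSpec U) g
      refine (congrArg (fun z => ((i.inter U).stalkIso x).hom
        ((i.inter U).toScheme.presheaf.germ ⊤ x trivial z)) h1).trans ?_
      refine (ConcreteCategory.congr_hom ((i.inter U).germ_stalkIso_hom (V := ⊤) x trivial)
        (ψ g)).trans ?_
      rw [i.toStalk_eq_germ]
      exact X.presheaf.germ_res_apply (eqToHom (i.inter U).ι_image_top) x.1 _ (i.app U g)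
    have hinj : Function.Injective ((i.inter U).stalkIso x).hom :=
      (ConcreteCategory.bijective_of_isIso _).1
    let G (g : Y.sections U) := (Spec (Y.sections U)).presheaf.germ ⊤ (j x) trivial
      ((Scheme.ΓSpecIso (Y.sections U)).inv g)
    have hG : IsUnit (G f) := by
      -- Stalk maps of morphisms of schemes are local, so `f` is already invertible in the stalk of
      -- `Spec R`.
      refine isUnit_of_map_unit (j.stalkMap x).hom _ ?_
      have h1 := hu.map ((i.inter U).stalkIso x).inv.hom
      rw [← key f] at h1
      have h2 := ((i.inter U).stalkIso x).hom_inv_id_apply (j.stalkMap x (G f))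
      exact h2 ▸ h1
    obtain ⟨w, hw⟩ := hG.exists_right_inv
    refine ⟨G r * w, hinj ?_⟩
    refine hu.mul_left_cancel (Eq.trans ?_ hfr.symm)
    change _ * ((i.inter U).stalkIso x).hom (j.stalkMap x (G r * w)) = _
    rw [map_mul, map_mul, key r, ← key f]
    have h3 := congrArg (fun z => ((i.inter U).stalkIso x).hom (j.stalkMap x z)) hw
    simp only [map_mul, map_one] at h3
    rw [mul_left_comm]
    refine (congrArg (_ * ·) h3).trans (mul_one _)
  · have h1 : Topology.IsClosedEmbedding (fun x : i.inter U => (h ⟨i.hom.base x.1, x.2⟩).1) :=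
      ((PrimeSpectrum.isClosed_zeroLocus _).isClosedEmbedding_subtypeVal.comp
        h.isClosedEmbedding).comp (i.isClosedEmbedding.restrictPreimage (U : Set Y.toRingedSpace))
    exact (funext hj : ⇑j = _) ▸ h1

theorem ClosedImmersion.isAffineOpen_inter (hU : IsAffinoid p Y.toRingedSpace U) :
    IsAffineOpen (i.inter U) ∧ Function.Surjective (i.app U) := by
  have := i.isClosedImmersion_toSpec hp hX hU
  obtain ⟨h1, h2⟩ := IsClosedImmersion.isAffine_surjective_of_isAffine
    ((i.inter U).toScheme.toSpecΓ ≫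
      Spec.map (CommRingCat.ofHom (i.app U) ≫ (i.inter U).topIso.inv))
  refine ⟨h1, fun x => ?_⟩
  obtain ⟨r, hr⟩ := h2 ((i.inter U).topIso.inv x)
  obtain ⟨r, rfl⟩ : ∃ r', (Scheme.ΓSpecIso (Y.sections U)).inv r' = r :=
    ⟨_, (Scheme.ΓSpecIso (Y.sections U)).hom_inv_id_apply r⟩
  have h3 := ConcreteCategory.congr_hom (i.appTop_toSpec U) r
  refine ⟨r, ?_⟩
  have h4 := congrArg (i.inter U).topIso.hom (h3.symm.trans hr)
  rw [Iso.inv_hom_id_apply] at h4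
  exact ((i.inter U).topIso.inv_hom_id_apply _).symm.trans h4

/-- If `x` vanishes on `X`, then `f^k x ≡ r` modulo `p`, where `r` vanishes on the principal open of
the affine scheme `X ∩ U`, so some `f^n r` lies in `I`. As `p ∈ I` and `f` is a unit, `x` lies in
the extended ideal. -/
theorem ClosedImmersion.ideal_basicOpen (hU : IsAffinoid p Y.toRingedSpace U) (f : Y.sections U) :
    (i.ideal U).map (rs Y.toRingedSpace.presheaf (Y.toRingedSpace.basicOpen_le f)) =
      i.ideal (Y.toRingedSpace.basicOpen f) := by
  refine le_antisymm (Ideal.map_le_iff_le_comap.2 fun x hx => ?_) fun x hx => ?_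
  · refine (i.app_rs _ x).trans ?_
    rw [show i.app U x = 0 from hx, map_zero]
  · have hl := hU.ploc hp f
    obtain ⟨k, r, hr⟩ := hl.surj x
    have h1 := i.app_eq_of_dvd hX hr
    rw [map_mul, show i.app _ x = 0 from hx, mul_zero, i.app_rs] at h1
    have hle : X.basicOpen (i.app U f) ≤ i.inter U := X.basicOpen_le _
    have h2 : rs X.presheaf hle (i.app U r) = 0 := by
      have h3 := congrArg (rs X.presheaf (i.basicOpen_app hp hU f).le) h1
      rw [rs_rs, map_zero] at h3
      exact h3.symm
    obtain ⟨n, hn⟩ := exists_pow_mul_eq_zero_of_res_basicOpen_eq_zero_of_isAffineOpen X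
      (i.isAffineOpen_inter hp hX hU).1 _ _ h2
    have h4 : f ^ n * r ∈ i.ideal U := by
      rw [← map_pow, ← map_mul] at hn
      exact hn
    have hpI : (p : Y.sections U) ∈ i.ideal U := (map_natCast (i.app U) p).trans (hX _)
    have hpI' := Ideal.mem_map_of_mem (rs Y.toRingedSpace.presheaf
      (Y.toRingedSpace.basicOpen_le f)) hpI
    rw [map_natCast] at hpI'
    have h5 := Ideal.mem_map_of_mem (rs Y.toRingedSpace.presheaf
      (Y.toRingedSpace.basicOpen_le f)) h4
    have h6 := add_mem (Ideal.mul_mem_left _ (rs Y.toRingedSpace.presheaf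
      (Y.toRingedSpace.basicOpen_le f) f ^ n) (Ideal.mem_of_dvd _ hr hpI')) h5
    rw [map_mul, map_pow, mul_sub, sub_add_cancel, ← mul_assoc, ← pow_add] at h6
    exact (Ideal.unit_mul_mem_iff_mem _ (hl.unit.pow _)).1 h6

end ClosedImmersion

/-! ### Envelopes over affinoids as a sheaf on a basis. -/

section Admissible

variable {p : ℕ} {Y : FormalScheme.{u} p} {X : Scheme.{u}}

/-- The properties of a closed immersion and of a Frobenius lift on which the construction of the
prismatic envelope depends. -/
structure ClosedImmersion.Admissible (i : ClosedImmersion X Y) (φ : Y.modPow 2 ⟶ Y.modPow 2) :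
    Prop where
  torsionFree : ∀ V, TorsionFree p (Y.sections V)
  natCast_eq_zero : ∀ V : X.Opens, (p : Γ(X, V)) = 0
  isFrobeniusLift : Y.IsFrobeniusLift φ
  exists_isLocalLift : ∀ U : Opens Y.toRingedSpace, IsAffinoid p Y.toRingedSpace U →
    ∃ φR : Y.sections U →+* Y.sections U, Y.IsLocalLift φ U φR

namespace ClosedImmersion.Admissible

variable {i : ClosedImmersion X Y} {φ : Y.modPow 2 ⟶ Y.modPow 2} (h : i.Admissible φ)
  {U : Opens Y.toRingedSpace}
include h

/-- Only `X ∩ U` is covered, not `U`; since it is affine and `R` maps onto its ring, this gives a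
partition of unity modulo `I`. -/
theorem exists_cover (hU : IsAffinoid p Y.toRingedSpace U) {ι : Type*} {f : ι → Y.sections U}
    (hf : ∀ x ∈ i.inter U, ∃ j, x ∈ i.inter (Y.toRingedSpace.basicOpen (f j))) :
    ∃ (m : ℕ) (j : Fin m → ι) (c : Fin m → Y.sections U),
      1 - ∑ a, c a * f (j a) ∈ i.ideal U := by
  obtain ⟨hA, hs⟩ := i.isAffineOpen_inter h.torsionFree h.natCast_eq_zero hU
  have h1 : Ideal.span (Set.range fun j => i.app U (f j)) = ⊤ := by
    refine hA.self_le_iSup_basicOpen_iff.1 fun x hx => ?_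
    obtain ⟨j, hj⟩ := hf x hx
    rw [← i.basicOpen_app h.torsionFree hU] at hj
    exact Opens.mem_iSup.2 ⟨⟨_, j, rfl⟩, hj⟩
  obtain ⟨m, j, c, hc⟩ := exists_sum_of_span_sup_eq_top (f := fun j => i.app U (f j)) (J := ⊥)
    (by rwa [sup_bot_eq])
  choose c' hc' using fun a => hs (c a)
  refine ⟨m, j, c', ?_⟩
  change i.app U _ = 0
  simpa [hc'] using hc

theorem exists_mem_inter (hU : IsAffinoid p Y.toRingedSpace U) {m : ℕ} {f c : Fin m → Y.sections U}
    (hc : 1 - ∑ a, c a * f a ∈ i.ideal U) {x : X} (hx : x ∈ i.inter U) :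
    ∃ a, x ∈ i.inter (Y.toRingedSpace.basicOpen (f a)) := by
  have h1 : Ideal.span (Set.range fun a => i.app U (f a)) = ⊤ := by
    rw [Ideal.eq_top_iff_one]
    have h2 : i.app U (1 - ∑ a, c a * f a) = 0 := hc
    rw [map_sub, map_one, map_sum, sub_eq_zero] at h2
    rw [h2]
    refine sum_mem fun a _ => ?_
    rw [map_mul]
    exact Ideal.mul_mem_left _ _ (Ideal.subset_span ⟨a, rfl⟩)
  have h2 := iSup_basicOpen_of_span_eq_top (i.inter U) _ h1
  rw [← h2] at hx
  simp only [Set.mem_range, Opens.mem_iSup] at hx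
  obtain ⟨_, ⟨a, rfl⟩, ha⟩ := hx
  exact ⟨a, by rwa [i.basicOpen_app h.torsionFree hU] at ha⟩

theorem exists_basicOpen_inter_le (hU : IsAffinoid p Y.toRingedSpace U) {V : X.Opens} {x : X}
    (hx : x ∈ i.inter U) (hxV : x ∈ V) : ∃ f : Y.sections U,
      x ∈ i.inter (Y.toRingedSpace.basicOpen f) ∧ i.inter (Y.toRingedSpace.basicOpen f) ≤ V := by
  obtain ⟨O, hO, e⟩ := i.isClosedEmbedding.isInducing.isOpen_iff.1 V.2
  have hx' : i.hom.base x ∈ O := by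
    rw [← Set.mem_preimage, e]
    exact hxV
  obtain ⟨f, hxf, hf⟩ := hU.exists_basicOpen_le h.torsionFree (V := ⟨O, hO⟩) hx hx'
  refine ⟨f, hxf, fun z hz => ?_⟩
  have : z ∈ i.hom.base ⁻¹' O := hf hz
  rw [e] at this
  exact this

theorem exists_affinoid_inter_le {V : X.Opens} {x : X} (hxV : x ∈ V) :
    ∃ U : Opens Y.toRingedSpace, IsAffinoid p Y.toRingedSpace U ∧ x ∈ i.inter U ∧
      i.inter U ≤ V := by
  obtain ⟨U, hxU, hU⟩ := Y.exists_isAffinoid (i.hom.base x)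
  obtain ⟨f, hf, hf'⟩ := h.exists_basicOpen_inter_le hU hxU hxV
  exact ⟨_, hU.basicOpen h.torsionFree f, hf, hf'⟩

/-- The chosen lift of the Frobenius to the sections over an affinoid. -/
noncomputable def lift (hU : IsAffinoid p Y.toRingedSpace U) : Y.sections U →+* Y.sections U :=
  (h.exists_isLocalLift U hU).choose

theorem isLocalLift_lift (hU : IsAffinoid p Y.toRingedSpace U) : Y.IsLocalLift φ U (h.lift hU) :=
  (h.exists_isLocalLift U hU).choose_spec

theorem exists_map [Fact p.Prime] {V : Opens Y.toRingedSpace} (hVU : V ≤ U)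
    {φU : Y.sections U →+* Y.sections U} {φV : Y.sections V →+* Y.sections V}
    (hφU : Y.IsLocalLift φ U φU) (hφV : Y.IsLocalLift φ V φV)
    {S S' : Type u} [CommRing S] [CommRing S'] {θ : Y.sections U →+* S} {θ' : Y.sections V →+* S'}
    (hS : IsEnvelope p φU (i.ideal U) θ) (hS' : IsEnvelope p φV (i.ideal V) θ') :
    ∃ g : S →+* S', ∀ r, g (θ r) = θ' (rs Y.toRingedSpace.presheaf hVU r) :=
  IsEnvelope.exists_map (hφU.dvd h.torsionFree h.isFrobeniusLift)
    (hφV.dvd h.torsionFree h.isFrobeniusLift) (rs Y.toRingedSpace.presheaf hVU)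
    (hφU.dvd_map h.torsionFree hVU hφV) (fun x hx => by
      refine (i.app_rs _ x).trans ?_
      rw [show i.app U x = 0 from hx, map_zero]) hS hS'

theorem ploc [Fact p.Prime] (hU : IsAffinoid p Y.toRingedSpace U) {f : Y.sections U}
    {φU : Y.sections U →+* Y.sections U}
    {φV : Y.sections (Y.toRingedSpace.basicOpen f) →+* Y.sections (Y.toRingedSpace.basicOpen f)}
    (hφU : Y.IsLocalLift φ U φU) (hφV : Y.IsLocalLift φ _ φV)
    {S S' : Type u} [CommRing S] [CommRing S'] {θ : Y.sections U →+* S}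
    {θ' : Y.sections (Y.toRingedSpace.basicOpen f) →+* S'}
    (hS : IsEnvelope p φU (i.ideal U) θ) (hS' : IsEnvelope p φV (i.ideal _) θ') {g : S →+* S'}
    (hg : ∀ r, g (θ r) =
      θ' (rs Y.toRingedSpace.presheaf (Y.toRingedSpace.basicOpen_le f) r)) :
    PLoc p g (θ f) :=
  IsEnvelope.ploc (h.torsionFree _) (hφU.dvd h.torsionFree h.isFrobeniusLift)
    (hφV.dvd h.torsionFree h.isFrobeniusLift) (hU.ploc h.torsionFree f)
    (hφU.dvd_map h.torsionFree _ hφV)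
    (i.ideal_basicOpen h.torsionFree h.natCast_eq_zero hU f) hS hS' hg

end ClosedImmersion.Admissible

/-- The affinoid open subsets of a formal scheme. -/
abbrev FormalScheme.Affinoid (Y : FormalScheme.{u} p) : Type u :=
  {U : Opens Y.toRingedSpace // IsAffinoid p Y.toRingedSpace U}

namespace ClosedImmersion.Admissible

variable {i : ClosedImmersion X Y} {φ : Y.modPow 2 ⟶ Y.modPow 2} (h : i.Admissible φ)

/-- The principal open subset of an affinoid. -/
def basicOpen (U : Y.Affinoid) (f : Y.sections U.1) : Y.Affinoid :=
  ⟨Y.toRingedSpace.basicOpen f, U.2.basicOpen h.torsionFree f⟩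

theorem basicOpen_le (U : Y.Affinoid) (f : Y.sections U.1) : h.basicOpen U f ≤ U :=
  Y.toRingedSpace.basicOpen_le f

theorem basicOpen_mul (U : Y.Affinoid) (f g : Y.sections U.1) :
    (h.basicOpen U (f * g)).1 = (h.basicOpen U f).1 ⊓ (h.basicOpen U g).1 :=
  Y.toRingedSpace.basicOpen_mul f g

theorem basicOpen_mul_le_left (U : Y.Affinoid) (f g : Y.sections U.1) :
    h.basicOpen U (f * g) ≤ h.basicOpen U f :=
  (h.basicOpen_mul U f g).le.trans inf_le_left

theorem basicOpen_mul_le_right (U : Y.Affinoid) (f g : Y.sections U.1) :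
    h.basicOpen U (f * g) ≤ h.basicOpen U g :=
  (h.basicOpen_mul U f g).le.trans inf_le_right

/-- The prismatic envelope of the sections over an affinoid. -/
abbrev Env (U : Y.Affinoid) : Type u := Envelope p (h.lift U.2) (i.ideal U.1)

/-- The map from the sections over an affinoid to their prismatic envelope. -/
noncomputable abbrev envMap (U : Y.Affinoid) : Y.sections U.1 →+* h.Env U :=
  algebraMap (Y.sections U.1) (Envelope p (h.lift U.2) (i.ideal U.1))

theorem isEnvelope_envMap (U : Y.Affinoid) :
    IsEnvelope p (h.lift U.2) (i.ideal U.1) (h.envMap U) := isEnvelope_algebraMap _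

theorem tfComplete_env (U : Y.Affinoid) : TFComplete p (h.Env U) :=
  (h.isEnvelope_envMap U).tfComplete

variable [Fact p.Prime]

/-- The restriction maps between prismatic envelopes. -/
noncomputable def envRes {U V : Y.Affinoid} (hVU : V ≤ U) : h.Env U →+* h.Env V :=
  (h.exists_map hVU (h.isLocalLift_lift U.2) (h.isLocalLift_lift V.2) (h.isEnvelope_envMap U)
    (h.isEnvelope_envMap V)).choose

theorem envRes_envMap {U V : Y.Affinoid} (hVU : V ≤ U) (r : Y.sections U.1) :
    h.envRes hVU (h.envMap U r) = h.envMap V (rs Y.toRingedSpace.presheaf hVU r) :=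
  (h.exists_map hVU (h.isLocalLift_lift U.2) (h.isLocalLift_lift V.2) (h.isEnvelope_envMap U)
    (h.isEnvelope_envMap V)).choose_spec r

theorem envRes_comp {U V W : Y.Affinoid} (hVU : V ≤ U) (hWV : W ≤ V) :
    (h.envRes hWV).comp (h.envRes hVU) = h.envRes (hWV.trans hVU) :=
  (h.isEnvelope_envMap U).hom_ext (h.tfComplete_env W) fun r => by
    simp only [RingHom.comp_apply, envRes_envMap, rs_rs]

theorem envRes_envRes {U V W : Y.Affinoid} (hVU : V ≤ U) (hWV : W ≤ V) (s : h.Env U) :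
    h.envRes hWV (h.envRes hVU s) = h.envRes (hWV.trans hVU) s :=
  congrArg (fun a => a s) (h.envRes_comp hVU hWV)

theorem envRes_self {U : Y.Affinoid} (hU : U ≤ U) (s : h.Env U) : h.envRes hU s = s :=
  congrArg (fun a => a s) ((h.isEnvelope_envMap U).hom_ext (h.tfComplete_env U)
    (f := h.envRes hU) (g := RingHom.id _) fun r => by
      simp only [RingHom.id_apply, envRes_envMap, rs_self])

theorem ploc_envRes (U : Y.Affinoid) (f : Y.sections U.1) :
    PLoc p (h.envRes (h.basicOpen_le U f)) (h.envMap U f) :=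
  h.ploc U.2 (h.isLocalLift_lift U.2) (h.isLocalLift_lift (h.basicOpen U f).2)
    (h.isEnvelope_envMap U) (h.isEnvelope_envMap (h.basicOpen U f)) (h.envRes_envMap _)

omit [Fact p.Prime] in
theorem dvd_of_mem_ideal {U : Y.Affinoid} {m : ℕ} {f c : Fin m → Y.sections U.1}
    (hc : 1 - ∑ a, c a * f a ∈ i.ideal U.1) :
    (p : h.Env U) ∣ 1 - ∑ a, h.envMap U (c a) * h.envMap U (f a) := by
  have := (h.isEnvelope_envMap U).dvd_of_mem hc
  simpa using this

/-- Separatedness: `s - t` is divisible by every `p^n` on a finite principal cover, hence is so in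
the envelope of `U` and vanishes. -/
theorem env_ext {U : Y.Affinoid} {s t : h.Env U} (hst : ∀ x ∈ i.inter U.1,
    ∃ (V : Y.Affinoid) (hV : V ≤ U), x ∈ i.inter V.1 ∧ h.envRes hV s = h.envRes hV t) : s = t := by
  have H (x : i.inter U.1) : ∃ f : Y.sections U.1, x.1 ∈ i.inter (h.basicOpen U f).1 ∧
      h.envRes (h.basicOpen_le U f) s = h.envRes (h.basicOpen_le U f) t := by
    obtain ⟨V, hV, hxV, e⟩ := hst x.1 x.2
    obtain ⟨f, hxf, hf⟩ := U.2.exists_basicOpen_le h.torsionFree (V := V.1) x.2 hxV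
    refine ⟨f, hxf, ?_⟩
    have e' := congrArg (h.envRes (show h.basicOpen U f ≤ V from hf)) e
    rwa [envRes_envRes, envRes_envRes] at e'
  choose f hxf hf using H
  obtain ⟨m, j, c, hc⟩ := h.exists_cover U.2 (f := f) fun x hx => ⟨⟨x, hx⟩, hxf _⟩
  refine (h.tfComplete_env U).eq_of_forall fun n => ?_
  refine pow_dvd_of_local (fun a => (h.tfComplete_env (h.basicOpen U (f (j a)))).tf)
    (fun a => h.ploc_envRes U (f (j a))) (h.dvd_of_mem_ideal hc) fun a => ?_
  rw [map_sub, hf, sub_self]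
  exact dvd_zero _

/-- The data on the downward closed family `D` are glued along finitely many principal opens of `U`
belonging to `D`. -/
theorem exists_env {U : Y.Affinoid} (D : Set Y.Affinoid) (hDU : ∀ V ∈ D, V ≤ U)
    (hD : ∀ V ∈ D, ∀ W ≤ V, W ∈ D) (hcov : ∀ x ∈ i.inter U.1, ∃ V ∈ D, x ∈ i.inter V.1)
    (t : ∀ V ∈ D, h.Env V)
    (ht : ∀ V (hV : V ∈ D) W (hWV : W ≤ V), h.envRes hWV (t V hV) = t W (hD V hV W hWV)) :
    ∃ s : h.Env U, ∀ V (hV : V ∈ D), h.envRes (hDU V hV) s = t V hV := by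
  have H (x : i.inter U.1) : ∃ f : Y.sections U.1, x.1 ∈ i.inter (h.basicOpen U f).1 ∧
      h.basicOpen U f ∈ D := by
    obtain ⟨V, hV, hxV⟩ := hcov x.1 x.2
    obtain ⟨f, hxf, hf⟩ := U.2.exists_basicOpen_le h.torsionFree (V := V.1) x.2 hxV
    exact ⟨f, hxf, hD V hV _ hf⟩
  choose f hxf hf using H
  obtain ⟨m, j, c, hc⟩ := h.exists_cover U.2 (f := f) fun x hx => ⟨⟨x, hx⟩, hxf _⟩
  obtain ⟨s, hs⟩ := exists_glue (p := p) (f := fun a => h.envMap U (f (j a)))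
    (h := fun a => h.envRes (h.basicOpen_le U (f (j a))))
    (l := fun a b => h.envRes (h.basicOpen_mul_le_left U (f (j a)) (f (j b))))
    (r := fun a b => h.envRes (h.basicOpen_mul_le_right U (f (j a)) (f (j b))))
    (h.tfComplete_env U) (fun a => h.tfComplete_env _) (fun a b => (h.tfComplete_env _).tf)
    (fun a => h.ploc_envRes U (f (j a)))
    (fun a b => by rw [envRes_comp, envRes_comp])
    (fun a b => by
      rw [envRes_comp]
      have e := h.ploc_envRes U (f (j a) * f (j b))
      rwa [(h.envMap U).map_mul] at e) (h.dvd_of_mem_ideal hc)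
    (fun a => t _ (hf (j a))) (fun a b => by rw [ht, ht])
  -- An arbitrary `V` in `D` need not be one of the chosen opens, so the values are compared on
  -- principal opens of `V` contained in one of them.
  refine ⟨s, fun V hV => h.env_ext fun x hx => ?_⟩
  obtain ⟨a, ha⟩ := h.exists_mem_inter U.2 hc (hDU V hV hx)
  obtain ⟨g, hxg, hg⟩ := V.2.exists_basicOpen_le h.torsionFree
    (V := (h.basicOpen U (f (j a))).1) hx ha
  have hg' : h.basicOpen V g ≤ h.basicOpen U (f (j a)) := hg
  refine ⟨h.basicOpen V g, h.basicOpen_le V g, hxg, ?_⟩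
  rw [envRes_envRes, ht, ← h.envRes_envRes (h.basicOpen_le U (f (j a))) hg', hs, ht]

end ClosedImmersion.Admissible

end Admissible

/-! ### Extending a sheaf from a basis. -/

section GluingSystem

/-- Rings indexed by open subsets forming a basis of `T`, with the sheaf property with respect to
coverings by smaller members of the basis. -/
structure GluingSystem (T : TopCat.{u}) where
  /-- The index type of the basis. -/
  B : Type u
  [preorder : Preorder B]
  /-- The open subset with a given index. -/
  toOpens : B → Opens T
  mono : ∀ {U V : B}, V ≤ U → toOpens V ≤ toOpens U
  exists_le : ∀ (W : Opens T), ∀ x ∈ W, ∃ U, x ∈ toOpens U ∧ toOpens U ≤ W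
  exists_le_le : ∀ (U V : B) (x : T), x ∈ toOpens U → x ∈ toOpens V →
    ∃ W ≤ V, W ≤ U ∧ x ∈ toOpens W
  /-- The ring with a given index. -/
  E : B → Type u
  [commRing : ∀ U, CommRing (E U)]
  /-- The restriction maps. -/
  res : ∀ {U V : B}, V ≤ U → E U →+* E V
  res_self : ∀ {U : B} (h : U ≤ U) (s : E U), res h s = s
  res_res : ∀ {U V W : B} (h : V ≤ U) (h' : W ≤ V) (s : E U),
    res h' (res h s) = res (h'.trans h) s
  ext : ∀ {U : B} {s t : E U}, (∀ x ∈ toOpens U, ∃ (V : B) (hV : V ≤ U), x ∈ toOpens V ∧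
    res hV s = res hV t) → s = t
  glue : ∀ {U : B} (D : Set B) (hDU : ∀ V ∈ D, V ≤ U) (hD : ∀ V ∈ D, ∀ W ≤ V, W ∈ D)
    (_ : ∀ x ∈ toOpens U, ∃ V ∈ D, x ∈ toOpens V) (t : ∀ V ∈ D, E V)
    (_ : ∀ V (hV : V ∈ D) W (hWV : W ≤ V), res hWV (t V hV) = t W (hD V hV W hWV)),
    ∃ s : E U, ∀ V (hV : V ∈ D), res (hDU V hV) s = t V hV

namespace GluingSystem

attribute [instance] preorder commRing

variable {T : TopCat.{u}} (G : GluingSystem T)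

/-- The compatible families over the members of the basis contained in `W`. -/
def families (W : Opens T) : Subring (∀ U : {U : G.B // G.toOpens U ≤ W}, G.E U.1) where
  carrier := {s | ∀ (U V : {U : G.B // G.toOpens U ≤ W}) (hVU : V.1 ≤ U.1), G.res hVU (s U) = s V}
  mul_mem' hs ht U V hVU := by
    rw [Pi.mul_apply, Pi.mul_apply, map_mul, hs U V hVU, ht U V hVU]
  one_mem' U V hVU := map_one _
  add_mem' hs ht U V hVU := by
    rw [Pi.add_apply, Pi.add_apply, map_add, hs U V hVU, ht U V hVU]
  zero_mem' U V hVU := map_zero _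
  neg_mem' hs U V hVU := by
    rw [Pi.neg_apply, Pi.neg_apply, map_neg, hs U V hVU]

/-- The restriction of compatible families. -/
def restrict {W W' : Opens T} (hW : W' ≤ W) : G.families W →+* G.families W' where
  toFun s := ⟨fun U => s.1 ⟨U.1, U.2.trans hW⟩,
    fun U V hVU => s.2 ⟨U.1, U.2.trans hW⟩ ⟨V.1, V.2.trans hW⟩ hVU⟩
  map_one' := rfl
  map_mul' _ _ := rfl
  map_zero' := rfl
  map_add' _ _ := rfl

/-- The presheaf of compatible families. -/
def presheaf : TopCat.Presheaf CommRingCat.{u} T where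
  obj W := CommRingCat.of (G.families W.unop)
  map f := CommRingCat.ofHom (G.restrict f.unop.le)

variable {G}

/-- A member `U` of the basis need not be comparable with members of `D`, so values are compared on
members below both. -/
theorem families_ext {W : Opens T} {s t : G.families W} (D : Set G.B)
    (hD : ∀ V ∈ D, ∀ V' ≤ V, V' ∈ D) (hcov : ∀ x ∈ W, ∃ V ∈ D, x ∈ G.toOpens V)
    (hst : ∀ V ∈ D, ∀ hV : G.toOpens V ≤ W, s.1 ⟨V, hV⟩ = t.1 ⟨V, hV⟩) : s = t := by
  refine Subtype.ext (funext fun U => G.ext fun x hx => ?_)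
  obtain ⟨V, hV, hxV⟩ := hcov x (U.2 hx)
  obtain ⟨V', hV', hle, hxV'⟩ := G.exists_le_le U.1 V x hx hxV
  have hW : G.toOpens V' ≤ W := (G.mono hle).trans U.2
  refine ⟨V', hle, hxV', ?_⟩
  rw [s.2 U ⟨V', hW⟩ hle, t.2 U ⟨V', hW⟩ hle]
  exact hst V' (hD V hV V' hV') hW

theorem exists_family {W : Opens T} (D : Set G.B)
    (hD : ∀ V ∈ D, ∀ V' ≤ V, V' ∈ D) (hcov : ∀ x ∈ W, ∃ V ∈ D, x ∈ G.toOpens V)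
    (t : ∀ V ∈ D, G.E V)
    (ht : ∀ V (hV : V ∈ D) V' (hV' : V' ≤ V), G.res hV' (t V hV) = t V' (hD V hV V' hV')) :
    ∃ s : G.families W, ∀ V (hVD : V ∈ D) (hV : G.toOpens V ≤ W), s.1 ⟨V, hV⟩ = t V hVD := by
  have hcov' (U : {U : G.B // G.toOpens U ≤ W}) :
      ∀ x ∈ G.toOpens U.1, ∃ V ∈ {V | V ∈ D ∧ V ≤ U.1}, x ∈ G.toOpens V := fun x hx => by
    obtain ⟨V, hV, hxV⟩ := hcov x (U.2 hx)
    obtain ⟨V', hV', hle, hxV'⟩ := G.exists_le_le U.1 V x hx hxV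
    exact ⟨V', ⟨hD V hV V' hV', hle⟩, hxV'⟩
  have H (U : {U : G.B // G.toOpens U ≤ W}) : ∃ s : G.E U.1,
      ∀ V (hV : V ∈ D ∧ V ≤ U.1), G.res hV.2 s = t V hV.1 :=
    G.glue {V | V ∈ D ∧ V ≤ U.1} (fun V hV => hV.2)
      (fun V hV V' hV' => ⟨hD V hV.1 V' hV', hV'.trans hV.2⟩) (hcov' U) (fun V hV => t V hV.1)
      fun V hV V' hV' => ht V hV.1 V' hV'
  choose s hs using H
  refine ⟨⟨s, fun U V hVU => G.ext fun x hx => ?_⟩, fun V hVD hV => ?_⟩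
  · obtain ⟨V', hV', hxV'⟩ := hcov' V x hx
    refine ⟨V', hV'.2, hxV', ?_⟩
    rw [G.res_res, hs U V' ⟨hV'.1, hV'.2.trans hVU⟩, hs V V' hV']
  · have := hs ⟨V, hV⟩ V ⟨hVD, le_rfl⟩
    rwa [G.res_self] at this

variable (G) in
theorem isSheaf_presheaf : G.presheaf.IsSheaf := by
  rw [TopCat.Presheaf.isSheaf_iff_isSheafUniqueGluing]
  intro ι W sf hsf
  let D : Set G.B := {V | ∃ a, G.toOpens V ≤ W a}
  have hD : ∀ V ∈ D, ∀ V' ≤ V, V' ∈ D := fun V ⟨a, ha⟩ V' hV' => ⟨a, (G.mono hV').trans ha⟩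
  have hcov : ∀ x ∈ iSup W, ∃ V ∈ D, x ∈ G.toOpens V := fun x hx => by
    obtain ⟨a, ha⟩ := Opens.mem_iSup.1 hx
    obtain ⟨U, hxU, hUa⟩ := G.exists_le _ x ha
    exact ⟨U, ⟨a, hUa⟩, hxU⟩
  let sf' (a : ι) : G.families (W a) := sf a
  have hsf' (V : G.B) (a b : ι) (ha : G.toOpens V ≤ W a) (hb : G.toOpens V ≤ W b) :
      (sf' a).1 ⟨V, ha⟩ = (sf' b).1 ⟨V, hb⟩ :=
    congrArg (fun s : G.families (W a ⊓ W b) => s.1 ⟨V, le_inf ha hb⟩) (hsf a b)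
  -- Each `V` in `D` receives the value of an arbitrary `sf a` with `V` inside `W a`; `hsf'` makes
  -- the choice of `a` irrelevant.
  obtain ⟨s, hs⟩ := exists_family D hD hcov
    (fun V hV => (sf' hV.choose).1 ⟨V, hV.choose_spec⟩) fun V hV V' hV' => by
      rw [(sf' hV.choose).2 ⟨V, hV.choose_spec⟩ ⟨V', (G.mono hV').trans hV.choose_spec⟩ hV']
      exact hsf' _ _ _ _ _
  refine ⟨s, fun a => Subtype.ext (funext fun U => ?_), fun t ht => ?_⟩
  · have h1 : U.1 ∈ D := ⟨a, U.2⟩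
    exact (hs U.1 h1 (U.2.trans (le_iSup W a))).trans (hsf' U.1 h1.choose a h1.choose_spec U.2)
  · refine families_ext (G := G) (W := iSup W) (s := t) (t := s) D hD hcov ?_
    intro V ⟨a, ha⟩ hV
    rw [hs V ⟨a, ha⟩ hV, hsf' V _ a _ ha]
    exact congrArg (fun s : G.families (W a) => s.1 ⟨V, ha⟩) (ht a)

variable (G) in
/-- The sheaf of compatible families. -/
def sheaf : TopCat.Sheaf CommRingCat.{u} T := ⟨G.presheaf, G.isSheaf_presheaf⟩

/-- A homomorphism to the compatible families from its values on a covering. -/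
theorem exists_hom {W : Opens T} (D : Set G.B) (hD : ∀ V ∈ D, ∀ V' ≤ V, V' ∈ D)
    (hcov : ∀ x ∈ W, ∃ V ∈ D, x ∈ G.toOpens V) {R : Type u} [CommRing R] (f : ∀ V ∈ D, R →+* G.E V)
    (hf : ∀ V (hV : V ∈ D) V' (hV' : V' ≤ V) r, G.res hV' (f V hV r) = f V' (hD V hV V' hV') r) :
    ∃ F : R →+* G.families W, ∀ r V (hVD : V ∈ D) (hV : G.toOpens V ≤ W),
      (F r).1 ⟨V, hV⟩ = f V hVD r := by
  choose F hF using fun r => exists_family D hD hcov (fun V hV => f V hV r)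
    fun V hV V' hV' => hf V hV V' hV' r
  exact ⟨{
    toFun := F
    map_one' := families_ext D hD hcov fun V hV hVW => by
      rw [hF _ V hV hVW, map_one]
      rfl
    map_mul' r r' := families_ext D hD hcov fun V hV hVW => by
      rw [hF _ V hV hVW, map_mul, ← hF r V hV hVW, ← hF r' V hV hVW]
      rfl
    map_zero' := families_ext D hD hcov fun V hV hVW => by
      rw [hF _ V hV hVW, map_zero]
      rfl
    map_add' r r' := families_ext D hD hcov fun V hV hVW => by
      rw [hF _ V hV hVW, map_add, ← hF r V hV hVW, ← hF r' V hV hVW]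
      rfl }, hF⟩

variable (G) in
theorem exists_equiv (U : G.B) {W : Opens T} (hW : G.toOpens U = W) :
    ∃ e : G.E U ≃+* G.families W, ∀ s, (e s).1 ⟨U, hW.le⟩ = s := by
  subst hW
  have hD : ∀ V ∈ {V : G.B | V ≤ U}, ∀ V' ≤ V, V' ∈ {V : G.B | V ≤ U} :=
    fun V hV V' hV' => le_trans hV' hV
  have hcov : ∀ x ∈ G.toOpens U, ∃ V ∈ {V : G.B | V ≤ U}, x ∈ G.toOpens V :=
    fun x hx => ⟨U, le_rfl, hx⟩
  let e := RingEquiv.ofBijective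
    ((Pi.evalRingHom (fun V : {V : G.B // G.toOpens V ≤ G.toOpens U} => G.E V.1)
      ⟨U, le_rfl⟩).comp (G.families (G.toOpens U)).subtype) ⟨fun s t hst => ?_, fun e => ?_⟩
  · exact ⟨e.symm, fun s => e.apply_symm_apply s⟩
  · refine families_ext {V : G.B | V ≤ U} hD hcov fun V hV hVU => ?_
    rw [← s.2 ⟨U, le_rfl⟩ ⟨V, hVU⟩ hV, ← t.2 ⟨U, le_rfl⟩ ⟨V, hVU⟩ hV]
    exact congrArg _ hst
  · obtain ⟨s, hs⟩ := exists_family (W := G.toOpens U) {V : G.B | V ≤ U} hD hcov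
      (fun V hV => G.res hV e) fun V hV V' hV' => G.res_res _ _ _
    exact ⟨s, (hs U le_rfl le_rfl).trans (G.res_self _ _)⟩

variable (G) in
theorem exists_structureMap {S : TopCat.{u}} (f : T ⟶ S) (O : TopCat.Presheaf CommRingCat.{u} S)
    (base : G.B → Opens S) (hbase : ∀ {U V : G.B}, V ≤ U → base V ≤ base U)
    (hle : ∀ {U V : G.B}, base V ≤ base U → V ≤ U)
    (hπ : ∀ V, G.toOpens V = (Opens.map f).obj (base V))
    (hcov : ∀ (U : Opens S), ∀ x ∈ (Opens.map f).obj U, ∃ V, base V ≤ U ∧ x ∈ G.toOpens V)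
    (α : ∀ V, O.obj (op (base V)) →+* G.E V)
    (hα : ∀ U V (hVU : V ≤ U) r, G.res hVU (α U r) = α V (rs O (hbase hVU) r)) :
    ∃ θ : O ⟶ (TopCat.Presheaf.pushforward CommRingCat.{u} f).obj G.sheaf.presheaf,
      ∀ V, ∃ e : G.E V ≃+* G.sheaf.presheaf.obj (op ((Opens.map f).obj (base V))),
        ∀ r, e (α V r) = θ.app (op (base V)) r := by
  have hD (U : Opens S) : ∀ V ∈ {V : G.B | base V ≤ U}, ∀ V' ≤ V, V' ∈ {V : G.B | base V ≤ U} :=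
    fun V hV V' hV' => le_trans (hbase hV') hV
  have H (U : Opens S) := exists_hom {V : G.B | base V ≤ U} (hD U) (hcov U)
    (fun V hV => (α V).comp (rs O hV)) fun V hV V' hV' r =>
      (hα V V' hV' _).trans (congrArg (α V') (rs_rs O _ _ r))
  choose F hF using H
  refine ⟨{
    app := fun U => CommRingCat.ofHom (F U.unop)
    naturality := fun U U' g => ?_ }, fun V => ?_⟩
  · ext r
    refine families_ext (G := G) (W := (Opens.map f).obj U'.unop) _ (hD U'.unop) (hcov U'.unop)
      fun V hV hVU => ?_
    refine (hF U'.unop (O.map g r) V hV hVU).trans ?_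
    refine (congrArg (α V) (rs_rs O g.unop.le hV r)).trans ?_
    exact (hF U.unop r V (le_trans hV g.unop.le) _).symm
  · obtain ⟨e, he⟩ := G.exists_equiv V (hπ V)
    have key {V' : G.B} (h1 : V' ≤ V) (hVU : G.toOpens V' ≤ (Opens.map f).obj (base V))
        (x : G.E V) : (e x).1 ⟨V', hVU⟩ = G.res h1 x :=
      ((e x).2 ⟨V, (hπ V).le⟩ ⟨V', hVU⟩ h1).symm.trans (congrArg _ (he x))
    refine ⟨e, fun r => ?_⟩
    refine families_ext (G := G) (W := (Opens.map f).obj (base V)) _ (hD (base V)) (hcov (base V))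
      fun V' hV' hVU => ?_
    exact (key (hle hV') hVU _).trans ((hα V V' (hle hV') r).trans
      (hF (base V) r V' hV' hVU).symm)

end GluingSystem

end GluingSystem

/-! ### Existence of the sheaf and of its structure map. -/

section Construction

variable {p : ℕ} [Fact p.Prime] {Y : FormalScheme.{u} p} {X : Scheme.{u}}
  {i : ClosedImmersion X Y} {φ : Y.modPow 2 ⟶ Y.modPow 2}

namespace ClosedImmersion.Admissible

variable (h : i.Admissible φ)

/-- The prismatic envelopes of the affinoids. -/
noncomputable def system : GluingSystem X.carrier where
  B := Y.Affinoid
  toOpens U := i.inter U.1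
  mono {U V} hVU := fun z hz => (show V.1 ≤ U.1 from hVU) hz
  exists_le W x hx := by
    obtain ⟨U, hU, hxU, hUW⟩ := h.exists_affinoid_inter_le hx
    exact ⟨⟨U, hU⟩, hxU, hUW⟩
  exists_le_le U V x hxU hxV := by
    obtain ⟨f, hxf, hf⟩ := U.2.exists_basicOpen_le h.torsionFree (V := V.1) hxU hxV
    exact ⟨h.basicOpen U f, hf, h.basicOpen_le U f, hxf⟩
  E := h.Env
  res := h.envRes
  res_self := h.envRes_self
  res_res := h.envRes_envRes
  ext := h.env_ext
  glue := h.exists_env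

omit [Fact p.Prime] in
include h in
theorem exists_affinoid_le (U : Opens Y.toRingedSpace) (x : X) (hx : x ∈ i.inter U) :
    ∃ V ∈ {V : Y.Affinoid | V.1 ≤ U}, x ∈ i.inter V.1 := by
  obtain ⟨U', hxU', hU'⟩ := Y.exists_isAffinoid (i.hom.base x)
  obtain ⟨f, hxf, hf⟩ := hU'.exists_basicOpen_le h.torsionFree (V := U) hxU' hx
  exact ⟨⟨_, hU'.basicOpen h.torsionFree f⟩, hf, hxf⟩

include h in
theorem exists_computesEnvelopes : ∃ (P : TopCat.Sheaf CommRingCat.{u} X.carrier)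
    (θ : Y.toRingedSpace.presheaf ⟶
      (TopCat.Presheaf.pushforward CommRingCat.{u} i.hom.base).obj P.presheaf),
    i.ComputesEnvelopes φ P θ := by
  obtain ⟨θ, hθ⟩ := h.system.exists_structureMap i.hom.base Y.toRingedSpace.presheaf
    (fun U : Y.Affinoid => U.1) id id (fun _ => rfl)
    (fun U x hx => by
      obtain ⟨V, hV, hxV⟩ := h.exists_affinoid_le U x hx
      exact ⟨V, hV, hxV⟩)
    h.envMap (fun U V hVU => h.envRes_envMap hVU)
  refine ⟨_, θ, fun U hU φR hφR => ?_⟩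
  obtain ⟨e, he⟩ := hθ (⟨U, hU⟩ : Y.Affinoid)
  have h1 : IsEnvelope p (h.lift hU) (i.ideal U) (θ.app (op U)).hom := ⟨e, he⟩
  -- The sheaf uses one chosen lift per affinoid. Another lift agrees with it modulo `p^2` and has
  -- the same envelope.
  exact h1.congr ((h.isLocalLift_lift hU).dvd h.torsionFree h.isFrobeniusLift)
    (hφR.dvd h.torsionFree h.isFrobeniusLift) fun x => by
      simpa using (h.isLocalLift_lift hU).dvd_map h.torsionFree le_rfl hφR x

end ClosedImmersion.Admissible

end Construction

/-! ### Morphisms of sheaves determined on a basis. -/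

section Basis

variable {T : TopCat.{u}} {F G : TopCat.Presheaf CommRingCat.{u} T} {B : Type*} {π : B → Opens T}

theorem hom_ext_of_basis (hG : G.IsSheaf) (hπ : ∀ (W : Opens T), ∀ x ∈ W, ∃ b, x ∈ π b ∧ π b ≤ W)
    {α β : F ⟶ G} (h : ∀ b s, α.app (op (π b)) s = β.app (op (π b)) s) : α = β := by
  ext W s
  refine eq_of_locally_eq hG fun x hx => ?_
  obtain ⟨b, hxb, hb⟩ := hπ W x hx
  exact ⟨π b, hb, hxb, (rs_naturality F α hb s).symm.trans ((h b _).trans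
    (rs_naturality F β hb s))⟩

theorem exists_hom_of_basis (hG : G.IsSheaf)
    (hπ : ∀ (W : Opens T), ∀ x ∈ W, ∃ b, x ∈ π b ∧ π b ≤ W)
    (e : ∀ b, F.obj (op (π b)) →+* G.obj (op (π b)))
    (he : ∀ b b' x, x ∈ π b → x ∈ π b' → ∃ (c : B) (h : π c ≤ π b) (h' : π c ≤ π b'), x ∈ π c ∧
      (∀ s, rs G h (e b s) = e c (rs F h s)) ∧ ∀ s, rs G h' (e b' s) = e c (rs F h' s)) :
    ∃ α : F ⟶ G, ∀ b s, α.app (op (π b)) s = e b s := by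
  have H (W : Opens T) (s : F.obj (op W)) : ∃ t : G.obj (op W), ∀ b (hb : π b ≤ W),
      rs G hb t = e b (rs F hb s) := by
    obtain ⟨t, ht⟩ := exists_section hG (ι := {b // π b ≤ W}) (fun b => π b.1) W (fun b => b.2)
      (fun x hx => by
        obtain ⟨b, hxb, hb⟩ := hπ W x hx
        exact ⟨⟨b, hb⟩, hxb⟩) (fun b => e b.1 (rs F b.2 s)) fun b b' x hx hx' => by
        obtain ⟨c, h, h', hxc, hc, hc'⟩ := he b.1 b'.1 x hx hx'
        refine ⟨π c, h, h', hxc, ?_⟩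
        rw [hc, hc', rs_rs, rs_rs]
    exact ⟨t, fun b hb => ht ⟨b, hb⟩⟩
  choose a ha using H
  have ext {W : Opens T} {t t' : G.obj (op W)}
      (h : ∀ b (hb : π b ≤ W), rs G hb t = rs G hb t') : t = t' :=
    eq_of_locally_eq hG fun x hx => by
      obtain ⟨b, hxb, hb⟩ := hπ W x hx
      exact ⟨π b, hb, hxb, h b hb⟩
  refine ⟨{
    app W := CommRingCat.ofHom
      { toFun := a W.unop
        map_one' := ext fun b hb => by
          rw [ha, map_one, map_one, map_one]
        map_mul' s s' := ext fun b hb => by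
          rw [ha, map_mul, map_mul, map_mul, ha, ha]
        map_zero' := ext fun b hb => by
          rw [ha, map_zero, map_zero, map_zero]
        map_add' s s' := ext fun b hb => by
          rw [ha, map_add, map_add, map_add, ha, ha] }
    naturality W W' g := ?_ }, fun b s => ?_⟩
  · ext s
    refine ext (W := W'.unop) fun b hb => ?_
    refine (ha W'.unop _ b hb).trans ?_
    refine (congrArg (e b) (rs_rs F g.unop.le hb s)).trans ?_
    exact (ha W.unop s b (hb.trans g.unop.le)).symm.trans (rs_rs G g.unop.le hb _).symm
  · have := ha (π b) s b le_rfl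
    rw [rs_self, rs_self] at this
    exact this

end Basis

/-! ### Uniqueness, torsion-freeness and completeness of the sheaf. -/

section ComputesEnvelopes

variable {p : ℕ} {Y : FormalScheme.{u} p} {X : Scheme.{u}}
  {i : ClosedImmersion X Y} {φ : Y.modPow 2 ⟶ Y.modPow 2}
  {P P' : TopCat.Sheaf CommRingCat.{u} X.carrier}

namespace ClosedImmersion

/-- The map on sections over `U` given by `θ : 𝒪_Y → i_* P`. -/
def sectionMap (θ : Y.toRingedSpace.presheaf ⟶
    (TopCat.Presheaf.pushforward CommRingCat.{u} i.hom.base).obj P.presheaf)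
    (U : Opens Y.toRingedSpace) : Y.sections U →+* P.presheaf.obj (op (i.inter U)) :=
  (θ.app (op U)).hom

variable {θ : Y.toRingedSpace.presheaf ⟶
    (TopCat.Presheaf.pushforward CommRingCat.{u} i.hom.base).obj P.presheaf}
  {θ' : Y.toRingedSpace.presheaf ⟶
    (TopCat.Presheaf.pushforward CommRingCat.{u} i.hom.base).obj P'.presheaf}

theorem inter_mono (i : ClosedImmersion X Y) {U V : Opens Y.toRingedSpace} (h : V ≤ U) :
    i.inter V ≤ i.inter U :=
  fun _ hx => h hx

theorem rs_sectionMap {U V : Opens Y.toRingedSpace} (h : V ≤ U) (r : Y.sections U) :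
    rs P.presheaf (i.inter_mono h) (i.sectionMap θ U r) =
      i.sectionMap θ V (rs Y.toRingedSpace.presheaf h r) :=
  (rs_naturality Y.toRingedSpace.presheaf θ h r).symm

namespace Admissible

variable (h : i.Admissible φ)
include h

theorem exists_affinoid_mem (W : Opens X) (x : X) (hx : x ∈ W) :
    ∃ U : Y.Affinoid, x ∈ i.inter U.1 ∧ i.inter U.1 ≤ W := by
  obtain ⟨U, hU, hxU, hUW⟩ := h.exists_affinoid_inter_le hx
  exact ⟨⟨U, hU⟩, hxU, hUW⟩

theorem exists_affinoid_le_le {U V : Y.Affinoid} {x : X} (hU : x ∈ i.inter U.1)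
    (hV : x ∈ i.inter V.1) : ∃ W : Y.Affinoid, W ≤ U ∧ W ≤ V ∧ x ∈ i.inter W.1 := by
  obtain ⟨f, hxf, hf⟩ := U.2.exists_basicOpen_le h.torsionFree (V := V.1) hU hV
  exact ⟨h.basicOpen U f, h.basicOpen_le U f, hf, hxf⟩

end Admissible

namespace ComputesEnvelopes

variable (hP : i.ComputesEnvelopes φ P θ) (h : i.Admissible φ) (hP' : i.ComputesEnvelopes φ P' θ')
include hP h

theorem isEnvelope (U : Y.Affinoid) :
    IsEnvelope p (h.lift U.2) (i.ideal U.1) (i.sectionMap θ U.1) :=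
  hP U.1 U.2 _ (h.isLocalLift_lift U.2)

theorem tfComplete_inter (U : Y.Affinoid) : TFComplete p (P.presheaf.obj (op (i.inter U.1))) :=
  (hP.isEnvelope h U).tfComplete

theorem torsionFree (V : Opens X) : TorsionFree p (P.presheaf.obj (op V)) :=
  torsionFree_of_locally P.2 fun x hx => by
    obtain ⟨U, hxU, hU⟩ := h.exists_affinoid_mem V x hx
    exact ⟨_, hU, hxU, (hP.tfComplete_inter h U).tf⟩

theorem tfComplete (V : Opens X) : TFComplete p (P.presheaf.obj (op V)) :=
  tfComplete_of_locally P.2 (fun W _ x hx => by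
    obtain ⟨U, hxU, hU⟩ := h.exists_affinoid_mem W x hx
    exact ⟨_, hU, hxU, hP.tfComplete_inter h U⟩) (hP.torsionFree h)

theorem dvd_of_mem {U : Y.Affinoid} {r : Y.sections U.1} (hr : r ∈ i.ideal U.1) :
    (p : P.presheaf.obj (op (i.inter U.1))) ∣ i.sectionMap θ U.1 r :=
  (hP.isEnvelope h U).dvd_of_mem hr

theorem hom_ext {U : Y.Affinoid} {S : Type u} [CommRing S] (hS : TFComplete p S)
    {f g : P.presheaf.obj (op (i.inter U.1)) →+* S}
    (hfg : ∀ r, f (i.sectionMap θ U.1 r) = g (i.sectionMap θ U.1 r)) : f = g :=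
  (hP.isEnvelope h U).hom_ext hS hfg

variable [Fact p.Prime]

theorem ploc (U : Y.Affinoid) (f : Y.sections U.1) :
    PLoc p (rs P.presheaf (i.inter_mono (h.basicOpen_le U f))) (i.sectionMap θ U.1 f) :=
  h.ploc U.2 (h.isLocalLift_lift U.2) (h.isLocalLift_lift (h.basicOpen U f).2)
    (hP.isEnvelope h U) (hP.isEnvelope h (h.basicOpen U f)) fun r =>
      rs_sectionMap (h.basicOpen_le U f) r

include hP'

theorem exists_ringHom (U : Y.Affinoid) :
    ∃ e : P.presheaf.obj (op (i.inter U.1)) →+* P'.presheaf.obj (op (i.inter U.1)),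
      ∀ r, e (i.sectionMap θ U.1 r) = i.sectionMap θ' U.1 r := by
  obtain ⟨e, he⟩ := h.exists_map le_rfl (h.isLocalLift_lift U.2) (h.isLocalLift_lift U.2)
    (hP.isEnvelope h U) (hP'.isEnvelope h U)
  exact ⟨e, fun r => (he r).trans (congrArg _ (rs_self _ _ r))⟩

theorem exists_hom : ∃ α : P.presheaf ⟶ P'.presheaf, ∀ (U : Y.Affinoid) r,
    α.app (op (i.inter U.1)) (i.sectionMap θ U.1 r) = i.sectionMap θ' U.1 r := by
  choose e he using hP.exists_ringHom h hP'
  have H {U V : Y.Affinoid} (hVU : V ≤ U) (s : P.presheaf.obj (op (i.inter U.1))) :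
      rs P'.presheaf (i.inter_mono hVU) (e U s) = e V (rs P.presheaf (i.inter_mono hVU) s) := by
    refine congrArg (fun a => a s) (hP.hom_ext h (hP'.tfComplete h _)
      (f := (rs P'.presheaf (i.inter_mono hVU)).comp (e U))
      (g := (e V).comp (rs P.presheaf (i.inter_mono hVU))) fun r => ?_)
    refine (congrArg _ (he U r)).trans ((rs_sectionMap hVU r).trans ?_)
    exact (he V _).symm.trans (congrArg (e V) (rs_sectionMap hVU r).symm)
  obtain ⟨α, hα⟩ := exists_hom_of_basis (F := P.presheaf) (π := fun U : Y.Affinoid => i.inter U.1)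
    P'.2 h.exists_affinoid_mem e fun U V x hxU hxV => by
      obtain ⟨W, hWU, hWV, hxW⟩ := h.exists_affinoid_le_le hxU hxV
      exact ⟨W, i.inter_mono hWU, i.inter_mono hWV, hxW, H hWU, H hWV⟩
  exact ⟨α, fun U r => (hα U _).trans (he U r)⟩

omit [Fact p.Prime] in
theorem hom_eq {α β : P.presheaf ⟶ P'.presheaf} (hαβ : ∀ (U : Y.Affinoid) r,
    α.app (op (i.inter U.1)) (i.sectionMap θ U.1 r) =
      β.app (op (i.inter U.1)) (i.sectionMap θ U.1 r)) : α = β :=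
  hom_ext_of_basis (π := fun U : Y.Affinoid => i.inter U.1) P'.2 h.exists_affinoid_mem fun U s =>
    congrArg (fun a => a s) (hP.hom_ext h (hP'.tfComplete h _)
      (f := (α.app (op (i.inter U.1))).hom) (g := (β.app (op (i.inter U.1))).hom) (hαβ U))

/-- By `IsEnvelope.hom_ext`, maps compatible with `θ` and `θ'` are unique on each `X ∩ U`; so the
two comparison maps are mutually inverse. -/
theorem existsUnique_iso : ∃! e : P ≅ P', ∀ (U : Opens Y.toRingedSpace) (r : Y.sections U),
    e.hom.hom.app (op (i.inter U)) (θ.app (op U) r) = θ'.app (op U) r := by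
  obtain ⟨α, hα⟩ := hP.exists_hom h hP'
  obtain ⟨β, hβ⟩ := hP'.exists_hom h hP
  refine ⟨⟨⟨α⟩, ⟨β⟩, ?_, ?_⟩, fun U r => ?_, fun e he => ?_⟩
  · refine Sheaf.hom_ext ?_
    exact hP.hom_eq h hP (α := α ≫ β) (β := 𝟙 _) fun U r =>
      (congrArg (β.app (op (i.inter U.1))) (hα U r)).trans (hβ U r)
  · refine Sheaf.hom_ext ?_
    exact hP'.hom_eq h hP' (α := β ≫ α) (β := 𝟙 _) fun U r =>
      (congrArg (α.app (op (i.inter U.1))) (hβ U r)).trans (hα U r)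
  · refine eq_of_locally_eq (U := i.inter U) P'.2 fun x hx => ?_
    obtain ⟨V, hV, hxV⟩ := h.exists_affinoid_le U x hx
    refine ⟨i.inter V.1, i.inter_mono hV, hxV, ?_⟩
    refine (rs_naturality P.presheaf α (i.inter_mono hV) (i.sectionMap θ U r)).symm.trans ?_
    refine (congrArg _ (rs_sectionMap hV r)).trans ?_
    exact (hα V _).trans (rs_sectionMap hV r).symm
  · refine Iso.ext (Sheaf.hom_ext ?_)
    exact hP.hom_eq h hP' fun U r => (he U.1 r).trans (hα U r).symm

end ComputesEnvelopes

end ClosedImmersion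

end ComputesEnvelopes

/-! ### Quasi-coherence through localization of sections. -/

section Quasicoherent

variable {X : Scheme.{u}}

/-- The sections of the module `M` over `W` are the localization at `f` of those over `V`. -/
def LocalizesAt (M : X.Modules) {V W : X.Opens} (h : W ≤ V) (f : Γ(X, V)) : Prop :=
  (∀ s : Γ(M, W), ∃ (n : ℕ) (t : Γ(M, V)),
    M.presheaf.map (homOfLE h).op t = (X.presheaf.map (homOfLE h).op f) ^ n • s) ∧
  ∀ t : Γ(M, V), M.presheaf.map (homOfLE h).op t = 0 → ∃ n : ℕ, f ^ n • t = 0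

/-- The principal open subset of `Spec R` defined by `f`. -/
def specBasicOpen {R : CommRingCat.{u}} (f : R) : (Spec R).Opens := PrimeSpectrum.basicOpen f

theorem isLocalizing_iff {R : CommRingCat.{u}} (M : (Spec R).Modules) :
    IsLocalizing (modulesSpecToSheaf.obj M) ↔ ∀ f : R,
      (∀ s : Γ(M, specBasicOpen f), ∃ (n : ℕ) (t : Γ(M, ⊤)),
        M.presheaf.map (homOfLE le_top).op t = f ^ n • s) ∧
      ∀ t : Γ(M, ⊤), M.presheaf.map (homOfLE (le_top : specBasicOpen f ≤ ⊤)).op t = 0 →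
        ∃ n : ℕ, f ^ n • t = 0 := by
  let φ (f : R) := ((modulesSpecToSheaf.obj M).obj.map (PrimeSpectrum.basicOpen f).leTop.op).hom
  refine ⟨fun h f => ?_, fun h f => IsLocalizedModule.Away.mk_of_addCommGroup ?_ ?_ ?_⟩
  · have hf : IsLocalizedModule.Away f (φ f) := h f
    refine ⟨fun s => ?_, fun s hs => ?_⟩
    · obtain ⟨n, y, hy⟩ := hf.surj _ _ s
      exact ⟨n, y, hy.symm⟩
    · obtain ⟨⟨_, n, rfl⟩, hn⟩ := (IsLocalizedModule.eq_zero_iff (.powers f) (φ f)).mp hs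
      exact ⟨n, hn⟩
  · exact Scheme.Modules.isUnit_algebraMap_end_of_le_basicOpen f le_rfl
  · intro x
    obtain ⟨n, t, ht⟩ := (h f).1 x
    exact ⟨n, t, ht.symm⟩
  · intro x hx
    exact (h f).2 _ hx

/-- It shows that the scalar action of `r` on a module restricted to `Spec Γ(X, V)` is
multiplication by a restriction of `r` on `X`. -/
theorem appIso_fromSpec_inv {V : X.Opens} (hV : IsAffineOpen V) (U : (Spec Γ(X, V)).Opens)
    (h : hV.fromSpec ''ᵁ U ≤ V) (r : Γ(X, V)) :
    (hV.fromSpec.appIso U).inv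
      ((Spec Γ(X, V)).presheaf.map U.leTop.op ((Scheme.ΓSpecIso Γ(X, V)).inv r)) =
      X.presheaf.map (homOfLE h).op r := by
  have e : X.presheaf.map (homOfLE h).op ≫ (hV.fromSpec.appIso U).hom =
      (Scheme.ΓSpecIso Γ(X, V)).inv ≫ (Spec Γ(X, V)).presheaf.map U.leTop.op := by
    rw [Scheme.Hom.appIso_hom', Scheme.Hom.map_appLE, Scheme.Hom.appLE, hV.fromSpec_app_self,
      Category.assoc, ← Functor.map_comp]
    rfl
  have e' := congrArg (fun a => a ≫ (hV.fromSpec.appIso U).inv) e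
  simp only [Category.assoc, Iso.hom_inv_id, Category.comp_id] at e'
  exact (congrArg (fun a => a.hom r) e').symm

theorem isLocalizing_restrict_iff (M : X.Modules) {V : X.Opens} (hV : IsAffineOpen V) :
    IsLocalizing (modulesSpecToSheaf.obj (M.restrict hV.fromSpec)) ↔
      ∀ f : Γ(X, V), LocalizesAt M (X.basicOpen_le f) f := by
  rw [isLocalizing_iff]
  refine forall_congr' fun f => ?_
  -- The images of `⊤` and `D(f)` under `fromSpec` equal `V` and the principal open only
  -- propositionally, so the statement is transported along equalities of opens.
  have key {V' W' : X.Opens} (hVV : V' = V) (hWW : W' = X.basicOpen f) (h : W' ≤ V') :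
      (LocalizesAt M (X.basicOpen_le f) f ↔
        LocalizesAt M h (X.presheaf.map (homOfLE hVV.le).op f)) := by
    subst hVV hWW
    have : homOfLE (le_refl V') = 𝟙 V' := rfl
    rw [this, op_id, X.presheaf.map_id]
    rfl
  have e1 : hV.fromSpec ''ᵁ ⊤ = V := by simp
  have e2 : hV.fromSpec ''ᵁ (specBasicOpen f) = X.basicOpen f :=
    hV.fromSpec_image_basicOpen f
  have hle : hV.fromSpec ''ᵁ (specBasicOpen f) ≤ hV.fromSpec ''ᵁ ⊤ :=
    hV.fromSpec.image_mono le_top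
  rw [key e1 e2 hle]
  have h1 (n : ℕ) (s : Γ(M, hV.fromSpec ''ᵁ (specBasicOpen f))) :
      (f ^ n • (show Γ(M.restrict hV.fromSpec, specBasicOpen f) from s) :
        Γ(M.restrict hV.fromSpec, specBasicOpen f)) =
      (X.presheaf.map (homOfLE hle).op (X.presheaf.map (homOfLE e1.le).op f)) ^ n • s := by
    have := appIso_fromSpec_inv hV (specBasicOpen f) (hle.trans e1.le) (f ^ n)
    have e : X.presheaf.map (homOfLE (hle.trans e1.le)).op (f ^ n) =
        (X.presheaf.map (homOfLE hle).op (X.presheaf.map (homOfLE e1.le).op f)) ^ n := by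
      rw [map_pow, ← ConcreteCategory.comp_apply, ← Functor.map_comp]
      rfl
    exact congrArg (fun a : Γ(X, hV.fromSpec ''ᵁ (specBasicOpen f)) => a • s)
      (this.trans e)
  have h2 (n : ℕ) (s : Γ(M, hV.fromSpec ''ᵁ ⊤)) :
      (f ^ n • (show Γ(M.restrict hV.fromSpec, ⊤) from s) : Γ(M.restrict hV.fromSpec, ⊤)) =
      (X.presheaf.map (homOfLE e1.le).op f) ^ n • s := by
    have := appIso_fromSpec_inv hV ⊤ e1.le (f ^ n)
    exact congrArg (fun a : Γ(X, hV.fromSpec ''ᵁ ⊤) => a • s) (this.trans (map_pow _ _ _))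
  refine and_congr (forall_congr' fun s => exists_congr fun n => exists_congr fun t => ?_)
    (forall_congr' fun t => imp_congr Iff.rfl (exists_congr fun n => ?_))
  · exact Eq.congr_right (h1 n s)
  · exact Eq.congr_left (h2 n t)

theorem localizesAt_of_isQuasicoherent (M : X.Modules) [M.IsQuasicoherent] {V : X.Opens}
    (hV : IsAffineOpen V) (f : Γ(X, V)) : LocalizesAt M (X.basicOpen_le f) f := by
  refine (isLocalizing_restrict_iff M hV).1 ?_ f
  rw [← isIso_fromTildeΓ_iff_isLocalizing]
  have : (M.restrict hV.fromSpec).IsQuasicoherent :=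
    Scheme.Modules.isQuasicoherent_restrictFunctor hV.fromSpec M
  exact Scheme.Modules.isIso_fromTildeΓ_of_isQuasicoherent _

/-- Over `Spec Γ(X, V)` the module is the one associated with its global sections, which has a
presentation; this is carried to `V` and then to the slice over `V`. -/
theorem nonempty_presentation_over (M : X.Modules) {V : X.Opens} (hV : IsAffineOpen V)
    (h : ∀ f : Γ(X, V), LocalizesAt M (X.basicOpen_le f) f) :
    Nonempty (SheafOfModules.Presentation (SheafOfModules.over M V)) := by
  have h1 : IsIso (M.restrict hV.fromSpec).fromTildeΓ := by
    rw [isIso_fromTildeΓ_iff_isLocalizing]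
    exact (isLocalizing_restrict_iff M hV).2 h
  have h1' : @IsIso (SheafOfModules.{u} (Spec Γ(X, V)).ringCatSheaf) _ _ _
    (M.restrict hV.fromSpec).fromTildeΓ := h1
  let P1 : SheafOfModules.Presentation (M.restrict hV.fromSpec) :=
    SheafOfModules.Presentation.ofIsIso.{u, u, u} (M.restrict hV.fromSpec).fromTildeΓ
      (presentationTilde.{u} _ .univ (by simp) _ (Submodule.span_eq _))
  let P2 := Scheme.Modules.presentationRestrict hV.isoSpec.hom P1
  let e : Scheme.Modules.restrictFunctor hV.fromSpec ⋙
      Scheme.Modules.restrictFunctor hV.isoSpec.hom ≅ Scheme.Modules.restrictFunctor V.ι :=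
    (Scheme.Modules.restrictFunctorComp _ _).symm ≪≫
      Scheme.Modules.restrictFunctorCongr hV.isoSpec_hom_fromSpec
  have h2 : @IsIso (SheafOfModules.{u} V.toScheme.ringCatSheaf) _ _ _ (e.app M).hom :=
    (inferInstance : IsIso (e.app M).hom)
  let P3 : SheafOfModules.Presentation (M.restrict V.ι) :=
    SheafOfModules.Presentation.ofIsIso.{u, u, u} (e.app M).hom P2
  let E := Scheme.Modules.overEquiv V
  let e' : E.inverse.obj (M.restrict V.ι) ≅ SheafOfModules.over M V :=
    E.inverse.mapIso ((Scheme.Modules.overFunctorEquiv V).app M).symm ≪≫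
      (E.unitIso.app (SheafOfModules.over M V)).symm
  let F : SheafOfModules.{u} V.toScheme.ringCatSheaf ⥤
    SheafOfModules.{u} (X.ringCatSheaf.over V) := E.inverse
  have : Limits.PreservesColimitsOfSize.{u, u} F :=
    E.symm.toAdjunction.leftAdjoint_preservesColimits
  exact ⟨SheafOfModules.Presentation.ofIsIso.{u, u, u} e'.hom
    (P3.map F (V.sheafOfModulesEquivOverInverseUnit X.ringCatSheaf).symm)⟩

theorem isQuasicoherent_of_localizesAt (M : X.Modules)
    (h : ∀ x : X, ∃ V : X.Opens, x ∈ V ∧ IsAffineOpen V ∧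
      ∀ f : Γ(X, V), LocalizesAt M (X.basicOpen_le f) f) : M.IsQuasicoherent := by
  choose V hxV hV hf using h
  exact SheafOfModules.QuasicoherentData.isQuasicoherent (M := M)
    { I := X
      X := V
      coversTop := (Opens.coversTop_iff _ _).2 (by
        refine eq_top_iff.2 ?_
        exact fun x _ => Opens.mem_iSup.2 ⟨x, hxV x⟩)
      presentation := fun x => (nonempty_presentation_over M (hV x) (hf x)).some }

end Quasicoherent

/-! ### The reduction map on sections. -/

section Reduce

variable (p : ℕ) {T : TopCat.{u}} {F : TopCat.Presheaf CommRingCat.{u} T}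

/-- The reduction map `F(U) → (F / p)(U)`. -/
noncomputable def reduce (F : TopCat.Presheaf CommRingCat.{u} T) (U : Opens T) :
    F.obj (op U) →+* (modPow p 1 F).presheaf.obj (op U) :=
  ((toModPow p 1 F).app (op U)).hom

variable {p}

theorem rs_reduce {U V : Opens T} (h : V ≤ U) (s : F.obj (op U)) :
    rs (modPow p 1 F).presheaf h (reduce p F U s) = reduce p F V (rs F h s) :=
  (rs_naturality F (toModPow p 1 F) h s).symm

theorem reduce_eq_iff (hF : F.IsSheaf) (hp : ∀ U : Opens T, TorsionFree p (F.obj (op U)))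
    {U : Opens T} {s t : F.obj (op U)} :
    reduce p F U s = reduce p F U t ↔ (p : F.obj (op U)) ∣ s - t := by
  have := toModPow_eq_iff hF hp (n := 1) (s := s) (t := t)
  rwa [pow_one] at this

theorem reduce_eq_zero_iff (hF : F.IsSheaf) (hp : ∀ U : Opens T, TorsionFree p (F.obj (op U)))
    {U : Opens T} {s : F.obj (op U)} : reduce p F U s = 0 ↔ (p : F.obj (op U)) ∣ s := by
  rw [← map_zero (reduce p F U), reduce_eq_iff hF hp, sub_zero]

end Reduce

/-! ### The `𝒪_X`-algebra structure on `P/p`. -/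

section Reduction

variable {p : ℕ} {Y : FormalScheme.{u} p} {X : Scheme.{u}}
  {i : ClosedImmersion X Y} {φ : Y.modPow 2 ⟶ Y.modPow 2}
  {P : TopCat.Sheaf CommRingCat.{u} X.carrier}
  {θ : Y.toRingedSpace.presheaf ⟶
    (TopCat.Presheaf.pushforward CommRingCat.{u} i.hom.base).obj P.presheaf}

namespace ClosedImmersion.ComputesEnvelopes

variable (hP : i.ComputesEnvelopes φ P θ) (h : i.Admissible φ)
include hP h

theorem reduce_surjective [Fact p.Prime] (U : Y.Affinoid) :
    Function.Surjective (reduce p P.presheaf (i.inter U.1)) := by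
  intro t
  have H (x : i.inter U.1) : ∃ (f : Y.sections U.1)
      (s : P.presheaf.obj (op (i.inter (h.basicOpen U f).1))),
      x.1 ∈ i.inter (h.basicOpen U f).1 ∧ reduce p P.presheaf _ s =
        rs (modPow p 1 P.presheaf).presheaf (i.inter_mono (h.basicOpen_le U f)) t := by
    obtain ⟨V, hV, s, hxV, hs⟩ := exists_local_toModPow t x.1 x.2
    obtain ⟨f, hxf, hf⟩ := h.exists_basicOpen_inter_le U.2 x.2 hxV
    have hf' : i.inter (h.basicOpen U f).1 ≤ V := hf
    refine ⟨f, rs P.presheaf hf' s, hxf, ?_⟩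
    have e : reduce p P.presheaf V s = rs (modPow p 1 P.presheaf).presheaf hV t := hs
    rw [← rs_reduce, e, rs_rs]
  choose f s hxf hs using H
  obtain ⟨m, j, c, hc⟩ := h.exists_cover U.2 (f := f) fun x hx => ⟨⟨x, hx⟩, hxf _⟩
  have hc' := hP.dvd_of_mem h hc
  simp only [map_sub, map_one, map_sum, map_mul] at hc'
  obtain ⟨x, hx⟩ := exists_glue_mod_pow (p := p) (f := fun a => i.sectionMap θ U.1 (f (j a)))
    (h := fun a => rs P.presheaf (i.inter_mono (h.basicOpen_le U (f (j a)))))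
    (l := fun a b => rs P.presheaf (i.inter_mono (h.basicOpen_mul_le_left U (f (j a)) (f (j b)))))
    (r := fun a b => rs P.presheaf (i.inter_mono (h.basicOpen_mul_le_right U (f (j a)) (f (j b)))))
    (fun a b => hP.torsionFree h _) (fun a => hP.ploc h U (f (j a)))
    (fun a b => by
      ext s
      simp only [RingHom.comp_apply, rs_rs])
    (fun a b => by
      have e := hP.ploc h U (f (j a) * f (j b))
      rw [map_mul] at e
      convert e using 1
      ext s
      simp only [RingHom.comp_apply, rs_rs]) hc' (M := 1) (fun a => s (j a)) (fun a b => by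
        rw [pow_one, ← reduce_eq_iff P.2 (hP.torsionFree h), ← rs_reduce, ← rs_reduce, hs, hs,
          rs_rs, rs_rs])
  refine ⟨x, eq_of_locally_eq (modPow p 1 P.presheaf).2 fun y hy => ?_⟩
  obtain ⟨a, ha⟩ := h.exists_mem_inter U.2 hc hy
  refine ⟨_, i.inter_mono (h.basicOpen_le U (f (j a))), ha, ?_⟩
  have := hx a
  rw [pow_one, ← reduce_eq_iff P.2 (hP.torsionFree h), ← rs_reduce, hs] at this
  exact this.symm

/-- `R` maps onto `Γ(X ∩ U, 𝒪_X)` with kernel `I`, and `I` becomes divisible by `p` in the envelope.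
-/
theorem exists_reduction_inter (U : Y.Affinoid) :
    ∃ e : X.presheaf.obj (op (i.inter U.1)) →+*
      (modPow p 1 P.presheaf).presheaf.obj (op (i.inter U.1)),
      ∀ r, e (i.app U.1 r) = reduce p P.presheaf _ (i.sectionMap θ U.1 r) := by
  have hs := (i.isAffineOpen_inter h.torsionFree h.natCast_eq_zero U.2).2
  refine ⟨(i.app U.1).liftOfSurjective hs
    ⟨(reduce p P.presheaf _).comp (i.sectionMap θ U.1), fun r hr => ?_⟩, fun r => ?_⟩
  · exact (reduce_eq_zero_iff P.2 (hP.torsionFree h)).2 (hP.dvd_of_mem h hr)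
  · exact RingHom.liftOfRightInverse_comp_apply ..

theorem exists_isReduction : ∃ σ : X.sheaf ⟶ modPow p 1 P.presheaf, i.IsReduction P θ σ := by
  choose e he using hP.exists_reduction_inter h
  have hs (U : Y.Affinoid) := (i.isAffineOpen_inter h.torsionFree h.natCast_eq_zero U.2).2
  have H {U V : Y.Affinoid} (hVU : V ≤ U) (s : X.presheaf.obj (op (i.inter U.1))) :
      rs (modPow p 1 P.presheaf).presheaf (i.inter_mono hVU) (e U s) =
        e V (rs X.presheaf (i.inter_mono hVU) s) := by
    obtain ⟨r, rfl⟩ := hs U s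
    rw [he, rs_reduce]
    refine (congrArg _ (rs_sectionMap hVU r)).trans ?_
    exact (he V _).symm.trans (congrArg (e V) (i.app_rs hVU r))
  obtain ⟨α, hα⟩ := exists_hom_of_basis (F := X.presheaf) (π := fun U : Y.Affinoid => i.inter U.1)
    (modPow p 1 P.presheaf).2 h.exists_affinoid_mem e fun U V x hxU hxV => by
      obtain ⟨W, hWU, hWV, hxW⟩ := h.exists_affinoid_le_le hxU hxV
      exact ⟨W, i.inter_mono hWU, i.inter_mono hWV, hxW, H hWU, H hWV⟩
  refine ⟨⟨α⟩, fun U r => eq_of_locally_eq (modPow p 1 P.presheaf).2 fun x hx => ?_⟩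
  obtain ⟨V, hV, hxV⟩ := h.exists_affinoid_le U x hx
  refine ⟨i.inter V.1, i.inter_mono hV, hxV, ?_⟩
  refine (rs_naturality X.presheaf α (i.inter_mono hV) (i.app U r)).symm.trans ?_
  refine (congrArg _ (i.app_rs hV r).symm).trans ((hα V _).trans ((he V _).trans ?_))
  refine (congrArg _ (rs_sectionMap hV r).symm).trans ?_
  exact (rs_reduce (i.inter_mono hV) (i.sectionMap θ U r)).symm

omit hP in
theorem isReduction_unique {σ σ' : X.sheaf ⟶ modPow p 1 P.presheaf} (hσ : i.IsReduction P θ σ)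
    (hσ' : i.IsReduction P θ σ') : σ' = σ := by
  refine Sheaf.hom_ext (hom_ext_of_basis (F := X.presheaf)
    (π := fun U : Y.Affinoid => i.inter U.1) (modPow p 1 P.presheaf).2 h.exists_affinoid_mem
    fun U s => ?_)
  obtain ⟨r, rfl⟩ := (i.isAffineOpen_inter h.torsionFree h.natCast_eq_zero U.2).2 s
  exact (hσ' U.1 r).trans (hσ U.1 r).symm

end ClosedImmersion.ComputesEnvelopes

end Reduction

/-! ### The localization property for an `𝒪_X`-algebra. -/

section AsModule

variable {X : Scheme.{u}} {Q : TopCat.Sheaf CommRingCat.{u} X.carrier} (σ : X.sheaf ⟶ Q)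

/-- The map on sections given by a homomorphism `σ : 𝒪_X → Q`. -/
noncomputable def algMap (V : X.Opens) : Γ(X, V) →+* Q.presheaf.obj (op V) := (σ.hom.app (op V)).hom

theorem rs_algMap {V W : X.Opens} (h : W ≤ V) (f : Γ(X, V)) :
    rs Q.presheaf h (algMap σ V f) = algMap σ W (rs X.presheaf h f) :=
  (rs_naturality X.presheaf σ.hom h f).symm

theorem localizesAt_asModule_iff {V W : X.Opens} (h : W ≤ V) (f : Γ(X, V)) :
    LocalizesAt (asModule σ) h f ↔
      (∀ s : Q.presheaf.obj (op W), ∃ (n : ℕ) (t : Q.presheaf.obj (op V)),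
        rs Q.presheaf h t = rs Q.presheaf h (algMap σ V f) ^ n * s) ∧
      ∀ t : Q.presheaf.obj (op V), rs Q.presheaf h t = 0 → ∃ n : ℕ, algMap σ V f ^ n * t = 0 := by
  refine and_congr (forall_congr' fun s => exists_congr fun n => exists_congr fun t => ?_)
    (forall_congr' fun t => imp_congr Iff.rfl (exists_congr fun n => ?_))
  · have e : rs Q.presheaf h (algMap σ V f) ^ n = algMap σ W (rs X.presheaf h f ^ n) := by
      rw [rs_algMap, map_pow]
    rw [e]
    rfl
  · rw [← map_pow]
    rfl

end AsModule

/-! ### Quasi-coherence of `P/p`. -/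

section Quasicoherent

variable {p : ℕ} [Fact p.Prime] {Y : FormalScheme.{u} p} {X : Scheme.{u}}
  {i : ClosedImmersion X Y} {φ : Y.modPow 2 ⟶ Y.modPow 2}
  {P : TopCat.Sheaf CommRingCat.{u} X.carrier}
  {θ : Y.toRingedSpace.presheaf ⟶
    (TopCat.Presheaf.pushforward CommRingCat.{u} i.hom.base).obj P.presheaf}
  {σ : X.sheaf ⟶ modPow p 1 P.presheaf}

namespace ClosedImmersion.ComputesEnvelopes

variable (hP : i.ComputesEnvelopes φ P θ) (h : i.Admissible φ) (hσ : i.IsReduction P θ σ)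
include hP h hσ

theorem localizesAt_inter (U : Y.Affinoid) (f : Γ(X, i.inter U.1)) :
    LocalizesAt (asModule σ) (X.basicOpen_le f) f := by
  obtain ⟨r, rfl⟩ := (i.isAffineOpen_inter h.torsionFree h.natCast_eq_zero U.2).2 f
  -- The principal open of `X` equals `X ∩ U_r` only propositionally, so it is generalized before
  -- substituting; over `X ∩ U_r` the claim is the `PLoc` property of envelopes.
  have key : ∀ (W : X.Opens) (hW : W = i.inter (h.basicOpen U r).1) (hWU : W ≤ i.inter U.1),
      LocalizesAt (asModule σ) hWU (i.app U.1 r) := by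
    rintro _ rfl hWU
    have e : algMap σ _ (i.app U.1 r) = reduce p P.presheaf _ (i.sectionMap θ U.1 r) := hσ U.1 r
    rw [localizesAt_asModule_iff, e]
    refine ⟨fun s => ?_, fun t ht => ?_⟩
    · obtain ⟨b, rfl⟩ := hP.reduce_surjective h (h.basicOpen U r) s
      obtain ⟨k, a, ha⟩ := (hP.ploc h U r).surj b
      refine ⟨k, reduce p P.presheaf _ a, ?_⟩
      rw [← reduce_eq_iff P.2 (hP.torsionFree h), map_mul, map_pow] at ha
      rw [rs_reduce, rs_reduce]
      exact ha.symm
    · obtain ⟨a, rfl⟩ := hP.reduce_surjective h U t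
      rw [rs_reduce, reduce_eq_zero_iff P.2 (hP.torsionFree h)] at ht
      obtain ⟨k, hk⟩ := (hP.ploc h U r).inj a ht
      refine ⟨k, ?_⟩
      rwa [← reduce_eq_zero_iff P.2 (hP.torsionFree h), map_mul, map_pow] at hk
  exact key _ (i.basicOpen_app h.torsionFree U.2 r) _

theorem isQuasicoherent : (asModule σ).IsQuasicoherent :=
  isQuasicoherent_of_localizesAt (asModule σ) fun x => by
    obtain ⟨U, hxU, -⟩ := h.exists_affinoid_mem ⊤ x trivial
    exact ⟨_, hxU, (i.isAffineOpen_inter h.torsionFree h.natCast_eq_zero U.2).1,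
      hP.localizesAt_inter h hσ U⟩

/-- Quasi-coherence carries the localization property from the opens `X ∩ U` to all affine opens. -/
theorem localizes {V : X.Opens} (hV : IsAffineOpen V) (f : Γ(X, V)) :
    (∀ s : (modPow p 1 P.presheaf).presheaf.obj (op (X.basicOpen f)),
      ∃ (n : ℕ) (t : (modPow p 1 P.presheaf).presheaf.obj (op V)),
        rs _ (X.basicOpen_le f) t = rs _ (X.basicOpen_le f) (algMap σ V f) ^ n * s) ∧
      ∀ t : (modPow p 1 P.presheaf).presheaf.obj (op V), rs _ (X.basicOpen_le f) t = 0 →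
        ∃ n : ℕ, algMap σ V f ^ n * t = 0 := by
  rw [← localizesAt_asModule_iff]
  exact @localizesAt_of_isQuasicoherent X (asModule σ) (hP.isQuasicoherent h hσ) V hV f

end ClosedImmersion.ComputesEnvelopes

end Quasicoherent

/-! ### Čech cohomology and lifting of sections modulo `p`. -/

section Cech

variable {T : TopCat.{u}} {Q : TopCat.Presheaf CommRingCat.{u} T} {V : Opens T} {ι : Type*}
  [Fintype ι] {W : ι → Opens T}

/-- Vanishing of the first Čech cohomology of a covering by principal open subsets. -/
theorem exists_coboundary (hW : ∀ a, W a ≤ V) (g : ι → Q.obj (op V))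
    (hg : ∀ N : ℕ, ∃ d : ι → Q.obj (op V), ∑ b, d b * g b ^ N = 1)
    (hsurj : ∀ a b (s : Q.obj (op (W a ⊓ W b))), ∃ (n : ℕ) (t : Q.obj (op (W a))),
      rs Q inf_le_left t = rs Q (inf_le_left.trans (hW a)) (g b) ^ n * s)
    (hinj : ∀ a b c (t : Q.obj (op (W a ⊓ W b))),
      rs Q (inf_le_left : W a ⊓ W b ⊓ W c ≤ _) t = 0 →
        ∃ n : ℕ, rs Q (inf_le_left.trans (hW a)) (g c) ^ n * t = 0)
    (n : ∀ a b, Q.obj (op (W a ⊓ W b)))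
    (hn : ∀ a b c, rs Q (le_inf (inf_le_left.trans inf_le_left) inf_le_right :
        W a ⊓ W b ⊓ W c ≤ W a ⊓ W c) (n a c) -
      rs Q (le_inf (inf_le_left.trans inf_le_right) inf_le_right :
        W a ⊓ W b ⊓ W c ≤ W b ⊓ W c) (n b c) = rs Q inf_le_left (n a b)) :
    ∃ e : ∀ a, Q.obj (op (W a)), ∀ a b,
      n a b = rs Q inf_le_left (e a) - rs Q inf_le_right (e b) := by
  obtain ⟨K, hK⟩ := exists_uniform (ι := ι × ι)
    (Q := fun c k => ∃ t : Q.obj (op (W c.1)), rs Q (inf_le_left : W c.1 ⊓ W c.2 ≤ _) t =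
      rs Q (inf_le_left.trans (hW c.1)) (g c.2) ^ k * n c.1 c.2)
    (fun c k ⟨t, ht⟩ => ⟨rs Q (hW c.1) (g c.2) * t, by
      rw [map_mul, ht, rs_rs, pow_succ', mul_assoc]⟩) fun c => hsurj _ _ _
  -- `m a c` extends `g_c^K n_ac` from the overlap to `W a`. Up to a uniform power `g_c^L`, the
  -- difference `m_ac - m_bc` is `g_c^K n_ab`.
  choose m hm using fun a b => hK (a, b)
  obtain ⟨L, hL⟩ := exists_uniform (ι := ι × ι × ι)
    (Q := fun c k => rs Q (inf_le_left.trans (hW c.1)) (g c.2.2) ^ k *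
      (rs Q (inf_le_left : W c.1 ⊓ W c.2.1 ≤ _) (m c.1 c.2.2) - rs Q inf_le_right (m c.2.1 c.2.2) -
        rs Q (inf_le_left.trans (hW c.1)) (g c.2.2) ^ K * n c.1 c.2.1) = 0)
    (fun c k hk => by rw [pow_succ', mul_assoc, hk, mul_zero]) fun ⟨a, b, c⟩ => by
      refine hinj a b c _ ?_
      have h1 := congrArg (rs Q (le_inf (inf_le_left.trans inf_le_left) inf_le_right :
        W a ⊓ W b ⊓ W c ≤ W a ⊓ W c)) (hm a c)
      have h2 := congrArg (rs Q (le_inf (inf_le_left.trans inf_le_right) inf_le_right :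
        W a ⊓ W b ⊓ W c ≤ W b ⊓ W c)) (hm b c)
      simp only [rs_rs, map_mul, map_pow] at h1 h2
      simp only [map_sub, rs_rs, map_mul, map_pow]
      rw [h1, h2, ← hn a b c]
      ring
  obtain ⟨d, hd⟩ := hg (L + K)
  -- Weighting by `∑ d_c g_c^(L+K) = 1` makes the differences of these sums equal to `n_ab`.
  refine ⟨fun a => ∑ c, rs Q (hW a) (d c) * rs Q (hW a) (g c) ^ L * m a c, fun a b => ?_⟩
  have hd' := congrArg (rs Q (inf_le_left.trans (hW a) : W a ⊓ W b ≤ V)) hd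
  simp only [map_sum, map_mul, map_pow, map_one] at hd'
  simp only [map_sum, map_mul, map_pow, rs_rs]
  rw [← Finset.sum_sub_distrib, ← one_mul (n a b), ← hd', Finset.sum_mul]
  refine Finset.sum_congr rfl fun c _ => ?_
  have := hL (a, b, c)
  rw [mul_sub, sub_eq_zero] at this
  rw [pow_add, ← mul_sub_left_distrib, mul_assoc, mul_assoc, mul_assoc]
  exact congrArg _ this.symm

variable {p : ℕ} {F : TopCat.Presheaf CommRingCat.{u} T}

omit [Fintype ι] in
/-- Sections of `F / p` lift to `F` when the first Čech cohomology of `F / p` vanishes. -/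
theorem exists_reduce_eq (hF : F.IsSheaf) (hc : ∀ U : Opens T, TFComplete p (F.obj (op U)))
    (hW : ∀ a, W a ≤ V) (hcov : ∀ x ∈ V, ∃ a, x ∈ W a)
    (hs : ∀ a, Function.Surjective (reduce p F (W a)))
    (H : ∀ n : ∀ a b, (modPow p 1 F).presheaf.obj (op (W a ⊓ W b)),
      (∀ a b c, rs _ (le_inf (inf_le_left.trans inf_le_left) inf_le_right :
        W a ⊓ W b ⊓ W c ≤ W a ⊓ W c) (n a c) -
      rs _ (le_inf (inf_le_left.trans inf_le_right) inf_le_right :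
        W a ⊓ W b ⊓ W c ≤ W b ⊓ W c) (n b c) = rs _ inf_le_left (n a b)) →
      ∃ e : ∀ a, (modPow p 1 F).presheaf.obj (op (W a)), ∀ a b,
        n a b = rs _ inf_le_left (e a) - rs _ inf_le_right (e b))
    (t : (modPow p 1 F).presheaf.obj (op V)) : ∃ s, reduce p F V s = t := by
  have hp (U : Opens T) : TorsionFree p (F.obj (op U)) := (hc U).tf
  let good (n : ℕ) (s : ∀ a, F.obj (op (W a))) : Prop :=
    (∀ a, reduce p F (W a) (s a) = rs _ (hW a) t) ∧
      ∀ a b, (p : F.obj (op (W a ⊓ W b))) ^ (n + 1) ∣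
        rs F inf_le_left (s a) - rs F inf_le_right (s b)
  have step (n : ℕ) (s : ∀ a, F.obj (op (W a))) (hs' : good n s) :
      ∃ s', good (n + 1) s' ∧ ∀ a, (p : F.obj (op (W a))) ^ (n + 1) ∣ s' a - s a := by
    choose c hc' using hs'.2
    -- The quotients of the differences by `p^(n+1)` form a cocycle modulo `p`; subtracting
    -- `p^(n+1)` times lifts of the bounding cochain improves the agreement to `p^(n+2)` without
    -- changing the reductions.
    obtain ⟨e, he⟩ := H (fun a b => reduce p F _ (c a b)) fun a b d => by
      rw [rs_reduce, rs_reduce, rs_reduce, ← map_sub]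
      congr 1
      refine (hp _).pow_mul_cancel (n + 1) ?_
      have h1 := congrArg (rs F (le_inf (inf_le_left.trans inf_le_left) inf_le_right :
        W a ⊓ W b ⊓ W d ≤ W a ⊓ W d)) (hc' a d)
      have h2 := congrArg (rs F (le_inf (inf_le_left.trans inf_le_right) inf_le_right :
        W a ⊓ W b ⊓ W d ≤ W b ⊓ W d)) (hc' b d)
      have h3 := congrArg (rs F (inf_le_left : W a ⊓ W b ⊓ W d ≤ W a ⊓ W b)) (hc' a b)
      simp only [map_sub, rs_rs, map_mul, map_pow, map_natCast] at h1 h2 h3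
      rw [mul_sub, ← h1, ← h2, ← h3]
      ring
    choose e' he' using fun a => hs a (e a)
    refine ⟨fun a => s a - p ^ (n + 1) * e' a, ⟨fun a => ?_, fun a b => ?_⟩, fun a => ?_⟩
    · rw [← hs'.1 a, reduce_eq_iff hF hp, sub_sub_cancel_left, dvd_neg]
      exact (dvd_pow_self _ n.succ_ne_zero).mul_right _
    · have h1 := he a b
      rw [← he' a, ← he' b, rs_reduce, rs_reduce, ← map_sub, reduce_eq_iff hF hp] at h1
      obtain ⟨v, hv⟩ := h1
      have h2 := hc' a b
      refine ⟨v, ?_⟩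
      simp only [map_sub, map_mul, map_pow, map_natCast]
      linear_combination h2 + (p : F.obj (op (W a ⊓ W b))) ^ (n + 1) * hv
    · rw [sub_sub_cancel_left, dvd_neg]
      exact dvd_mul_right _ _
  choose s₀ hs₀ using fun a => hs a (rs _ (hW a) t)
  have h0 : good 0 s₀ := ⟨hs₀, fun a b => by
    rw [zero_add, pow_one, ← reduce_eq_iff hF hp, ← rs_reduce, ← rs_reduce, hs₀, hs₀, rs_rs, rs_rs]⟩
  choose f hf hf' using step
  let u (n : ℕ) : {s // good n s} := Nat.rec ⟨s₀, h0⟩ (fun n s => ⟨f n s.1 s.2, hf n s.1 s.2⟩) n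
  have hu (n : ℕ) (a : ι) : (p : F.obj (op (W a))) ^ (n + 1) ∣ (u (n + 1)).1 a - (u n).1 a :=
    hf' n (u n).1 (u n).2 a
  choose l hl using fun a => (hc (W a)).exists_limit (u := fun n => (u n).1 a) fun n =>
    (pow_dvd_pow _ n.le_succ).trans (hu n a)
  obtain ⟨s, hsl⟩ := exists_section hF W V hW hcov l fun a b x hxa hxb => by
    refine ⟨W a ⊓ W b, inf_le_left, inf_le_right, ⟨hxa, hxb⟩, (hc _).eq_of_forall fun n => ?_⟩
    have h1 := map_dvd_pow (rs F (inf_le_left : W a ⊓ W b ≤ W a)) (hl a n)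
    have h2 := map_dvd_pow (rs F (inf_le_right : W a ⊓ W b ≤ W b)) (hl b n)
    have h3 := (pow_dvd_pow (p : F.obj (op (W a ⊓ W b))) n.le_succ).trans ((u n).2.2 a b)
    rw [map_sub] at h1 h2
    have h4 := dvd_sub (dvd_add h1 h3) h2
    convert h4 using 1
    ring
  refine ⟨s, eq_of_locally_eq (modPow p 1 F).2 fun x hx => ?_⟩
  obtain ⟨a, ha⟩ := hcov x hx
  refine ⟨W a, hW a, ha, ?_⟩
  rw [rs_reduce, hsl, ← (u 1).2.1 a, reduce_eq_iff hF hp]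
  simpa using hl a 1

end Cech

/-! ### Arbitrary affine opens of `X`. -/

section Main

variable {p : ℕ} [Fact p.Prime] {Y : FormalScheme.{u} p} {X : Scheme.{u}}
  {i : ClosedImmersion X Y} {φ : Y.modPow 2 ⟶ Y.modPow 2}
  {P : TopCat.Sheaf CommRingCat.{u} X.carrier}
  {θ : Y.toRingedSpace.presheaf ⟶
    (TopCat.Presheaf.pushforward CommRingCat.{u} i.hom.base).obj P.presheaf}
  {σ : X.sheaf ⟶ modPow p 1 P.presheaf}

namespace ClosedImmersion.ComputesEnvelopes

variable (hP : i.ComputesEnvelopes φ P θ) (h : i.Admissible φ) (hσ : i.IsReduction P θ σ)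
include hP h

/-- Near `x` there is an open that is principal both in `V` and in some `X ∩ U`; the latter makes it
of the form `X ∩ U_r`, where sections lift. -/
theorem exists_basicOpen_reduce_surjective {V : X.Opens} (hV : IsAffineOpen V) {x : X}
    (hx : x ∈ V) : ∃ f : Γ(X, V), x ∈ X.basicOpen f ∧
      Function.Surjective (reduce p P.presheaf (X.basicOpen f)) := by
  obtain ⟨U, hxU, -⟩ := h.exists_affinoid_mem ⊤ x trivial
  obtain ⟨hU, hs⟩ := i.isAffineOpen_inter h.torsionFree h.natCast_eq_zero U.2
  obtain ⟨f, g, e, hxf⟩ := exists_basicOpen_le_affine_inter hV hU x ⟨hx, hxU⟩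
  obtain ⟨r, rfl⟩ := hs g
  refine ⟨f, hxf, ?_⟩
  rw [e, i.basicOpen_app h.torsionFree U.2]
  exact hP.reduce_surjective h (h.basicOpen U r)

include hσ

theorem localizes_inf {V : X.Opens} {f : Γ(X, V)} {V' W : X.Opens} (hV' : IsAffineOpen V')
    (hVV : V' ≤ V) (hW : W = V' ⊓ X.basicOpen f) (hWV : W ≤ V') :
    (∀ s : (modPow p 1 P.presheaf).presheaf.obj (op W),
      ∃ (n : ℕ) (t : (modPow p 1 P.presheaf).presheaf.obj (op V')),
        rs _ hWV t = rs _ (hWV.trans hVV) (algMap σ V f) ^ n * s) ∧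
      ∀ t : (modPow p 1 P.presheaf).presheaf.obj (op V'), rs _ hWV t = 0 →
        ∃ n : ℕ, rs _ hVV (algMap σ V f) ^ n * t = 0 := by
  have e : W = X.basicOpen (rs X.presheaf hVV f) :=
    hW.trans (X.basicOpen_res f (homOfLE hVV).op).symm
  subst e
  have := hP.localizes h hσ hV' (rs X.presheaf hVV f)
  rw [← rs_algMap, rs_rs] at this
  exact this

theorem reduce_surjective_of_isAffineOpen {V : X.Opens} (hV : IsAffineOpen V) :
    Function.Surjective (reduce p P.presheaf V) := by
  choose f hxf hf using fun x : V => hP.exists_basicOpen_reduce_surjective h hV x.2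
  have h1 : Ideal.span (Set.range f) = ⊤ := by
    refine hV.self_le_iSup_basicOpen_iff.1 fun x hx => ?_
    exact Opens.mem_iSup.2 ⟨⟨_, ⟨x, hx⟩, rfl⟩, hxf _⟩
  obtain ⟨m, j, c, hc⟩ := exists_sum_of_span_sup_eq_top (f := f) (J := ⊥) (by rwa [sup_bot_eq])
  have hc1 : ∑ a, c a * f (j a) = 1 := by
    rw [Ideal.mem_bot, sub_eq_zero] at hc
    exact hc.symm
  have hspan (N : ℕ) : ∃ d : Fin m → Γ(X, V), ∑ a, d a * f (j a) ^ N = 1 := by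
    -- For `p = 0`, divisibility by `p` means vanishing, so this gives an exact partition of unity
    -- by `N`-th powers.
    obtain ⟨d, hd⟩ := exists_partition_pow (p := 0) (f := fun a => f (j a)) (c := c)
      (by rw [hc1, sub_self]; exact dvd_zero _) 1 N
    rw [pow_one, Nat.cast_zero, zero_dvd_iff, sub_eq_zero] at hd
    exact ⟨d, hd.symm⟩
  have hcov (x) (hx : x ∈ V) : ∃ a, x ∈ X.basicOpen (f (j a)) := by
    have h2 : Ideal.span (Set.range fun a => f (j a)) = ⊤ := by
      rw [Ideal.eq_top_iff_one, ← hc1]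
      exact sum_mem fun a _ => Ideal.mul_mem_left _ _ (Ideal.subset_span ⟨a, rfl⟩)
    rw [← iSup_basicOpen_of_span_eq_top V _ h2] at hx
    simp only [Set.mem_range, Opens.mem_iSup] at hx
    obtain ⟨_, ⟨a, rfl⟩, ha⟩ := hx
    exact ⟨a, ha⟩
  have hinf (a b : Fin m) : X.basicOpen (f (j a)) ⊓ X.basicOpen (f (j b)) =
      X.basicOpen (f (j a) * f (j b)) := (X.basicOpen_mul _ _).symm
  intro t
  refine exists_reduce_eq (W := fun a => X.basicOpen (f (j a))) P.2 (hP.tfComplete h)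
    (fun a => X.basicOpen_le _) hcov (fun a => hf _) (fun n hn => ?_) t
  refine exists_coboundary (W := fun a => X.basicOpen (f (j a))) (fun a => X.basicOpen_le _)
    (fun a => algMap σ V (f (j a))) (fun N => ?_) (fun a b s => ?_) (fun a b c s hs => ?_) n hn
  · obtain ⟨d, hd⟩ := hspan N
    refine ⟨fun a => algMap σ V (d a), ?_⟩
    rw [← map_one (algMap σ V), ← hd]
    simp
  · exact (hP.localizes_inf h hσ (hV.basicOpen (f (j a))) (X.basicOpen_le _) rfl inf_le_left).1 s
  · refine (hP.localizes_inf h hσ (V' := X.basicOpen (f (j a)) ⊓ X.basicOpen (f (j b))) ?_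
      (inf_le_left.trans (X.basicOpen_le _)) rfl inf_le_left).2 s hs
    rw [hinf]
    exact hV.basicOpen _

/-- Since sections of `P/p` over affine opens lift, the localization property of `P/p` translates
into divisibility by `p` in `P`, and `g` becomes a unit because it is one modulo `p`. -/
theorem ploc_of_isAffineOpen {V : X.Opens} (hV : IsAffineOpen V) {f : Γ(X, V)}
    {g : P.presheaf.obj (op V)} (hg : reduce p P.presheaf V g = algMap σ V f) :
    PLoc p (rs P.presheaf (X.basicOpen_le f)) g where
  unit := by
    have h1 : IsUnit (rs X.presheaf (X.basicOpen_le f) f) := X.toRingedSpace.isUnit_res_basicOpen f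
    obtain ⟨v, hv⟩ := (h1.map (algMap σ _)).exists_right_inv
    obtain ⟨y, rfl⟩ := hP.reduce_surjective_of_isAffineOpen h hσ (hV.basicOpen f) v
    refine (hP.tfComplete h _).isUnit (y := y) ?_
    rw [← reduce_eq_iff P.2 (hP.torsionFree h), map_mul, map_one, ← rs_reduce, hg, rs_algMap, hv]
  surj b := by
    obtain ⟨n, t, ht⟩ := (hP.localizes h hσ hV f).1 (reduce p P.presheaf _ b)
    obtain ⟨a, rfl⟩ := hP.reduce_surjective_of_isAffineOpen h hσ hV t
    refine ⟨n, a, ?_⟩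
    rw [← reduce_eq_iff P.2 (hP.torsionFree h), map_mul, map_pow, ← rs_reduce, ← rs_reduce, hg, ht]
  inj a ha := by
    rw [← reduce_eq_zero_iff P.2 (hP.torsionFree h), ← rs_reduce] at ha
    obtain ⟨n, hn⟩ := (hP.localizes h hσ hV f).2 _ ha
    refine ⟨n, ?_⟩
    rw [← reduce_eq_zero_iff P.2 (hP.torsionFree h), map_mul, map_pow, hg, hn]

end ClosedImmersion.ComputesEnvelopes

end Main

end PrismaticSheaf

theorem mainTheorem8 (p : ℕ) [Fact p.Prime]
    -- the crystalline prism `(A, δ)`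
    {A : Type u} [CommRing A] (d : DeltaStructure p A) (hA : IsCrystallinePrism p A d)
    -- the smooth formal `A`-scheme `Y`
    (Y : FormalScheme.{u} p) (a : A →+* Y.sections ⊤) (hY : Y.IsSmoothOver a)
    -- the separated `A / p`-scheme `X` of finite type
    (X : Scheme.{u}) (s : X ⟶ Spec (CommRingCat.of (A ⧸ Ideal.span {(p : A)})))
    [IsSeparated s] [LocallyOfFiniteType s] [QuasiCompact s]
    -- the complete intersection closed immersion `X → Y` over `A`
    (i : ClosedImmersion X Y) (hi : i.IsOver a s) (hci : i.IsCompleteIntersection)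
    -- the Frobenius lift on `Y ⊗ A / p ^ 2`
    (φ : Y.modPow 2 ⟶ Y.modPow 2) (hφ : Y.IsFrobeniusLift φ) (hφA : Y.IsCompatible d a φ) :
    -- local lifts of `φ` exist
    (∀ U : Opens Y.toRingedSpace, IsAffinoid p Y.toRingedSpace U →
      ∃ φR : Y.sections U →+* Y.sections U, Y.IsLocalLift φ U φR) ∧
    ∃ (P : TopCat.Sheaf CommRingCat.{u} X.carrier)
      (θ : Y.toRingedSpace.presheaf ⟶
        (TopCat.Presheaf.pushforward CommRingCat.{u} i.hom.base).obj P.presheaf),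
      -- the sections over `X ∩ Spf R` are the prismatic envelope, for every local lift
      i.ComputesEnvelopes φ P θ ∧
      -- and this determines `(P, θ)` up to unique isomorphism
      (∀ (P' : TopCat.Sheaf CommRingCat.{u} X.carrier)
        (θ' : Y.toRingedSpace.presheaf ⟶
          (TopCat.Presheaf.pushforward CommRingCat.{u} i.hom.base).obj P'.presheaf),
        i.ComputesEnvelopes φ P' θ' →
        ∃! e : P ≅ P', ∀ (U : Opens Y.toRingedSpace) (r : Y.sections U),
          e.hom.hom.app (op (i.inter U)) (θ.app (op U) r) = θ'.app (op U) r) ∧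
      -- `P / p` is an `𝒪_X`-algebra compatibly with `θ`, in a unique way
      ∃ σ : X.sheaf ⟶ modPow p 1 P.presheaf,
        i.IsReduction P θ σ ∧
        (∀ σ' : X.sheaf ⟶ modPow p 1 P.presheaf, i.IsReduction P θ σ' → σ' = σ) ∧
        -- it is quasi-coherent
        (asModule σ).IsQuasicoherent ∧
        ∀ V : X.Opens, IsAffineOpen V →
          -- `Γ(V, P)` is `p`-adically complete
          IsAdicComplete (Ideal.span {(p : P.presheaf.obj (op V))}) (P.presheaf.obj (op V)) ∧
          -- `Γ(V, P) / p → Γ(V, P / p)` is an isomorphism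
          Function.Bijective ((quotientToModPow p 1 P.presheaf).app (op V)) ∧
          -- `Γ(V_f, P)` is the completed localization of `Γ(V, P)` at any lift `g` of `f`
          ∀ (f : Γ(X, V)) (g : P.presheaf.obj (op V)),
            (toModPow p 1 P.presheaf).app (op V) g = σ.hom.app (op V) f →
            ∃ e : CompletedLocalization p (P.presheaf.obj (op V)) g ≃+*
                P.presheaf.obj (op (X.basicOpen f)),
              ∀ x : P.presheaf.obj (op V),
                e (algebraMap _ (CompletedLocalization p (P.presheaf.obj (op V)) g) x) =
                  P.presheaf.map (homOfLE (X.basicOpen_le f)).op x := by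
  have h : i.Admissible φ :=
    { torsionFree := hY.torsionFree hA.torsionFree
      natCast_eq_zero := hi.natCast_eq_zero
      isFrobeniusLift := hφ
      exists_isLocalLift := fun U hU => hY.exists_isLocalLift hA.torsionFree hφA hU }
  obtain ⟨P, θ, hP⟩ := h.exists_computesEnvelopes
  obtain ⟨σ, hσ⟩ := hP.exists_isReduction h
  refine ⟨h.exists_isLocalLift, P, θ, hP, fun P' θ' hP' => hP.existsUnique_iso h hP', σ, hσ,
    fun σ' hσ' => ClosedImmersion.ComputesEnvelopes.isReduction_unique h hσ hσ',
    hP.isQuasicoherent h hσ, fun V hV => ⟨(hP.tfComplete h V).complete,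
    quotientToModPow_bijective P.2 (hP.torsionFree h) 1 V
      (hP.reduce_surjective_of_isAffineOpen h hσ hV), fun f g hg => ?_⟩⟩
  exact (hP.ploc_of_isAffineOpen h hσ hV hg).exists_equiv (hP.torsionFree h V) (hP.tfComplete h _)
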